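/- **Problem.** Let $m\ge 1$, let $X\subset\mathbb{R}^d$ be convex and compact with $\|x-x'\|\le D$ on $X$, let $f_0,\dots,f_m:\mathbb{R}^d\to\mathbb{R}\cup\{+\infty\}$, $f=f_0$, $g=\max_{1\le i\le m}f_i$, and consider $\min_{x\in X}f(x)$ s.t. $g(x)\le 0$. Let $\partial h(x)=\{v: h(y)\ge h(x)+v^\top(y-x)+o(\|y-x\|),\ y\to x\}$. Fix $\varepsilon,\sigma,\rho_\varepsilon>0$ and $\rho,M\ge0$ and assume: (1a) each $f_i$ is closed, $\partial f_i(x)\ne\emptyset$ for $x\in X$, and $f_i(x)\ge f_i(x')+v^\top(x-x')-\frac{\rho}{2}\|x-x'\|^2$ for $x,x'\in X$, $v\in\partial f_i(x')$; (1b) for every $x\in X$ with $g(x)\le\varepsilon^2$, $\min_{y\in X}\{g(y)+\frac{\rho+\rho_\varepsilon}{2}\|y-x\|^2\}<-\sigma$; (1c) $f$ is bounded below on $X$, and $\|v\|\le M$ for all $v\in\partial f_i(x)$, $x\in X$, $0\le i\le m$; (2) with a random sample $s$ one can compute at every $x\in X$ estimates $\theta_i(x)=\theta_i(x,s)$ and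 $\zeta_i(x)=\zeta_i(x,s)$, jointly measurable, with $\mathbb{E}\theta_i(x)=f_i(x)$, $\mathbb{E}\zeta_i(x)\in\partial f_i(x)$ for $0\le i\le m$, and almost surely $\|(\theta_1(x),\dots,\theta_m(x))\|\le M_0$ and $\|\zeta_i(x)\|\le M_1$. Let $\hat\rho\in(\rho,\rho+\rho_\varepsilon]$. For $x_t\in X$ put $F_i(x)=f_i(x)+\frac{\hat\rho}{2}\|x-x_t\|^2$, $F=F_0$, $G=\max_{1\le i\le m}F_i$, and let $\hat x_t$ be the minimizer of $F$ over $\{x\in X: G(x)\le0\}$. **Algorithm 3** (input $x_t$, $K\ge 1$): $z_0=x_t$, $Q_0=0\in\mathbb{R}^m$. For $k=0,\dots,K-1$, draw a fresh independent sample, set $\tilde\theta_i^k=\theta_i(z_k)+\frac{\hat\rho}{2}\|z_k-x_t\|^2$, $\tilde\zeta_i^k=\zeta_i(z_k)+\hat\rho(z_k-x_t)$, $$z_{k+1}=\arg\min_{z\in X}\Big\{\big(\sqrt K\,\tilde\zeta_0^k+\textstyle\sum_{i=1}^mQ_k^i\tilde\zeta_i^k\big)^\top(z-z_k)+K\|z-z_k\|^2\Big\},\quad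 Q_{k+1}^i=\max\{Q_k^i+\tilde\theta_i^k+(\tilde\zeta_i^k)^\top(z_{k+1}-z_k),0\}.$$ Output $x_{t+1}=\frac1K\sum_{k=0}^{K-1}z_k$. **Bounds.** Let $\tilde M_0=M_0+\frac{\hat\rho\sqrt m D^2}{2}$, $\tilde M_1=M_1+\hat\rho D$, $H=\tilde M_0+\sqrt m\tilde M_1D$, $$\Lambda=\frac{\sigma}{2}+H+\frac{2D^2}{\sigma}+\frac{2\tilde M_1D+H^2}{\sigma}+\frac{8H^2}{\sigma}\log\Big[1+\frac{32H^2}{\sigma^2}e^{\sigma/(8H)}\Big]+\frac{8H^2}{\sigma}\log\frac{2K}{\delta},$$ $$\mathcal B_1=\frac{D^2+\tilde M_1^2/4+H^2/2+2\sqrt{2\log(8/\delta)}\,(H\Lambda+\tilde M_1D)}{\sqrt K},\qquad \mathcal B_2=\frac{\Lambda+\tilde M_1^2+\Lambda\sqrt m\,\tilde M_1^2/2+2\tilde M_0\sqrt{2\log(8m/\delta)}}{\sqrt K}.$$ **Theorem.** (i) For all $x_t\in X$ with $g(x_t)\le\varepsilon^2$, $K\ge1$ and $\delta\in(0,1)$: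 with probability at least $1-\delta$, Algorithm 3 gives $F(x_{t+1})-F(\hat x_t)\le\mathcal B_1$ and $F_i(x_{t+1})\le\mathcal B_2$ for all $i=1,\dots,m$ simultaneously. For each fixed $\delta$, $\mathcal B_1,\mathcal B_2=O(\log(K/\delta)/\sqrt K)$ as $K\to\infty$. (ii) There is a constant $C>0$, depending only on $m,D,M,M_0,M_1,\rho,\rho_\varepsilon,\sigma,\hat\rho$, such that for all $\hat\varepsilon>0$ and $\delta\in(0,1)$, with $e=\max\{1,1/\hat\varepsilon\}$, every $$K\ \ge\ C\,e^{4}\,\big(1+\log\tfrac1\delta\big)\big(1+\log e+\log\tfrac1\delta\big)^2=\tilde O\big(\hat\varepsilon^{-4}\log\tfrac1\delta\big)$$ satisfies $\mathcal B_1\le\hat\varepsilon^2$ and $\mathcal B_2\le\hat\varepsilon^2$. Hence Algorithm 3 with such a $K=K(\hat\varepsilon,\delta)$ is an oracle for the subproblems at all $x_t\in X$ with $g(x_t)\le\varepsilon^2$: $x_{t+1}\in X$, and with probability at least $1-\delta$, $F(x_{t+1})-F(\hat x_t)\le\hat\varepsilon^2$ and $G(x_{t+1})\le\hat\varepsilon^2$.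 (iii) Consider Algorithm 1: start at $x_0\in X$ with $g(x_0)\le\varepsilon^2$; for $t=0,\dots,T-1$ let $x_{t+1}$ be the output of the oracle of (ii), run with fresh samples, at $x_t$ with failure probability $\delta/T$ and accuracy $$\hat\varepsilon=\min\Big\{1,\sqrt{\tfrac{\hat\rho-\rho}{4}}\Big(\tfrac{M+\hat\rho D}{\sqrt{2\sigma(\hat\rho-\rho)}}+1\Big)^{-1/2}\Big\}\varepsilon ,$$ i.e. with $K=\lceil C\hat\varepsilon^{-4}(1+\log\frac T\delta)(1+\log\frac1{\hat\varepsilon}+\log\frac T\delta)^2\rceil$ iterations; output $x_R$, $R$ uniform on $\{0,\dots,T\}$. There is a constant $C'>0$, depending only on the same constants, such that for all $\varepsilon\in(0,1]$ and $\delta\in(0,1)$ some $T\ge 1$ with $T\le C'/\varepsilon^2$, depending only on $\varepsilon$, $\delta$ and these constants, has the following property: all iterates lie in $X$, with probability at least $1-\delta$ one has $\mathbb{E}_R\|x_R-\hat x_R\|^2\le\varepsilon^2$, and the total number of samples at which the stochastic estimates are queried (equivalently, of iterations of Algorithm 3) is at most $$\frac{C'}{\varepsilon^{6}}\Big(1+\log\frac1{\varepsilon\delta}\Big)^3=\tilde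 O(\varepsilon^{-6}).$$ -/

import Mathlib

open MeasureTheory ProbabilityTheory Filter Topology Asymptotics

noncomputable section

namespace IPC

/-- `ℝ^d` with the `ℓ₂`-norm. -/
abbrev Vec (d : ℕ) := EuclideanSpace ℝ (Fin d)

/-! ## Subdifferentials and weak convexity -/

/-- The subdifferential of `h : ℝ^d → ℝ ∪ {+∞}` at `x`: all `v` such that
`h y ≥ h x + ⟨v, y - x⟩ + o(‖y - x‖)` as `y → x`. It is empty where `h` is not finite. -/
def subdifferential {d : ℕ} (h : Vec d → EReal) (x : Vec d) : Set (Vec d) :=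
  {v | h x ≠ ⊤ ∧ h x ≠ ⊥ ∧ ∀ c : ℝ, 0 < c → ∀ᶠ y in 𝓝 x,
    (((h x).toReal + inner ℝ v (y - x) - c * ‖y - x‖ : ℝ) : EReal) ≤ h y}

/-- `h` is `ρ`-weakly convex on `X`. -/
def WeaklyConvexOn {d : ℕ} (ρ : ℝ) (X : Set (Vec d)) (h : Vec d → EReal) : Prop :=
  ∀ x ∈ X, ∀ x' ∈ X, ∀ v ∈ subdifferential h x',
    (((h x').toReal + inner ℝ v (x - x') - ρ / 2 * ‖x - x'‖ ^ 2 : ℝ) : EReal) ≤ h x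

/-! ## The constrained problem

The data are a set `X` and functions `f 0, f 1, …, f m`; `f 0` is the objective and
`f i.succ`, `i : Fin m`, are the constraint functions. Under the assumptions below, all of them
are finite on `X`, and only their values on `X` are ever used. -/

/-- `g x = max_{1 ≤ i ≤ m} f_i x` (for `x ∈ X`, where the `f_i` are finite). -/
def constraintMax {m d : ℕ} (f : Fin (m + 1) → Vec d → EReal) (x : Vec d) : ℝ :=
  ⨆ i : Fin m, (f i.succ x).toReal

/-- The standing assumptions on the problem, with tolerance `ε`. The initial `ε ^ 2`-feasible
point is an input of the algorithms and appears as a separate hypothesis. -/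
structure ProblemAssumption {m d : ℕ} (X : Set (Vec d)) (f : Fin (m + 1) → Vec d → EReal)
    (ρ ε σ ρε D M : ℝ) : Prop where
  convex : Convex ℝ X
  compact : IsCompact X
  ne_bot : ∀ i x, f i x ≠ ⊥
  closed : ∀ i, LowerSemicontinuous (f i)
  weaklyConvex : ∀ i, WeaklyConvexOn ρ X (f i)
  subdifferential_nonempty : ∀ i, ∀ x ∈ X, (subdifferential (f i) x).Nonempty
  /-- the uniform Slater condition -/
  slater : ∀ x ∈ X, constraintMax f x ≤ ε ^ 2 →
    ∃ y ∈ X, constraintMax f y + (ρ + ρε) / 2 * ‖y - x‖ ^ 2 < -σ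
  diam : ∀ x ∈ X, ∀ x' ∈ X, ‖x - x'‖ ≤ D
  lower_bound : ∃ flb : ℝ, ∀ x ∈ X, flb ≤ (f 0 x).toReal
  subgradient_bound : ∀ i, ∀ x ∈ X, ∀ v ∈ subdifferential (f i) x, ‖v‖ ≤ M

/-! ## The proximal subproblem at `xt` -/

/-- `F_i(x) = f_i(x) + (ρ̂ / 2) ‖x - xt‖ ^ 2`; `F = F_0`. -/
def proxFun {m d : ℕ} (f : Fin (m + 1) → Vec d → EReal) (ρhat : ℝ) (xt : Vec d)
    (i : Fin (m + 1)) (x : Vec d) : ℝ :=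
  (f i x).toReal + ρhat / 2 * ‖x - xt‖ ^ 2

/-- `G(x) = g(x) + (ρ̂ / 2) ‖x - xt‖ ^ 2`. -/
def proxConstraint {m d : ℕ} (f : Fin (m + 1) → Vec d → EReal) (ρhat : ℝ) (xt : Vec d)
    (x : Vec d) : ℝ :=
  constraintMax f x + ρhat / 2 * ‖x - xt‖ ^ 2

/-- `y` is the solution `x̂_t` of the subproblem `min {F x : x ∈ X, G x ≤ 0}` at `xt`. -/
def IsProxSolution {m d : ℕ} (X : Set (Vec d)) (f : Fin (m + 1) → Vec d → EReal) (ρhat : ℝ)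
    (xt y : Vec d) : Prop :=
  y ∈ X ∧ proxConstraint f ρhat xt y ≤ 0 ∧
    ∀ w ∈ X, proxConstraint f ρhat xt w ≤ 0 → proxFun f ρhat xt 0 y ≤ proxFun f ρhat xt 0 w

/-! ## Stochastic estimates -/

/-- Stochastic estimates: on drawing a sample `s : Ξ`, a query at `x` returns the values
`θ i x s` and the vectors `ζ i x s`, `0 ≤ i ≤ m`. -/
structure Estimator (m d : ℕ) (Ξ : Type*) where
  θ : Fin (m + 1) → Vec d → Ξ → ℝ
  ζ : Fin (m + 1) → Vec d → Ξ → Vec d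

/-- The estimates are unbiased and almost surely bounded on `X`; `P` is the law of a sample. -/
structure EstimatorAssumption {m d : ℕ} {Ξ : Type*} [MeasurableSpace Ξ] (X : Set (Vec d))
    (f : Fin (m + 1) → Vec d → EReal) (S : Estimator m d Ξ) (P : Measure Ξ) (M0 M1 : ℝ) :
    Prop where
  measurable_θ : ∀ i, Measurable fun p : Vec d × Ξ => S.θ i p.1 p.2
  measurable_ζ : ∀ i, Measurable fun p : Vec d × Ξ => S.ζ i p.1 p.2
  unbiased_θ : ∀ i, ∀ x ∈ X, Integrable (S.θ i x) P ∧ ∫ s, S.θ i x s ∂P = (f i x).toReal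
  unbiased_ζ : ∀ i, ∀ x ∈ X,
    Integrable (S.ζ i x) P ∧ ∫ s, S.ζ i x s ∂P ∈ subdifferential (f i) x
  bound_θ : ∀ x ∈ X, ∀ᵐ s ∂P, √(∑ i : Fin m, S.θ i.succ x s ^ 2) ≤ M0
  bound_ζ : ∀ i, ∀ x ∈ X, ∀ᵐ s ∂P, ‖S.ζ i x s‖ ≤ M1

/-- `ξ` is a family of independent samples with common law `P`. -/
structure IsIIDSample {ι Ω Ξ : Type*} [MeasurableSpace Ω] [MeasurableSpace Ξ]
    (ξ : ι → Ω → Ξ) (P : Measure Ξ) (μ : Measure Ω) : Prop where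
  measurable : ∀ j, Measurable (ξ j)
  law : ∀ j, μ.map (ξ j) = P
  indep : iIndepFun ξ μ

/-! ## The online stochastic subgradient method for the subproblem at `xt` -/

/-- A minimizer of `φ` over `X` (an arbitrary point if there is none). -/
def argminOn {d : ℕ} (X : Set (Vec d)) (φ : Vec d → ℝ) : Vec d :=
  Classical.epsilon fun z => z ∈ X ∧ ∀ w ∈ X, φ z ≤ φ w

/-- State of the method: the iterate, the virtual queues, and the number of samples at which the
stochastic estimates have been queried so far. -/
structure YuState (m d : ℕ) where
  z : Vec d
  Q : Fin m → ℝ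
  queries : ℕ

/-- One iteration, with `V = √K`, `α = K` and the sample `s`. -/
def yuStep {m d : ℕ} {Ξ : Type*} (X : Set (Vec d)) (S : Estimator m d Ξ) (ρhat : ℝ) (K : ℕ)
    (xt : Vec d) (s : Ξ) (st : YuState m d) : YuState m d :=
  let θt : Fin (m + 1) → ℝ := fun i => S.θ i st.z s + ρhat / 2 * ‖st.z - xt‖ ^ 2
  let ζt : Fin (m + 1) → Vec d := fun i => S.ζ i st.z s + ρhat • (st.z - xt)
  let z' : Vec d := argminOn X fun w =>
    inner ℝ (√(K : ℝ) • ζt 0 + ∑ i : Fin m, st.Q i • ζt i.succ) (w - st.z)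
      + (K : ℝ) * ‖w - st.z‖ ^ 2
  { z := z'
    Q := fun i => max (st.Q i + θt i.succ + inner ℝ (ζt i.succ) (z' - st.z)) 0
    queries := st.queries + 1 }

/-- The state after `k` iterations, started at `z_0 = xt`, `Q_0 = 0`; iteration `k` uses `s k`. -/
def yuState {m d : ℕ} {Ξ : Type*} (X : Set (Vec d)) (S : Estimator m d Ξ) (ρhat : ℝ) (K : ℕ)
    (xt : Vec d) (s : ℕ → Ξ) : ℕ → YuState m d
  | 0 => ⟨xt, fun _ => 0, 0⟩
  | k + 1 => yuStep X S ρhat K xt (s k) (yuState X S ρhat K xt s k)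

/-- The output `(1 / K) ∑_{k < K} z_k` of the run with `K` iterations. -/
def yuOutput {m d : ℕ} {Ξ : Type*} (X : Set (Vec d)) (S : Estimator m d Ξ) (ρhat : ℝ) (K : ℕ)
    (xt : Vec d) (s : ℕ → Ξ) : Vec d :=
  (K : ℝ)⁻¹ • ∑ k ∈ Finset.range K, (yuState X S ρhat K xt s k).z

/-! ## Oracles for the subproblem -/

/-- A (randomized) algorithm `A`, taking the point `x`, the accuracy `εhat` and the failure
probability `δ`, is an oracle for the subproblems at the points of `N`: its output lies in `X`,
and with probability at least `1 - δ` it is `εhat ^ 2`-optimal and `εhat ^ 2`-feasible. -/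
def IsOracle {m d : ℕ} {Ω : Type*} [MeasurableSpace Ω] (X : Set (Vec d))
    (f : Fin (m + 1) → Vec d → EReal) (ρhat : ℝ) (N : Set (Vec d)) (μ : Measure Ω)
    (A : Vec d → ℝ → ℝ → Ω → Vec d) : Prop :=
  ∀ x ∈ N, ∀ εhat δ : ℝ, 0 < εhat → 0 < δ → δ < 1 →
    (∀ ω, A x εhat δ ω ∈ X) ∧
    μ {ω | ¬ ∃ xh, IsProxSolution X f ρhat x xh ∧
      proxFun f ρhat x 0 (A x εhat δ ω) - proxFun f ρhat x 0 xh ≤ εhat ^ 2 ∧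
      proxConstraint f ρhat x (A x εhat δ ω) ≤ εhat ^ 2} ≤ ENNReal.ofReal δ

/-! ## The inexact proximally constrained method, with the above method as oracle -/

/-- State of the method: the iterate and the total number of samples queried so far. -/
structure IPCState (d : ℕ) where
  x : Vec d
  queries : ℕ

/-- The state after `t` outer iterations, started at `x0`, each of which runs `K` iterations of
the online stochastic subgradient method; outer iteration `t` uses the samples `s t`. -/
def ipcState {m d : ℕ} {Ξ : Type*} (X : Set (Vec d)) (S : Estimator m d Ξ) (ρhat : ℝ) (K : ℕ)
    (x0 : Vec d) (s : ℕ → ℕ → Ξ) : ℕ → IPCState d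
  | 0 => ⟨x0, 0⟩
  | t + 1 =>
    let st := ipcState X S ρhat K x0 s t
    { x := yuOutput X S ρhat K st.x (s t)
      queries := st.queries + (yuState X S ρhat K st.x (s t) K).queries }

/-- The subproblem accuracy `ε̂` that the method uses for the tolerance `ε`. -/
def epsHat (ρ ρhat D M σ ε : ℝ) : ℝ :=
  min 1 (√((ρhat - ρ) / 4) *
    (√((M + ρhat * D) / √(2 * σ * (ρhat - ρ)) + 1))⁻¹) * ε

/-! ## The explicit bounds -/

/-- Bound `M̃₀` on the vector of stochastic values of `F_1, …, F_m`. -/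
def tildeM0 (m : ℕ) (D ρhat M0 : ℝ) : ℝ := M0 + ρhat * √(m : ℝ) * D ^ 2 / 2

/-- Bound `M̃₁` on the stochastic subgradients of `F_0, …, F_m`. -/
def tildeM1 (D ρhat M1 : ℝ) : ℝ := M1 + ρhat * D

/-- `H = M̃₀ + √m M̃₁ D`. -/
def boundH (D M0 M1 : ℝ) (m : ℕ) : ℝ := M0 + √(m : ℝ) * M1 * D

/-- `Λ(D, M̃₀, M̃₁, m, σ, K, δ)`. -/
def boundLambda (D M0 M1 : ℝ) (m : ℕ) (σ : ℝ) (K : ℕ) (δ : ℝ) : ℝ :=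
  σ / 2 + boundH D M0 M1 m + 2 * D ^ 2 / σ + (2 * M1 * D + boundH D M0 M1 m ^ 2) / σ
    + 8 * boundH D M0 M1 m ^ 2 / σ *
        Real.log (1 + 32 * boundH D M0 M1 m ^ 2 / σ ^ 2 * Real.exp (σ / (8 * boundH D M0 M1 m)))
    + 8 * boundH D M0 M1 m ^ 2 / σ * Real.log (2 * K / δ)

/-- `B₁(D, M̃₀, M̃₁, m, σ, K, δ)`, the bound on the objective gap. -/
def boundB1 (D M0 M1 : ℝ) (m : ℕ) (σ : ℝ) (K : ℕ) (δ : ℝ) : ℝ :=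
  (D ^ 2 + M1 ^ 2 / 4 + boundH D M0 M1 m ^ 2 / 2
    + 2 * √(2 * Real.log (8 / δ)) *
        (boundH D M0 M1 m * boundLambda D M0 M1 m σ K δ + M1 * D)) / √(K : ℝ)

/-- `B₂(D, M̃₀, M̃₁, m, σ, K, δ)`, the bound on the constraint violations. -/
def boundB2 (D M0 M1 : ℝ) (m : ℕ) (σ : ℝ) (K : ℕ) (δ : ℝ) : ℝ :=
  (boundLambda D M0 M1 m σ K δ + M1 ^ 2 + boundLambda D M0 M1 m σ K δ * √(m : ℝ) * M1 ^ 2 / 2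
    + 2 * M0 * √(2 * Real.log (8 * m / δ))) / √(K : ℝ)

/-- `C e⁴ (1 + log(1/δ)) (1 + log e + log(1/δ))²` with `e = max 1 (1/ε̂)`. -/
def iterBudget (C εhat δ : ℝ) : ℝ :=
  C * (max 1 εhat⁻¹) ^ 4 * (1 + Real.log δ⁻¹) *
    (1 + Real.log (max 1 εhat⁻¹) + Real.log δ⁻¹) ^ 2

end IPC

end

open IPC

/-!
The method is analysed for a fixed starting point `xt`, where the subproblem is a strongly convex
program with unbiased, bounded estimates (`StochasticProgram`), and the one-step inequality
`pdStep_drift` compares an iteration with an arbitrary point `w` of `X`.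

*Queues.* Take for `w` a Slater point `y`. The inequality says that
`‖Q‖² + 2 K ‖y - z‖²` grows in one step by at most `2 (c + U)`, where `U` is bounded by `H ‖Q‖` and
has conditional mean at most `-σ ‖Q‖`. Let `W` be the square root of this Lyapunov function. Then
`W` grows by at most `(c + U) / W`, so by Hoeffding's lemma `exp (r W)`, `r = σ / H²`, does not grow
in mean when `‖Q‖ ≥ 2 c / σ`, while otherwise `W` is of order `√K` anyway. Hence `E exp (r W_k)`
grows at most linearly in `k`, and Markov's inequality gives `‖Q_k‖ ≤ √K Λ` for all `k ≤ K` with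
probability at least `1 - δ / 2` (`StochasticProgram.measure_queue_ge_le`). Including the distance
to `y` in the Lyapunov function makes the drift negative at every single step, so no blocks of
iterations are needed.

*Bounds.* Taking `w = x̂` and summing bounds the regret by the queue drift towards `x̂`, whose
conditional mean is nonpositive; the queue recursion bounds the sums of the constraint estimates by
`‖Q_K‖` and the step lengths. Replacing the estimates by their means costs three martingale
deviations, which the Azuma–Hoeffding inequality controls, and convexity passes to the average of
the iterates (`StochasticProgram.measure_not_bounds_le`). Conditional expectations are avoided
throughout: the fresh sample is independent of the past, so it is integrated out by Fubini's theorem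
(`IsSampleFiltration.lintegral_mul_le`).

*Budget.* Both bounds are of order `√(1 + log (1/δ)) (1 + log K + log (1/δ)) / √K`, uniformly in
`K` and `δ` (`bounds_le`), which is inverted in `le_sq_of_iterBudget_le`.

*Outer method.* Each subproblem has a Lagrange multiplier at most `(M + ρ̂ D) / √(2 σ (ρ̂ - ρ))`,
and the Lagrangian grows quadratically at `x̂_t` (`ProblemAssumption.exists_multiplier`). A step
therefore decreases the objective by a multiple of `‖x_t - x̂_t‖²`, up to terms of order `ε̂²`, and
summation bounds the average (`ProblemAssumption.sum_sq_dist_le`). The failure event of a step is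
jointly measurable in its input and its samples, because the pairs `(x, r)` with optimal value at
most `r` form a closed set; so the bound for a fixed starting point holds at the random iterates,
which are independent of the fresh samples (`ProblemAssumption.measure_step_failure_le`).
-/

namespace IPC

/-! ### Minimization over a compact convex set -/

lemma nonneg_of_forall_add_mul_nonneg {a b : ℝ}
    (h : ∀ t : ℝ, 0 < t → t ≤ 1 → 0 ≤ a + t * b) : 0 ≤ a := by
  have hlim : Tendsto (fun t : ℝ => a + t * b) (𝓝[>] 0) (𝓝 a) := by
    have : Tendsto (fun t : ℝ => a + t * b) (𝓝 0) (𝓝 (a + 0 * b)) :=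
      (continuous_const.add (continuous_id.mul continuous_const)).tendsto 0
    rw [zero_mul, add_zero] at this
    exact this.mono_left nhdsWithin_le_nhds
  refine ge_of_tendsto hlim ?_
  filter_upwards [Ioc_mem_nhdsGT (show (0 : ℝ) < 1 by norm_num)] with t ht
  exact h t ht.1 ht.2

variable {d : ℕ} {X : Set (Vec d)}

lemma argminOn_spec {φ : Vec d → ℝ} (hX : IsCompact X) (hne : X.Nonempty)
    (hφ : ContinuousOn φ X) : argminOn X φ ∈ X ∧ ∀ w ∈ X, φ (argminOn X φ) ≤ φ w := by
  obtain ⟨z, hz, hmin⟩ := hX.exists_isMinOn hne hφ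
  exact Classical.epsilon_spec (p := fun z => z ∈ X ∧ ∀ w ∈ X, φ z ≤ φ w) ⟨z, hz, hmin⟩

/-- The Euclidean projection onto `X`. -/
noncomputable def nearest (X : Set (Vec d)) (u : Vec d) : Vec d :=
  argminOn X fun w => ‖w - u‖ ^ 2

lemma nearest_spec (hX : IsCompact X) (hne : X.Nonempty) (u : Vec d) :
    nearest X u ∈ X ∧ ∀ w ∈ X, ‖nearest X u - u‖ ^ 2 ≤ ‖w - u‖ ^ 2 :=
  argminOn_spec hX hne (by fun_prop)

lemma inner_nearest_nonneg (hc : Convex ℝ X) (hX : IsCompact X) (u : Vec d) {w : Vec d}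
    (hw : w ∈ X) : 0 ≤ inner ℝ (nearest X u - u) (w - nearest X u) := by
  obtain ⟨hp, hmin⟩ := nearest_spec hX ⟨w, hw⟩ u
  set p := nearest X u
  suffices h : 0 ≤ 2 * inner ℝ (p - u) (w - p) by linarith
  refine nonneg_of_forall_add_mul_nonneg (b := ‖w - p‖ ^ 2) fun t ht ht1 => ?_
  have h1 := hmin _ (hc.add_smul_sub_mem hp hw ⟨ht.le, ht1⟩)
  have h2 : ‖p + t • (w - p) - u‖ ^ 2
      = ‖p - u‖ ^ 2 + t * (2 * inner ℝ (p - u) (w - p) + t * ‖w - p‖ ^ 2) := by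
    rw [show p + t • (w - p) - u = (p - u) + t • (w - p) by abel, norm_add_sq_real,
      inner_smul_right, norm_smul, mul_pow, Real.norm_eq_abs, sq_abs]
    ring
  rw [h2] at h1
  exact nonneg_of_mul_nonneg_right (by linarith) ht

lemma norm_nearest_sub_nearest_le (hc : Convex ℝ X) (hX : IsCompact X) (hne : X.Nonempty)
    (u v : Vec d) : ‖nearest X u - nearest X v‖ ≤ ‖u - v‖ := by
  have h1 := inner_nearest_nonneg hc hX u (nearest_spec hX hne v).1
  have h2 := inner_nearest_nonneg hc hX v (nearest_spec hX hne u).1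
  set p := nearest X u
  set q := nearest X v
  have h3 : ‖p - q‖ ^ 2 ≤ inner ℝ (u - v) (p - q) := by
    have e : inner ℝ (u - v) (p - q) - inner ℝ (p - q) (p - q)
        = inner ℝ (p - u) (q - p) + inner ℝ (q - v) (p - q) := by
      simp only [inner_sub_left, inner_sub_right]; ring
    rw [real_inner_self_eq_norm_sq] at e
    linarith
  have h4 := h3.trans (real_inner_le_norm (u - v) (p - q))
  by_contra! hlt
  have : 0 < ‖p - q‖ := (norm_nonneg _).trans_lt hlt
  nlinarith

lemma continuous_nearest (hc : Convex ℝ X) (hX : IsCompact X) (hne : X.Nonempty) :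
    Continuous (nearest X) :=
  (LipschitzWith.of_dist_le_mul (K := 1) fun u v => by
    simpa [dist_eq_norm] using norm_nearest_sub_nearest_le hc hX hne u v).continuous

/-- Completing the square: a linearized proximal step is a projected gradient step. -/
lemma argminOn_linear_add_sq (a z : Vec d) {c : ℝ} (hc : 0 < c) :
    argminOn X (fun w => inner ℝ a (w - z) + c * ‖w - z‖ ^ 2)
      = nearest X (z - (2 * c)⁻¹ • a) := by
  have key : ∀ w : Vec d, inner ℝ a (w - z) + c * ‖w - z‖ ^ 2
      = c * ‖w - (z - (2 * c)⁻¹ • a)‖ ^ 2 - (4 * c)⁻¹ * ‖a‖ ^ 2 := by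
    intro w
    rw [show w - (z - (2 * c)⁻¹ • a) = (w - z) + (2 * c)⁻¹ • a by abel, norm_add_sq_real,
      inner_smul_right, norm_smul, mul_pow, Real.norm_eq_abs, sq_abs, real_inner_comm]
    field_simp
    ring
  unfold nearest argminOn
  congr 1
  funext y
  simp only [key, sub_le_sub_iff_right, mul_le_mul_iff_right₀ hc]

lemma argminOn_linear_add_sq_mem (hX : IsCompact X) (hne : X.Nonempty) (a z : Vec d) (c : ℝ) :
    argminOn X (fun w => inner ℝ a (w - z) + c * ‖w - z‖ ^ 2) ∈ X :=
  (argminOn_spec hX hne (by fun_prop)).1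

/-- The three-point inequality for a linearized proximal step. -/
lemma argminOn_three_point (hconv : Convex ℝ X) (hX : IsCompact X) (a z : Vec d) {c : ℝ}
    (hc : 0 < c) {p w : Vec d} (hw : w ∈ X)
    (hp : p = argminOn X fun w => inner ℝ a (w - z) + c * ‖w - z‖ ^ 2) :
    inner ℝ a (p - z) + c * ‖p - z‖ ^ 2 + c * ‖w - p‖ ^ 2
      ≤ inner ℝ a (w - z) + c * ‖w - z‖ ^ 2 := by
  rw [argminOn_linear_add_sq a z hc] at hp
  have h := inner_nearest_nonneg hconv hX (z - (2 * c)⁻¹ • a) hw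
  rw [← hp, show p - (z - (2 * c)⁻¹ • a) = (p - z) + (2 * c)⁻¹ • a by abel, inner_add_left,
    real_inner_smul_left] at h
  have e1 : ‖w - z‖ ^ 2 = ‖w - p‖ ^ 2 + 2 * inner ℝ (p - z) (w - p) + ‖p - z‖ ^ 2 := by
    rw [show w - z = (w - p) + (p - z) by abel, norm_add_sq_real, real_inner_comm]
  have e2 : inner ℝ a (w - z) = inner ℝ a (w - p) + inner ℝ a (p - z) := by
    rw [← inner_add_right]; congr 1; abel
  have h' : 0 ≤ 2 * c * inner ℝ (p - z) (w - p) + inner ℝ a (w - p) := by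
    have := mul_nonneg (by positivity : (0 : ℝ) ≤ 2 * c) h
    field_simp at this
    linarith
  rw [e1, e2]
  nlinarith

/-! ### Fresh samples and exponential supermartingales -/

/-- The samples `ξ k` have law `P`, `ξ k` is independent of the past `𝓕 k`, and it is known
from time `k + 1` on. -/
structure IsSampleFiltration {Ω Ξ : Type*} [mΩ : MeasurableSpace Ω] [MeasurableSpace Ξ]
    (𝓕 : ℕ → MeasurableSpace Ω) (ξ : ℕ → Ω → Ξ) (P : Measure Ξ) (μ : Measure Ω) : Prop where
  le : ∀ k, 𝓕 k ≤ mΩ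
  mono : Monotone 𝓕
  measurable_succ : ∀ k, Measurable[𝓕 (k + 1)] (ξ k)
  law : ∀ k, μ.map (ξ k) = P
  indep : ∀ k, Indep (𝓕 k) (MeasurableSpace.comap (ξ k) inferInstance) μ

section Fresh

variable {Ω Ξ 𝒴 : Type*} [mΩ : MeasurableSpace Ω] [MeasurableSpace Ξ] [MeasurableSpace 𝒴]
  {𝓕 : ℕ → MeasurableSpace Ω} {ξ : ℕ → Ω → Ξ} {P : Measure Ξ} {μ : Measure Ω}

lemma IsSampleFiltration.measurable (h : IsSampleFiltration 𝓕 ξ P μ) (k : ℕ) :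
    Measurable (ξ k) :=
  (h.measurable_succ k).mono (h.le _) le_rfl

/-- Conditionally on the past, the fresh sample can be integrated out. -/
lemma IsSampleFiltration.lintegral_mul_le [IsProbabilityMeasure μ] [IsProbabilityMeasure P]
    (h : IsSampleFiltration 𝓕 ξ P μ) (k : ℕ) {g : Ω → ENNReal} (hg : Measurable[𝓕 k] g)
    {Y : Ω → 𝒴} (hY : Measurable[𝓕 k] Y) {ψ : 𝒴 → Ξ → ENNReal}
    (hψ : Measurable (Function.uncurry ψ)) {c : ENNReal}
    (hc : ∀ ω, ∫⁻ s, ψ (Y ω) s ∂P ≤ c) :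
    ∫⁻ ω, g ω * ψ (Y ω) (ξ k ω) ∂μ ≤ c * ∫⁻ ω, g ω ∂μ := by
  have hgY : Measurable[𝓕 k] fun ω => (g ω, Y ω) := hg.prodMk hY
  have hgY' : Measurable fun ω => (g ω, Y ω) := hgY.mono (h.le k) le_rfl
  have hind : IndepFun (fun ω => (g ω, Y ω)) (ξ k) μ := by
    rw [IndepFun_iff_Indep]
    exact indep_of_indep_of_le_left (h.indep k) hgY.comap_le
  have hmap := hind.map_prod_eq_prod_map_map hgY'.aemeasurable (h.measurable k).aemeasurable
  rw [h.law k] at hmap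
  have hm : Measurable fun p : (ENNReal × 𝒴) × Ξ => p.1.1 * ψ p.1.2 p.2 :=
    (measurable_fst.comp measurable_fst).mul
      (hψ.comp ((measurable_snd.comp measurable_fst).prodMk measurable_snd))
  calc ∫⁻ ω, g ω * ψ (Y ω) (ξ k ω) ∂μ
      = ∫⁻ p, p.1.1 * ψ p.1.2 p.2 ∂(μ.map fun ω => ((g ω, Y ω), ξ k ω)) := by
        rw [lintegral_map hm (hgY'.prodMk (h.measurable k))]
    _ = ∫⁻ q, ∫⁻ s, q.1 * ψ q.2 s ∂P ∂(μ.map fun ω => (g ω, Y ω)) := by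
        rw [hmap, lintegral_prod _ hm.aemeasurable]
    _ = ∫⁻ ω, ∫⁻ s, g ω * ψ (Y ω) s ∂P ∂μ := by
        rw [lintegral_map hm.lintegral_prod_right' hgY']
    _ ≤ ∫⁻ ω, c * g ω ∂μ := by
        refine lintegral_mono fun ω => ?_
        rw [lintegral_const_mul (g ω) (f := ψ (Y ω)) (hψ.comp measurable_prodMk_left), mul_comm c]
        gcongr
        exact hc ω
    _ = c * ∫⁻ ω, g ω ∂μ := lintegral_const_mul _ (hg.mono (h.le k) le_rfl)

lemma IsSampleFiltration.ae_of_ae [IsProbabilityMeasure μ] [IsProbabilityMeasure P]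
    (h : IsSampleFiltration 𝓕 ξ P μ) (k : ℕ) {Y : Ω → 𝒴} (hY : Measurable[𝓕 k] Y)
    {p : 𝒴 → Ξ → Prop} (hp : MeasurableSet {q : 𝒴 × Ξ | p q.1 q.2})
    (hae : ∀ ω, ∀ᵐ s ∂P, p (Y ω) s) : ∀ᵐ ω ∂μ, p (Y ω) (ξ k ω) := by
  have hY' : Measurable Y := hY.mono (h.le k) le_rfl
  have hψ : Measurable (Function.uncurry fun y s =>
      Set.indicator {q : 𝒴 × Ξ | p q.1 q.2}ᶜ (fun _ => (1 : ENNReal)) (y, s)) :=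
    measurable_const.indicator hp.compl
  have h0 := h.lintegral_mul_le k (g := fun _ => 1) measurable_const hY hψ (c := 0) fun ω => by
    rw [nonpos_iff_eq_zero]
    refine lintegral_eq_zero_of_ae_eq_zero ?_
    filter_upwards [hae ω] with s hs
    simp [hs]
  simp only [one_mul, zero_mul, nonpos_iff_eq_zero] at h0
  rw [lintegral_eq_zero_iff] at h0
  · filter_upwards [h0] with ω hω
    by_contra hn
    simp [hn] at hω
  · exact hψ.comp (hY'.prodMk (h.measurable k))

/-- **Hoeffding's lemma** for a bounded variable with mean at most `a`. -/
lemma lintegral_exp_mul_le [IsProbabilityMeasure P] {U : Ξ → ℝ} (hU : Measurable U) {a b t : ℝ}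
    (ht : 0 ≤ t) (hb : ∀ᵐ s ∂P, |U s| ≤ b) (ha : ∫ s, U s ∂P ≤ a) :
    ∫⁻ s, ENNReal.ofReal (Real.exp (t * U s)) ∂P
      ≤ ENNReal.ofReal (Real.exp (t * a + t ^ 2 * b ^ 2 / 2)) := by
  have hIcc : ∀ᵐ s ∂P, U s ∈ Set.Icc (-b) b := by
    filter_upwards [hb] with s hs using abs_le.mp hs
  have hint : Integrable (fun s => Real.exp (t * U s)) P :=
    integrable_exp_mul_of_mem_Icc hU.aemeasurable hIcc
  rw [← ofReal_integral_eq_lintegral_ofReal hint (ae_of_all _ fun _ => (Real.exp_pos _).le)]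
  refine ENNReal.ofReal_le_ofReal ?_
  have h1 := (hasSubgaussianMGF_of_mem_Icc hU.aemeasurable hIcc).mgf_le t
  have h2 : mgf (fun s => U s - P[U]) P t
      = Real.exp (-(t * P[U])) * ∫ s, Real.exp (t * U s) ∂P := by
    rw [mgf, ← integral_const_mul]
    congr 1
    funext s
    rw [← Real.exp_add]
    ring_nf
  have h3 : ((((‖b - -b‖₊ / 2) ^ 2 : NNReal)) : ℝ) = b ^ 2 := by
    push_cast
    rw [Real.norm_eq_abs, div_pow, sq_abs]
    ring
  rw [h2, h3] at h1
  calc ∫ s, Real.exp (t * U s) ∂P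
      = Real.exp (t * P[U]) * (Real.exp (-(t * P[U])) * ∫ s, Real.exp (t * U s) ∂P) := by
        rw [← mul_assoc, ← Real.exp_add, add_neg_cancel, Real.exp_zero, one_mul]
    _ ≤ Real.exp (t * P[U]) * Real.exp (b ^ 2 * t ^ 2 / 2) := by gcongr
    _ = Real.exp (t * P[U] + b ^ 2 * t ^ 2 / 2) := (Real.exp_add _ _).symm
    _ ≤ _ := by
        refine Real.exp_le_exp.mpr ?_
        have := mul_le_mul_of_nonneg_left ha ht
        linarith

lemma measure_le_of_lintegral_exp_le {S : Ω → ℝ} {t w : ℝ} {c : ENNReal}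
    (h : ∫⁻ ω, ENNReal.ofReal (Real.exp (t * S ω)) ∂μ ≤ c) (hS : Measurable S) (ht : 0 ≤ t) :
    μ {ω | w ≤ S ω} ≤ ENNReal.ofReal (Real.exp (-(t * w))) * c := by
  have hpos : 0 < Real.exp (t * w) := Real.exp_pos _
  have hne : ENNReal.ofReal (Real.exp (t * w)) ≠ 0 := by
    simpa using hpos
  calc μ {ω | w ≤ S ω}
      ≤ μ {ω | ENNReal.ofReal (Real.exp (t * w)) ≤ ENNReal.ofReal (Real.exp (t * S ω))} :=
        measure_mono fun ω (hω : w ≤ S ω) =>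
          ENNReal.ofReal_le_ofReal (Real.exp_le_exp.mpr (mul_le_mul_of_nonneg_left hω ht))
    _ ≤ (∫⁻ ω, ENNReal.ofReal (Real.exp (t * S ω)) ∂μ) / ENNReal.ofReal (Real.exp (t * w)) :=
        meas_ge_le_lintegral_div (by fun_prop) hne ENNReal.ofReal_ne_top
    _ ≤ c / ENNReal.ofReal (Real.exp (t * w)) := by gcongr
    _ = _ := by
        rw [Real.exp_neg, ENNReal.ofReal_inv_of_pos hpos, ENNReal.div_eq_inv_mul]

/-- The **Azuma–Hoeffding inequality** for increments `U (Y k) (ξ k) - a (Y k)`, where `Y k` is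
determined by the past and `a y` bounds the mean of `U y` under the law of a fresh sample. -/
lemma IsSampleFiltration.measure_sum_gt_le [IsProbabilityMeasure μ] [IsProbabilityMeasure P]
    (h : IsSampleFiltration 𝓕 ξ P μ) {Y : ℕ → Ω → 𝒴} (hY : ∀ k, Measurable[𝓕 k] (Y k))
    {U : 𝒴 → Ξ → ℝ} (hU : Measurable (Function.uncurry U)) {a : 𝒴 → ℝ} (ha : Measurable a)
    {b : ℝ} (hb0 : 0 ≤ b) (hb : ∀ k ω, ∀ᵐ s ∂P, |U (Y k ω) s| ≤ b)
    (hmean : ∀ k ω, ∫ s, U (Y k ω) s ∂P ≤ a (Y k ω)) {K : ℕ} (hK : 1 ≤ K) {L : ℝ} (hL : 0 ≤ L) :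
    μ {ω | b * √(2 * K * L) < ∑ k ∈ Finset.range K, (U (Y k ω) (ξ k ω) - a (Y k ω))}
      ≤ ENNReal.ofReal (Real.exp (-L)) := by
  set S : ℕ → Ω → ℝ := fun n ω => ∑ k ∈ Finset.range n, (U (Y k ω) (ξ k ω) - a (Y k ω)) with hS
  have hSm : ∀ n, Measurable[𝓕 n] (S n) := by
    intro n
    refine Finset.measurable_sum _ fun k hk => ?_
    have hk' : k + 1 ≤ n := Finset.mem_range.mp hk
    have hYk : Measurable[𝓕 n] (Y k) := (hY k).mono (h.mono (by omega)) le_rfl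
    have hξk : Measurable[𝓕 n] (ξ k) := (h.measurable_succ k).mono (h.mono hk') le_rfl
    exact (hU.comp (hYk.prodMk hξk)).sub (ha.comp hYk)
  have hexp : ∀ t : ℝ, 0 ≤ t → ∀ n, ∫⁻ ω, ENNReal.ofReal (Real.exp (t * S n ω)) ∂μ
      ≤ ENNReal.ofReal (Real.exp (n * (t ^ 2 * b ^ 2 / 2))) := by
    intro t ht n
    induction n with
    | zero => simp [hS]
    | succ n ih =>
      have hψ : Measurable (Function.uncurry fun y s =>
          ENNReal.ofReal (Real.exp (t * (U y s - a y)))) :=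
        ENNReal.measurable_ofReal.comp (Real.measurable_exp.comp
          ((hU.sub (ha.comp measurable_fst)).const_mul t))
      have hg : Measurable[𝓕 n] fun ω => ENNReal.ofReal (Real.exp (t * S n ω)) :=
        ENNReal.measurable_ofReal.comp (Real.measurable_exp.comp ((hSm n).const_mul t))
      have hstep := h.lintegral_mul_le n hg (hY n) hψ
        (c := ENNReal.ofReal (Real.exp (t ^ 2 * b ^ 2 / 2))) fun ω => by
          have h1 := lintegral_exp_mul_le (hU.comp measurable_prodMk_left) ht (hb n ω) (hmean n ω)
          calc ∫⁻ s, ENNReal.ofReal (Real.exp (t * (U (Y n ω) s - a (Y n ω)))) ∂P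
              = ∫⁻ s, ENNReal.ofReal (Real.exp (-(t * a (Y n ω))))
                  * ENNReal.ofReal (Real.exp (t * U (Y n ω) s)) ∂P := by
                congr 1; funext s
                rw [← ENNReal.ofReal_mul (Real.exp_pos _).le, ← Real.exp_add]
                ring_nf
            _ = ENNReal.ofReal (Real.exp (-(t * a (Y n ω))))
                  * ∫⁻ s, ENNReal.ofReal (Real.exp (t * U (Y n ω) s)) ∂P := by
                refine lintegral_const_mul _ ?_
                exact ENNReal.measurable_ofReal.comp (Real.measurable_exp.comp
                  ((hU.comp measurable_prodMk_left).const_mul t))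
            _ ≤ ENNReal.ofReal (Real.exp (-(t * a (Y n ω))))
                  * ENNReal.ofReal (Real.exp (t * a (Y n ω) + t ^ 2 * b ^ 2 / 2)) := by
                gcongr
                exact h1
            _ = ENNReal.ofReal (Real.exp (t ^ 2 * b ^ 2 / 2)) := by
                rw [← ENNReal.ofReal_mul (Real.exp_pos _).le, ← Real.exp_add]
                ring_nf
      calc ∫⁻ ω, ENNReal.ofReal (Real.exp (t * S (n + 1) ω)) ∂μ
          = ∫⁻ ω, ENNReal.ofReal (Real.exp (t * S n ω))
              * ENNReal.ofReal (Real.exp (t * (U (Y n ω) (ξ n ω) - a (Y n ω)))) ∂μ := by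
            congr 1; funext ω
            rw [← ENNReal.ofReal_mul (Real.exp_pos _).le, ← Real.exp_add]
            simp only [hS, Finset.sum_range_succ]
            ring_nf
        _ ≤ _ := hstep
        _ ≤ ENNReal.ofReal (Real.exp (t ^ 2 * b ^ 2 / 2))
              * ENNReal.ofReal (Real.exp (n * (t ^ 2 * b ^ 2 / 2))) := by gcongr
        _ = _ := by
            rw [← ENNReal.ofReal_mul (Real.exp_pos _).le, ← Real.exp_add]
            push_cast
            ring_nf
  have hKpos : (0 : ℝ) < K := by exact_mod_cast hK
  have hSK : Measurable (S K) := (hSm K).mono (h.le K) le_rfl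
  have htail : ∀ t w : ℝ, 0 ≤ t → μ {ω | w ≤ S K ω}
      ≤ ENNReal.ofReal (Real.exp (K * (t ^ 2 * b ^ 2 / 2) - t * w)) := by
    intro t w ht
    refine (measure_le_of_lintegral_exp_le (hexp t ht K) hSK ht).trans (le_of_eq ?_)
    rw [← ENNReal.ofReal_mul (Real.exp_pos _).le, ← Real.exp_add]
    ring_nf
  rcases hb0.eq_or_lt with rfl | hbpos
  · -- With `b = 0` the sum is almost surely nonpositive: let the exponent tend to infinity.
    have hnull : ∀ n : ℕ, μ {ω | ((n : ℝ) + 1)⁻¹ ≤ S K ω} = 0 := by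
      intro n
      have hlim : Tendsto (fun j : ℕ => ENNReal.ofReal (Real.exp (-(j * ((n : ℝ) + 1)⁻¹)))) atTop
          (𝓝 0) := by
        rw [← ENNReal.ofReal_zero]
        refine ENNReal.tendsto_ofReal (Real.tendsto_exp_neg_atTop_nhds_zero.comp ?_)
        exact tendsto_natCast_atTop_atTop.atTop_mul_const (by positivity)
      refine nonpos_iff_eq_zero.mp (ge_of_tendsto' hlim fun j => ?_)
      have := htail j ((n : ℝ) + 1)⁻¹ (by positivity)
      simpa using this
    have hsub : {ω | (0 : ℝ) * √(2 * K * L) < S K ω} ⊆ ⋃ n : ℕ, {ω | ((n : ℝ) + 1)⁻¹ ≤ S K ω} := by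
      intro ω hω
      simp only [zero_mul, Set.mem_ofPred_eq] at hω
      obtain ⟨n, hn⟩ := exists_nat_one_div_lt hω
      exact Set.mem_iUnion.mpr ⟨n, by simpa using hn.le⟩
    calc _ ≤ μ (⋃ n : ℕ, {ω | ((n : ℝ) + 1)⁻¹ ≤ S K ω}) := measure_mono hsub
      _ = 0 := measure_iUnion_null hnull
      _ ≤ _ := zero_le
  · set w := b * √(2 * K * L) with hw
    have hw0 : 0 ≤ w := by positivity
    have hw2 : w ^ 2 = b ^ 2 * (2 * K * L) := by
      rw [hw, mul_pow, Real.sq_sqrt (by positivity)]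
    refine (measure_mono fun ω (hω : w < S K ω) => hω.le).trans
      ((htail (w / (K * b ^ 2)) w (by positivity)).trans (le_of_eq ?_))
    congr 2
    have : K * ((w / (K * b ^ 2)) ^ 2 * b ^ 2 / 2) - w / (K * b ^ 2) * w
        = -(w ^ 2 / (2 * K * b ^ 2)) := by
      field_simp
      ring
    rw [this, hw2]
    field_simp

end Fresh

/-! ### The Euclidean norm of the queue vector -/

section EuclideanLength

variable {m : ℕ}

/-- The Euclidean norm of a vector of queue lengths (whose type carries the sup norm). -/
noncomputable def l2 (Q : Fin m → ℝ) : ℝ := √(∑ i, Q i ^ 2)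

lemma l2_nonneg (Q : Fin m → ℝ) : 0 ≤ l2 Q := Real.sqrt_nonneg _

lemma l2_sq (Q : Fin m → ℝ) : l2 Q ^ 2 = ∑ i, Q i ^ 2 :=
  Real.sq_sqrt (Finset.sum_nonneg fun _ _ => sq_nonneg _)

lemma l2_eq_norm (Q : Fin m → ℝ) : l2 Q = ‖WithLp.toLp 2 Q‖ := by
  simp [l2, EuclideanSpace.norm_eq]

lemma l2_add_le (Q R : Fin m → ℝ) : l2 (fun i => Q i + R i) ≤ l2 Q + l2 R := by
  rw [l2_eq_norm, l2_eq_norm, l2_eq_norm]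
  exact norm_add_le (WithLp.toLp 2 Q) (WithLp.toLp 2 R)

lemma l2_mono {Q R : Fin m → ℝ} (h : ∀ i, |Q i| ≤ |R i|) : l2 Q ≤ l2 R :=
  Real.sqrt_le_sqrt (Finset.sum_le_sum fun i _ => sq_le_sq.mpr (h i))

lemma l2_const (a : ℝ) : l2 (fun _ : Fin m => a) = √(m : ℝ) * |a| := by
  rw [l2, Finset.sum_const, Finset.card_univ, Fintype.card_fin, nsmul_eq_mul,
    Real.sqrt_mul (Nat.cast_nonneg m), Real.sqrt_sq_eq_abs]

lemma l2_le_of_abs_le {R : Fin m → ℝ} {a : ℝ} (ha : 0 ≤ a) (h : ∀ i, |R i| ≤ a) :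
    l2 R ≤ √(m : ℝ) * a := by
  have := l2_mono (Q := R) (R := fun _ => a) fun i => (h i).trans (le_abs_self a)
  rwa [l2_const, abs_of_nonneg ha] at this

lemma abs_sum_mul_le_l2 (Q R : Fin m → ℝ) : |∑ i, Q i * R i| ≤ l2 Q * l2 R := by
  refine abs_le_of_sq_le_sq ?_ (mul_nonneg (l2_nonneg _) (l2_nonneg _))
  rw [mul_pow, l2_sq, l2_sq]
  exact Finset.sum_mul_sq_le_sq_mul_sq _ _ _

lemma abs_le_l2 (Q : Fin m → ℝ) (i : Fin m) : |Q i| ≤ l2 Q :=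
  Real.abs_le_sqrt (Finset.single_le_sum (f := fun i => Q i ^ 2) (fun _ _ => sq_nonneg _)
    (Finset.mem_univ i))

lemma l2_le_sum {Q : Fin m → ℝ} (hQ : ∀ i, 0 ≤ Q i) : l2 Q ≤ ∑ i, Q i := by
  refine Real.sqrt_le_iff.mpr ⟨Finset.sum_nonneg fun i _ => hQ i, ?_⟩
  exact Finset.sum_sq_le_sq_sum_of_nonneg fun i _ => hQ i

lemma continuous_l2 : Continuous (l2 : (Fin m → ℝ) → ℝ) := by
  unfold l2; fun_prop

end EuclideanLength

/-! ### One iteration of the primal-dual method -/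

section Step

variable {m d : ℕ} {Ξ : Type*}

/-- One iteration on the pair of iterate and queues, for an arbitrary estimator. -/
noncomputable def pdStep (X : Set (Vec d)) (S : Estimator m d Ξ) (K : ℕ)
    (p : Vec d × (Fin m → ℝ)) (s : Ξ) : Vec d × (Fin m → ℝ) :=
  let z' : Vec d := argminOn X fun w =>
    inner ℝ (√(K : ℝ) • S.ζ 0 p.1 s + ∑ i : Fin m, p.2 i • S.ζ i.succ p.1 s) (w - p.1)
      + (K : ℝ) * ‖w - p.1‖ ^ 2
  (z', fun i => max (p.2 i + S.θ i.succ p.1 s + inner ℝ (S.ζ i.succ p.1 s) (z' - p.1)) 0)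

/-- The bounds that the estimates obey almost surely. -/
def GoodSample (S : Estimator m d Ξ) (A B : ℝ) (x : Vec d) (s : Ξ) : Prop :=
  l2 (fun i : Fin m => S.θ i.succ x s) ≤ A ∧ ∀ i, ‖S.ζ i x s‖ ≤ B

/-- The queue drift `∑ Q_i (θ_i + ⟨ζ_i, w - z⟩)` towards `w`. -/
noncomputable def queueDrift (S : Estimator m d Ξ) (w : Vec d) (p : Vec d × (Fin m → ℝ)) (s : Ξ) :
    ℝ :=
  ∑ i : Fin m, p.2 i * (S.θ i.succ p.1 s + inner ℝ (S.ζ i.succ p.1 s) (w - p.1))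

variable {X : Set (Vec d)} {S : Estimator m d Ξ} {D A B : ℝ} {K : ℕ}
  {p : Vec d × (Fin m → ℝ)} {s : Ξ}

lemma pdStep_fst_mem (hX : IsCompact X) (hne : X.Nonempty) : (pdStep X S K p s).1 ∈ X :=
  argminOn_linear_add_sq_mem hX hne _ _ _

lemma pdStep_snd_nonneg (i : Fin m) : 0 ≤ (pdStep X S K p s).2 i := le_max_right _ _

lemma GoodSample.abs_inner_le (hg : GoodSample S A B p.1 s) (i : Fin (m + 1)) {v : Vec d}
    (hv : ‖v‖ ≤ D) : |inner ℝ (S.ζ i p.1 s) v| ≤ B * D :=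
  (abs_real_inner_le_norm _ _).trans
    (mul_le_mul (hg.2 i) hv (norm_nonneg _) ((norm_nonneg _).trans (hg.2 i)))

lemma GoodSample.l2_add_inner_le (hg : GoodSample S A B p.1 s) {v : Vec d} (hv : ‖v‖ ≤ D) :
    l2 (fun i : Fin m => S.θ i.succ p.1 s + inner ℝ (S.ζ i.succ p.1 s) v) ≤ boundH D A B m := by
  have hBD : 0 ≤ B * D := (abs_nonneg _).trans (hg.abs_inner_le 0 hv)
  refine (l2_add_le _ _).trans ?_
  rw [boundH, mul_assoc]
  exact add_le_add hg.1 (l2_le_of_abs_le hBD fun i => hg.abs_inner_le i.succ hv)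

lemma GoodSample.abs_queueDrift_le (hg : GoodSample S A B p.1 s) {w : Vec d}
    (hw : ‖w - p.1‖ ≤ D) : |queueDrift S w p s| ≤ l2 p.2 * boundH D A B m :=
  (abs_sum_mul_le_l2 _ _).trans
    (mul_le_mul_of_nonneg_left (hg.l2_add_inner_le hw) (l2_nonneg _))

/-- Queues move by at most `H` in one iteration. -/
lemma l2_pdStep_snd_le (hg : GoodSample S A B p.1 s)
    (hz : ‖(pdStep X S K p s).1 - p.1‖ ≤ D) :
    l2 (pdStep X S K p s).2 ≤ l2 p.2 + boundH D A B m := by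
  refine le_trans ?_ (add_le_add_right (hg.l2_add_inner_le hz) _)
  refine le_trans (l2_mono fun i => ?_) (l2_add_le _ _)
  change |max (p.2 i + S.θ i.succ p.1 s + _) 0| ≤ _
  rw [← add_assoc, abs_of_nonneg (le_max_right _ _)]
  exact max_le (le_abs_self _) (abs_nonneg _)

/-- The drift-plus-penalty inequality of one iteration, against an arbitrary comparator `w`. -/
lemma pdStep_drift (hconv : Convex ℝ X) (hX : IsCompact X) (hK : 1 ≤ K)
    (hg : GoodSample S A B p.1 s) (hz : ‖(pdStep X S K p s).1 - p.1‖ ≤ D) {w : Vec d}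
    (hw : w ∈ X) :
    (l2 (pdStep X S K p s).2 ^ 2 - l2 p.2 ^ 2) / 2
        + √(K : ℝ) * inner ℝ (S.ζ 0 p.1 s) ((pdStep X S K p s).1 - p.1)
        + K * ‖(pdStep X S K p s).1 - p.1‖ ^ 2 + K * ‖w - (pdStep X S K p s).1‖ ^ 2
      ≤ boundH D A B m ^ 2 / 2 + √(K : ℝ) * inner ℝ (S.ζ 0 p.1 s) (w - p.1)
        + queueDrift S w p s + K * ‖w - p.1‖ ^ 2 := by
  have hKpos : (0 : ℝ) < K := by exact_mod_cast hK
  have h3 := argminOn_three_point hconv hX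
    (√(K : ℝ) • S.ζ 0 p.1 s + ∑ i : Fin m, p.2 i • S.ζ i.succ p.1 s) p.1 hKpos hw
    (p := (pdStep X S K p s).1) rfl
  set z' := (pdStep X S K p s).1 with hz'
  have hQ' : ∀ i, (pdStep X S K p s).2 i
      = max (p.2 i + S.θ i.succ p.1 s + inner ℝ (S.ζ i.succ p.1 s) (z' - p.1)) 0 := fun i => rfl
  simp only [inner_add_left, real_inner_smul_left, sum_inner] at h3
  have hH : ∑ i : Fin m, (S.θ i.succ p.1 s + inner ℝ (S.ζ i.succ p.1 s) (z' - p.1)) ^ 2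
      ≤ boundH D A B m ^ 2 := by
    rw [← l2_sq]
    exact pow_le_pow_left₀ (l2_nonneg _) (hg.l2_add_inner_le hz) 2
  have hq : l2 (pdStep X S K p s).2 ^ 2 ≤ l2 p.2 ^ 2
      + 2 * ∑ i : Fin m, p.2 i * (S.θ i.succ p.1 s + inner ℝ (S.ζ i.succ p.1 s) (z' - p.1))
      + ∑ i : Fin m, (S.θ i.succ p.1 s + inner ℝ (S.ζ i.succ p.1 s) (z' - p.1)) ^ 2 := by
    rw [l2_sq, l2_sq, Finset.mul_sum, ← Finset.sum_add_distrib, ← Finset.sum_add_distrib]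
    refine Finset.sum_le_sum fun i _ => ?_
    rw [hQ' i]
    rcases max_cases (p.2 i + S.θ i.succ p.1 s + inner ℝ (S.ζ i.succ p.1 s) (z' - p.1)) 0 with
      ⟨h, _⟩ | ⟨h, _⟩
    · rw [h]; apply le_of_eq; ring
    · rw [h]
      nlinarith [sq_nonneg (p.2 i + (S.θ i.succ p.1 s + inner ℝ (S.ζ i.succ p.1 s) (z' - p.1)))]
  have e1 : ∀ v : Vec d, ∑ i : Fin m, p.2 i * (S.θ i.succ p.1 s + inner ℝ (S.ζ i.succ p.1 s) v)
      = ∑ i : Fin m, p.2 i * S.θ i.succ p.1 s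
        + ∑ i : Fin m, p.2 i * inner ℝ (S.ζ i.succ p.1 s) v := by
    intro v
    rw [← Finset.sum_add_distrib]
    exact Finset.sum_congr rfl fun i _ => by ring
  rw [e1] at hq
  rw [queueDrift, e1]
  linarith

/-- The drift of the Lyapunov function `‖Q‖² / 2 + K ‖w - z‖²`. -/
lemma pdStep_lyapunov (hconv : Convex ℝ X) (hX : IsCompact X) (hK : 1 ≤ K)
    (hg : GoodSample S A B p.1 s) (hz : ‖(pdStep X S K p s).1 - p.1‖ ≤ D) {w : Vec d}
    (hw : w ∈ X) (hwz : ‖w - (pdStep X S K p s).1‖ ≤ D) :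
    l2 (pdStep X S K p s).2 ^ 2 + 2 * K * ‖w - (pdStep X S K p s).1‖ ^ 2
      ≤ l2 p.2 ^ 2 + 2 * K * ‖w - p.1‖ ^ 2
        + 2 * (boundH D A B m ^ 2 / 2 + √(K : ℝ) * (B * D) + queueDrift S w p s) := by
  have h := pdStep_drift hconv hX hK hg hz hw
  set z' := (pdStep X S K p s).1
  have h1 : inner ℝ (S.ζ 0 p.1 s) (w - p.1) - inner ℝ (S.ζ 0 p.1 s) (z' - p.1) ≤ B * D := by
    rw [← inner_sub_right, sub_sub_sub_cancel_right]
    exact (le_abs_self _).trans (hg.abs_inner_le 0 hwz)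
  have h2 := mul_le_mul_of_nonneg_left h1 (Real.sqrt_nonneg (K : ℝ))
  have h3 : 0 ≤ (K : ℝ) * ‖z' - p.1‖ ^ 2 := by positivity
  linarith

/-- The regret of one iteration. -/
lemma pdStep_regret (hconv : Convex ℝ X) (hX : IsCompact X) (hK : 1 ≤ K)
    (hg : GoodSample S A B p.1 s) (hz : ‖(pdStep X S K p s).1 - p.1‖ ≤ D) {w : Vec d}
    (hw : w ∈ X) :
    √(K : ℝ) * inner ℝ (S.ζ 0 p.1 s) (p.1 - w)
      ≤ B ^ 2 / 4 + boundH D A B m ^ 2 / 2 + queueDrift S w p s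
        + (K * ‖w - p.1‖ ^ 2 + l2 p.2 ^ 2 / 2)
        - (K * ‖w - (pdStep X S K p s).1‖ ^ 2 + l2 (pdStep X S K p s).2 ^ 2 / 2) := by
  have h := pdStep_drift hconv hX hK hg hz hw
  set z' := (pdStep X S K p s).1
  have h1 : -(‖S.ζ 0 p.1 s‖ * ‖z' - p.1‖) ≤ inner ℝ (S.ζ 0 p.1 s) (z' - p.1) :=
    (abs_le.mp (abs_real_inner_le_norm _ _)).1
  have h2 : inner ℝ (S.ζ 0 p.1 s) (p.1 - w) = -inner ℝ (S.ζ 0 p.1 s) (w - p.1) := by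
    rw [← inner_neg_right, neg_sub]
  have h3 := mul_le_mul_of_nonneg_left h1 (Real.sqrt_nonneg (K : ℝ))
  have hK2 : √(K : ℝ) ^ 2 = K := Real.sq_sqrt (Nat.cast_nonneg K)
  have h4 : ‖S.ζ 0 p.1 s‖ ^ 2 ≤ B ^ 2 := pow_le_pow_left₀ (norm_nonneg _) (hg.2 0) 2
  have h5 : 0 ≤ (√(K : ℝ) * ‖z' - p.1‖ - ‖S.ζ 0 p.1 s‖ / 2) ^ 2 := sq_nonneg _
  have h6 : (√(K : ℝ) * ‖z' - p.1‖ - ‖S.ζ 0 p.1 s‖ / 2) ^ 2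
      = K * ‖z' - p.1‖ ^ 2 - √(K : ℝ) * (‖S.ζ 0 p.1 s‖ * ‖z' - p.1‖)
        + ‖S.ζ 0 p.1 s‖ ^ 2 / 4 := by
    rw [sub_sq, mul_pow, hK2]; ring
  rw [h2]
  linarith

/-- The iterate moves by at most `(√K B + ‖Q‖ √m B) / (2 K)`. -/
lemma norm_pdStep_fst_sub_le (hconv : Convex ℝ X) (hX : IsCompact X) (hK : 1 ≤ K) (hp : p.1 ∈ X)
    (hg : GoodSample S A B p.1 s) :
    2 * K * ‖(pdStep X S K p s).1 - p.1‖ ≤ √(K : ℝ) * B + l2 p.2 * (√(m : ℝ) * B) := by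
  have hKpos : (0 : ℝ) < K := by exact_mod_cast hK
  have h3 := argminOn_three_point hconv hX
    (√(K : ℝ) • S.ζ 0 p.1 s + ∑ i : Fin m, p.2 i • S.ζ i.succ p.1 s) p.1 hKpos hp
    (p := (pdStep X S K p s).1) rfl
  set z' := (pdStep X S K p s).1
  set r := ‖z' - p.1‖ with hr
  have hB : 0 ≤ B := (norm_nonneg _).trans (hg.2 0)
  simp only [inner_add_left, real_inner_smul_left, sum_inner, sub_self, inner_zero_right,
    norm_zero, norm_sub_rev p.1 z', ← hr] at h3
  have h1 : -(B * r) ≤ inner ℝ (S.ζ 0 p.1 s) (z' - p.1) :=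
    (abs_le.mp (hg.abs_inner_le 0 le_rfl)).1
  have h2 : -(l2 p.2 * (√(m : ℝ) * (B * r)))
      ≤ ∑ i : Fin m, p.2 i * inner ℝ (S.ζ i.succ p.1 s) (z' - p.1) := by
    refine (abs_le.mp ((abs_sum_mul_le_l2 _ _).trans ?_)).1
    refine mul_le_mul_of_nonneg_left ?_ (l2_nonneg _)
    exact l2_le_of_abs_le (by positivity) fun i => hg.abs_inner_le i.succ le_rfl
  have h4 := mul_le_mul_of_nonneg_left h1 (Real.sqrt_nonneg (K : ℝ))
  by_contra! hlt
  have hr0 : 0 < r := by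
    by_contra! hr0
    have : r = 0 := le_antisymm hr0 (norm_nonneg _)
    rw [this, mul_zero] at hlt
    have : 0 ≤ √(K : ℝ) * B + l2 p.2 * (√(m : ℝ) * B) := by
      have := l2_nonneg p.2
      positivity
    linarith
  have := mul_lt_mul_of_pos_right hlt hr0
  nlinarith

lemma estimate_le_queue_increment (hg : GoodSample S A B p.1 s) (i : Fin m) :
    S.θ i.succ p.1 s
      ≤ (pdStep X S K p s).2 i - p.2 i + B * ‖(pdStep X S K p s).1 - p.1‖ := by
  have h1 : p.2 i + S.θ i.succ p.1 s
      + inner ℝ (S.ζ i.succ p.1 s) ((pdStep X S K p s).1 - p.1) ≤ (pdStep X S K p s).2 i :=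
    le_max_left _ _
  have h2 := (abs_le.mp (hg.abs_inner_le (D := ‖(pdStep X S K p s).1 - p.1‖) i.succ le_rfl)).1
  linarith

/-- The iterates and queues of the primal-dual method started at `x0` with empty queues. -/
noncomputable def pdIter (X : Set (Vec d)) (S : Estimator m d Ξ) (K : ℕ) (x0 : Vec d)
    (s : ℕ → Ξ) : ℕ → Vec d × (Fin m → ℝ)
  | 0 => (x0, fun _ => 0)
  | k + 1 => pdStep X S K (pdIter X S K x0 s k) (s k)

lemma pdIter_fst_mem (hX : IsCompact X) {x0 : Vec d} (hx0 : x0 ∈ X) (s : ℕ → Ξ) (k : ℕ) :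
    (pdIter X S K x0 s k).1 ∈ X := by
  cases k with
  | zero => exact hx0
  | succ k => exact pdStep_fst_mem hX ⟨x0, hx0⟩

lemma pdIter_snd_nonneg (x0 : Vec d) (s : ℕ → Ξ) (k : ℕ) (i : Fin m) :
    0 ≤ (pdIter X S K x0 s k).2 i := by
  cases k with
  | zero => exact le_rfl
  | succ k => exact pdStep_snd_nonneg i

end Step

/-! ### Convex programs with stochastic estimates -/

/-- A convex program `min {F 0 x : x ∈ X, F i.succ x ≤ 0}` with unbiased, almost surely bounded
estimates of the values and of subgradients; this is what each proximal subproblem is. -/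
structure StochasticProgram {m d : ℕ} {Ξ : Type*} [MeasurableSpace Ξ] (X : Set (Vec d))
    (F : Fin (m + 1) → Vec d → ℝ) (S : Estimator m d Ξ) (P : Measure Ξ) (D A B : ℝ) : Prop where
  convex : Convex ℝ X
  compact : IsCompact X
  diam : ∀ x ∈ X, ∀ y ∈ X, ‖x - y‖ ≤ D
  measurable_F : ∀ i, Measurable (F i)
  measurable_θ : ∀ i, Measurable fun p : Vec d × Ξ => S.θ i p.1 p.2
  measurable_ζ : ∀ i, Measurable fun p : Vec d × Ξ => S.ζ i p.1 p.2
  mean_θ : ∀ i, ∀ x ∈ X, Integrable (S.θ i x) P ∧ ∫ s, S.θ i x s ∂P = F i x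
  mean_ζ : ∀ i, ∀ x ∈ X, Integrable (S.ζ i x) P ∧
    ∀ y ∈ X, F i x + inner ℝ (∫ s, S.ζ i x s ∂P) (y - x) ≤ F i y
  good : ∀ x ∈ X, ∀ᵐ s ∂P, GoodSample S A B x s

section Program

variable {m d : ℕ} {Ξ : Type*} [MeasurableSpace Ξ] {X : Set (Vec d)}
  {F : Fin (m + 1) → Vec d → ℝ} {S : Estimator m d Ξ} {P : Measure Ξ} {D A B : ℝ} {K : ℕ}

lemma StochasticProgram.integrable_inner (h : StochasticProgram X F S P D A B)
    (i : Fin (m + 1)) {x : Vec d} (hx : x ∈ X) (v : Vec d) :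
    Integrable (fun s => inner ℝ (S.ζ i x s) v) P :=
  (h.mean_ζ i x hx).1.inner_const v

lemma StochasticProgram.integral_inner_le (h : StochasticProgram X F S P D A B)
    (i : Fin (m + 1)) {x y : Vec d} (hx : x ∈ X) (hy : y ∈ X) :
    ∫ s, inner ℝ (S.ζ i x s) (y - x) ∂P ≤ F i y - F i x := by
  have h1 := (h.mean_ζ i x hx).2 y hy
  have h2 : ∫ s, inner ℝ (S.ζ i x s) (y - x) ∂P = inner ℝ (∫ s, S.ζ i x s ∂P) (y - x) := by
    simp_rw [real_inner_comm (y - x)]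
    exact integral_inner (h.mean_ζ i x hx).1 _
  linarith

/-- The expected queue drift towards `w` is at most `∑ Q_i F_i(w)`. -/
lemma StochasticProgram.integral_queueDrift_le (h : StochasticProgram X F S P D A B)
    {p : Vec d × (Fin m → ℝ)} (hp : p.1 ∈ X) (hQ : ∀ i, 0 ≤ p.2 i) {w : Vec d} (hw : w ∈ X) :
    ∫ s, queueDrift S w p s ∂P ≤ ∑ i : Fin m, p.2 i * F i.succ w := by
  unfold queueDrift
  rw [integral_finsetSum _ fun i _ => ((h.mean_θ i.succ p.1 hp).1.add
    (h.integrable_inner i.succ hp _)).const_mul _]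
  refine Finset.sum_le_sum fun i _ => ?_
  rw [integral_const_mul, integral_add (h.mean_θ i.succ p.1 hp).1 (h.integrable_inner i.succ hp _)]
  refine mul_le_mul_of_nonneg_left ?_ (hQ i)
  have := h.integral_inner_le i.succ hp hw
  rw [(h.mean_θ i.succ p.1 hp).2]
  linarith

lemma StochasticProgram.measurable_queueDrift (h : StochasticProgram X F S P D A B) (w : Vec d) :
    Measurable fun q : (Vec d × (Fin m → ℝ)) × Ξ => queueDrift S w q.1 q.2 := by
  unfold queueDrift
  refine Finset.measurable_sum _ fun i _ => ?_
  have hx : Measurable fun q : (Vec d × (Fin m → ℝ)) × Ξ => (q.1.1, q.2) := by fun_prop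
  have h1 := (h.measurable_θ i.succ).comp hx
  have h2 := (h.measurable_ζ i.succ).comp hx
  have h3 : Measurable fun q : (Vec d × (Fin m → ℝ)) × Ξ => q.1.2 i := by fun_prop
  have h4 : Measurable fun q : (Vec d × (Fin m → ℝ)) × Ξ => w - q.1.1 := by fun_prop
  exact h3.mul (h1.add (h2.inner h4))

lemma StochasticProgram.measurableSet_good (h : StochasticProgram X F S P D A B) :
    MeasurableSet {q : (Vec d × (Fin m → ℝ)) × Ξ | GoodSample S A B q.1.1 q.2} := by
  have hx : Measurable fun q : (Vec d × (Fin m → ℝ)) × Ξ => (q.1.1, q.2) := by fun_prop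
  refine MeasurableSet.inter (s₁ := {q : (Vec d × (Fin m → ℝ)) × Ξ |
    l2 (fun i : Fin m => S.θ i.succ q.1.1 q.2) ≤ A}) ?_ ?_
  · refine measurableSet_le (continuous_l2.measurable.comp ?_) measurable_const
    exact measurable_pi_lambda _ fun i => (h.measurable_θ i.succ).comp hx
  · have : {q : (Vec d × (Fin m → ℝ)) × Ξ | ∀ i, ‖S.ζ i q.1.1 q.2‖ ≤ B}
        = ⋂ i, {q : (Vec d × (Fin m → ℝ)) × Ξ | ‖S.ζ i q.1.1 q.2‖ ≤ B} := by
      ext q; simp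
    change MeasurableSet {q : (Vec d × (Fin m → ℝ)) × Ξ | ∀ i, ‖S.ζ i q.1.1 q.2‖ ≤ B}
    rw [this]
    exact MeasurableSet.iInter fun i =>
      measurableSet_le ((h.measurable_ζ i).comp hx).norm measurable_const

lemma measurable_pdStep (hconv : Convex ℝ X) (hX : IsCompact X) (hne : X.Nonempty) (hK : 1 ≤ K)
    (hθ : ∀ i, Measurable fun p : Vec d × Ξ => S.θ i p.1 p.2)
    (hζ : ∀ i, Measurable fun p : Vec d × Ξ => S.ζ i p.1 p.2) :
    Measurable fun q : (Vec d × (Fin m → ℝ)) × Ξ => pdStep X S K q.1 q.2 := by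
  have hKpos : (0 : ℝ) < K := by exact_mod_cast hK
  have hx : Measurable fun q : (Vec d × (Fin m → ℝ)) × Ξ => (q.1.1, q.2) := by fun_prop
  have h1 : ∀ i, Measurable fun q : (Vec d × (Fin m → ℝ)) × Ξ => S.θ i q.1.1 q.2 :=
    fun i => (hθ i).comp hx
  have h2 : ∀ i, Measurable fun q : (Vec d × (Fin m → ℝ)) × Ξ => S.ζ i q.1.1 q.2 :=
    fun i => (hζ i).comp hx
  have h3 : ∀ i, Measurable fun q : (Vec d × (Fin m → ℝ)) × Ξ => q.1.2 i := by fun_prop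
  have h4 : Measurable fun q : (Vec d × (Fin m → ℝ)) × Ξ => q.1.1 := by fun_prop
  have hz : Measurable fun q : (Vec d × (Fin m → ℝ)) × Ξ => (pdStep X S K q.1 q.2).1 := by
    simp only [pdStep, argminOn_linear_add_sq _ _ hKpos]
    refine (continuous_nearest hconv hX hne).measurable.comp ?_
    have h5 : Measurable fun q : (Vec d × (Fin m → ℝ)) × Ξ =>
        √(K : ℝ) • S.ζ 0 q.1.1 q.2 + ∑ i, q.1.2 i • S.ζ i.succ q.1.1 q.2 :=
      (Measurable.const_smul (h2 0) (√(K : ℝ))).add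
        (Finset.measurable_sum _ fun i _ => (h3 i).smul (h2 i.succ))
    exact h4.sub (Measurable.const_smul h5 ((2 * (K : ℝ))⁻¹))
  refine hz.prodMk (measurable_pi_lambda _ fun i => ?_)
  exact (((h3 i).add (h1 i.succ)).add ((h2 i.succ).inner (hz.sub h4))).max measurable_const

lemma measurable_uncurry_apply {Ω 𝒴 𝒵 : Type*} {_ : MeasurableSpace Ω} [MeasurableSpace 𝒴]
    [MeasurableSpace 𝒵] {ψ : 𝒴 → Ξ → 𝒵} (hψ : Measurable (Function.uncurry ψ)) {Y : Ω → 𝒴}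
    (hY : Measurable Y) {ξ : Ω → Ξ} (hξ : Measurable ξ) : Measurable fun ω => ψ (Y ω) (ξ ω) :=
  hψ.comp (hY.prodMk hξ)

lemma measurable_pdIter_comp {Ω : Type*} {_ : MeasurableSpace Ω} (hconv : Convex ℝ X)
    (hX : IsCompact X) (hne : X.Nonempty) (hK : 1 ≤ K)
    (hθ : ∀ i, Measurable fun p : Vec d × Ξ => S.θ i p.1 p.2)
    (hζ : ∀ i, Measurable fun p : Vec d × Ξ => S.ζ i p.1 p.2) {x : Ω → Vec d} (hx : Measurable x)
    {s : ℕ → Ω → Ξ} (k : ℕ) (hs : ∀ j < k, Measurable (s j)) :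
    Measurable fun ω => pdIter X S K (x ω) (fun j => s j ω) k := by
  induction k with
  | zero => exact hx.prodMk measurable_const
  | succ k ih =>
    change Measurable fun ω => pdStep X S K (pdIter X S K (x ω) (fun j => s j ω) k) (s k ω)
    exact measurable_uncurry_apply (ψ := pdStep X S K)
      (measurable_pdStep hconv hX hne hK hθ hζ) (ih fun j hj => hs j (by omega))
      (hs k (Nat.lt_succ_self k))

lemma measurable_pdIter {Ω : Type*} [MeasurableSpace Ω] {μ : Measure Ω}
    {𝓕 : ℕ → MeasurableSpace Ω} {ξ : ℕ → Ω → Ξ} (h : StochasticProgram X F S P D A B)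
    (hξ : IsSampleFiltration 𝓕 ξ P μ) (hK : 1 ≤ K) {x0 : Vec d} (hx0 : x0 ∈ X) (k : ℕ) :
    Measurable[𝓕 k] fun ω => pdIter X S K x0 (fun j => ξ j ω) k :=
  measurable_pdIter_comp h.convex h.compact ⟨x0, hx0⟩ hK h.measurable_θ h.measurable_ζ
    measurable_const k fun j hj => Measurable.le (hξ.mono hj) (hξ.measurable_succ j)

end Program

/-! ### The queues are small with high probability -/

section Lyapunov

variable {m d : ℕ} {Ξ : Type*} {X : Set (Vec d)} {S : Estimator m d Ξ} {D A B σ : ℝ} {K : ℕ}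

/-- The length of the queue vector, corrected by the distance to `y`. -/
noncomputable def lyapunovLength (K : ℕ) (y : Vec d) (p : Vec d × (Fin m → ℝ)) : ℝ :=
  √(l2 p.2 ^ 2 + 2 * K * ‖y - p.1‖ ^ 2)

lemma l2_le_lyapunovLength (y : Vec d) (p : Vec d × (Fin m → ℝ)) :
    l2 p.2 ≤ lyapunovLength K y p := by
  refine Real.le_sqrt_of_sq_le ?_
  have : 0 ≤ 2 * (K : ℝ) * ‖y - p.1‖ ^ 2 := by positivity
  linarith

lemma lyapunovLength_le {y : Vec d} {p : Vec d × (Fin m → ℝ)} (hD : ‖y - p.1‖ ≤ D) :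
    lyapunovLength K y p ≤ l2 p.2 + √(2 * K) * D := by
  have hD0 : 0 ≤ D := (norm_nonneg _).trans hD
  have hq := l2_nonneg p.2
  refine Real.sqrt_le_iff.mpr ⟨by positivity, ?_⟩
  have h1 : ‖y - p.1‖ ^ 2 ≤ D ^ 2 := pow_le_pow_left₀ (norm_nonneg _) hD 2
  have h2 : √(2 * (K : ℝ)) ^ 2 = 2 * K := Real.sq_sqrt (by positivity)
  have h3 : 0 ≤ 2 * l2 p.2 * (√(2 * K) * D) := by positivity
  have h4 : 2 * (K : ℝ) * ‖y - p.1‖ ^ 2 ≤ 2 * K * D ^ 2 := by gcongr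
  calc l2 p.2 ^ 2 + 2 * K * ‖y - p.1‖ ^ 2 ≤ l2 p.2 ^ 2 + √(2 * (K : ℝ)) ^ 2 * D ^ 2 := by
        rw [h2]; linarith
    _ ≤ _ := by nlinarith

lemma continuous_lyapunovLength (y : Vec d) :
    Continuous (lyapunovLength K y : Vec d × (Fin m → ℝ) → ℝ) := by
  have := continuous_l2 (m := m)
  unfold lyapunovLength
  fun_prop

lemma le_add_div_of_sq_le {w w' e : ℝ} (hw : 0 < w) (h : w' ^ 2 ≤ w ^ 2 + 2 * e) :
    w' ≤ w + e / w := by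
  have h1 : w + e / w = (w ^ 2 + e) / w := by field_simp
  have h2 : 0 ≤ w + e / w := by
    rw [h1]
    exact div_nonneg (by nlinarith [sq_nonneg w']) hw.le
  refine le_of_sq_le_sq ?_ h2
  have h3 : (w + e / w) ^ 2 = w ^ 2 + 2 * e + (e / w) ^ 2 := by field_simp; ring
  nlinarith [sq_nonneg (e / w)]

/-- One step of the exponential Lyapunov recursion, on a sample obeying the bounds. -/
lemma exp_lyapunovLength_pdStep_le (hconv : Convex ℝ X) (hX : IsCompact X) (hK : 1 ≤ K)
    (hdiam : ∀ x ∈ X, ∀ y ∈ X, ‖x - y‖ ≤ D) {p : Vec d × (Fin m → ℝ)} (hp : p.1 ∈ X) {s : Ξ}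
    (hg : GoodSample S A B p.1 s) {y : Vec d} (hy : y ∈ X) {r q c : ℝ} (hr : 0 ≤ r) (hq : 0 < q)
    (hc : c = boundH D A B m ^ 2 / 2 + √(K : ℝ) * (B * D)) :
    ENNReal.ofReal (Real.exp (r * lyapunovLength K y (pdStep X S K p s)))
      ≤ ENNReal.ofReal (Real.exp (r * lyapunovLength K y p))
          * (if q ≤ l2 p.2 then ENNReal.ofReal (Real.exp (r
              * ((c + queueDrift S y p s) / lyapunovLength K y p))) else 0)
        + ENNReal.ofReal (Real.exp (r * (q + boundH D A B m + √(2 * K) * D))) := by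
  have hz' : (pdStep X S K p s).1 ∈ X := pdStep_fst_mem hX ⟨_, hp⟩
  have hz := hdiam _ hz' _ hp
  split_ifs with hcase
  · refine le_add_right ?_
    rw [← ENNReal.ofReal_mul (Real.exp_pos _).le, ← Real.exp_add, ← mul_add]
    refine ENNReal.ofReal_le_ofReal (Real.exp_le_exp.mpr (mul_le_mul_of_nonneg_left ?_ hr))
    have hW : 0 < lyapunovLength K y p :=
      hq.trans_le (hcase.trans (l2_le_lyapunovLength y p))
    refine le_add_div_of_sq_le hW ?_
    have h1 := pdStep_lyapunov hconv hX hK hg hz hy (hdiam _ hy _ hz')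
    rw [← hc] at h1
    unfold lyapunovLength
    rw [Real.sq_sqrt (by positivity), Real.sq_sqrt (by positivity)]
    exact h1
  · rw [mul_zero, zero_add]
    refine ENNReal.ofReal_le_ofReal (Real.exp_le_exp.mpr (mul_le_mul_of_nonneg_left ?_ hr))
    have h1 := lyapunovLength_le (K := K) (hdiam _ hy _ hz')
    have h2 := l2_pdStep_snd_le hg hz
    push Not at hcase
    linarith

lemma le_boundLambda (hσ : 0 < σ) (hD : 0 ≤ D) (hH : 0 < boundH D A B m)
    (hK : 1 ≤ K) {δ : ℝ} (hδ : 0 < δ) (hδ1 : δ < 1) {c : ℝ}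
    (hc : c = boundH D A B m ^ 2 / 2 + √(K : ℝ) * (B * D)) :
    2 * c / σ + boundH D A B m + √(2 * K) * D
        + 8 * boundH D A B m ^ 2 / σ * Real.log (2 * K / δ)
      ≤ √(K : ℝ) * boundLambda D A B m σ K δ := by
  set H := boundH D A B m
  have hK1 : (1 : ℝ) ≤ K := by exact_mod_cast hK
  have hs : 1 ≤ √(K : ℝ) := Real.one_le_sqrt.mpr hK1
  have hlog : 0 ≤ Real.log (2 * K / δ) :=
    Real.log_nonneg ((one_le_div hδ).mpr (by linarith))
  have hlog1 : 0 ≤ Real.log (1 + 32 * H ^ 2 / σ ^ 2 * Real.exp (σ / (8 * H))) :=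
    Real.log_nonneg (by have : 0 ≤ 32 * H ^ 2 / σ ^ 2 * Real.exp (σ / (8 * H)) := by positivity
                        linarith)
  have h2K : √(2 * (K : ℝ)) ≤ 2 * √(K : ℝ) := by
    rw [Real.sqrt_mul (by norm_num)]
    gcongr
    exact Real.sqrt_le_iff.mpr ⟨by norm_num, by norm_num⟩
  have hDσ : 2 * D ≤ σ / 2 + 2 * D ^ 2 / σ := by
    have : σ / 2 + 2 * D ^ 2 / σ - 2 * D = (σ - 2 * D) ^ 2 / (2 * σ) := by field_simp; ring
    have : 0 ≤ (σ - 2 * D) ^ 2 / (2 * σ) := by positivity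
    linarith
  have e1 : 2 * c / σ = √(K : ℝ) * (2 * B * D / σ) + 1 * (H ^ 2 / σ) := by
    rw [hc]; field_simp; ring
  have e2 : √(K : ℝ) * boundLambda D A B m σ K δ
      = √(K : ℝ) * (σ / 2 + 2 * D ^ 2 / σ) + √(K : ℝ) * H + √(K : ℝ) * (2 * B * D / σ)
        + √(K : ℝ) * (H ^ 2 / σ)
        + √(K : ℝ) * (8 * H ^ 2 / σ
            * Real.log (1 + 32 * H ^ 2 / σ ^ 2 * Real.exp (σ / (8 * H))))
        + √(K : ℝ) * (8 * H ^ 2 / σ * Real.log (2 * K / δ)) := by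
    rw [boundLambda]; ring
  have i1 : √(2 * (K : ℝ)) * D ≤ √(K : ℝ) * (σ / 2 + 2 * D ^ 2 / σ) := by
    calc √(2 * (K : ℝ)) * D ≤ 2 * √(K : ℝ) * D := by gcongr
      _ = √(K : ℝ) * (2 * D) := by ring
      _ ≤ _ := by gcongr
  have i2 : 1 * H ≤ √(K : ℝ) * H := by gcongr
  have i3 : 1 * (H ^ 2 / σ) ≤ √(K : ℝ) * (H ^ 2 / σ) := by gcongr
  have i4 : 0 ≤ √(K : ℝ) * (8 * H ^ 2 / σ
      * Real.log (1 + 32 * H ^ 2 / σ ^ 2 * Real.exp (σ / (8 * H)))) := by positivity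
  have i5 : 1 * (8 * H ^ 2 / σ * Real.log (2 * K / δ))
      ≤ √(K : ℝ) * (8 * H ^ 2 / σ * Real.log (2 * K / δ)) := by gcongr
  rw [e1, e2]
  linarith

end Lyapunov

section QueueTail

variable {m d : ℕ} {Ξ : Type*} [MeasurableSpace Ξ] {X : Set (Vec d)}
  {F : Fin (m + 1) → Vec d → ℝ} {S : Estimator m d Ξ} {P : Measure Ξ} {D A B σ : ℝ} {K : ℕ}

/-- When the queues are long, the Lyapunov length does not increase in exponential mean. -/
lemma StochasticProgram.lintegral_exp_drift_le [IsProbabilityMeasure P]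
    (h : StochasticProgram X F S P D A B) (hσ : 0 < σ) (hH : 0 < boundH D A B m) {y : Vec d}
    (hy : y ∈ X) (hFy : ∀ i : Fin m, F i.succ y ≤ -σ) {p : Vec d × (Fin m → ℝ)} (hp : p.1 ∈ X)
    (hQ : ∀ i, 0 ≤ p.2 i) {c : ℝ} (hc : 0 < c) (hcq : 2 * c / σ ≤ l2 p.2) :
    ∫⁻ s, ENNReal.ofReal (Real.exp (σ / boundH D A B m ^ 2
        * ((c + queueDrift S y p s) / lyapunovLength K y p))) ∂P ≤ 1 := by
  set H := boundH D A B m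
  set q := l2 p.2
  set W := lyapunovLength K y p
  have hq : 0 < q := lt_of_lt_of_le (by positivity) hcq
  have hqW : q ≤ W := l2_le_lyapunovLength y p
  have hW : 0 < W := hq.trans_le hqW
  set t := σ / H ^ 2 / W with ht
  have ht0 : 0 ≤ t := by positivity
  have hU : Measurable (queueDrift S y p) := (h.measurable_queueDrift y).comp measurable_prodMk_left
  have hmean : ∫ s, queueDrift S y p s ∂P ≤ -(σ * q) := by
    refine (h.integral_queueDrift_le hp hQ hy).trans ?_
    calc ∑ i : Fin m, p.2 i * F i.succ y ≤ ∑ i : Fin m, p.2 i * -σ :=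
          Finset.sum_le_sum fun i _ => mul_le_mul_of_nonneg_left (hFy i) (hQ i)
      _ = -(σ * ∑ i, p.2 i) := by rw [← Finset.sum_mul]; ring
      _ ≤ -(σ * q) := by
          have := mul_le_mul_of_nonneg_left (l2_le_sum hQ) hσ.le
          linarith
  have hb : ∀ᵐ s ∂P, |queueDrift S y p s| ≤ q * H := by
    filter_upwards [h.good p.1 hp] with s hs
    exact hs.abs_queueDrift_le (h.diam y hy p.1 hp)
  have hexp := lintegral_exp_mul_le hU ht0 hb hmean
  calc ∫⁻ s, ENNReal.ofReal (Real.exp (σ / H ^ 2 * ((c + queueDrift S y p s) / W))) ∂P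
      = ∫⁻ s, ENNReal.ofReal (Real.exp (t * c))
          * ENNReal.ofReal (Real.exp (t * queueDrift S y p s)) ∂P := by
        congr 1; funext s
        rw [← ENNReal.ofReal_mul (Real.exp_pos _).le, ← Real.exp_add, ht]
        congr 2
        field_simp
    _ = ENNReal.ofReal (Real.exp (t * c))
          * ∫⁻ s, ENNReal.ofReal (Real.exp (t * queueDrift S y p s)) ∂P :=
        lintegral_const_mul _ (ENNReal.measurable_ofReal.comp
          (Real.measurable_exp.comp (hU.const_mul t)))
    _ ≤ ENNReal.ofReal (Real.exp (t * c))
          * ENNReal.ofReal (Real.exp (t * -(σ * q) + t ^ 2 * (q * H) ^ 2 / 2)) := by gcongr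
    _ = ENNReal.ofReal (Real.exp (t * (c - σ * q + t * q ^ 2 * H ^ 2 / 2))) := by
        rw [← ENNReal.ofReal_mul (Real.exp_pos _).le, ← Real.exp_add]
        ring_nf
    _ ≤ 1 := by
        rw [← ENNReal.ofReal_one]
        refine ENNReal.ofReal_le_ofReal (Real.exp_le_one_iff.mpr ?_)
        refine mul_nonpos_of_nonneg_of_nonpos ht0 ?_
        have h1 : c ≤ σ * q / 2 := by
          rw [div_le_iff₀ hσ] at hcq
          linarith
        have h2 : t * q ^ 2 * H ^ 2 ≤ σ * q := by
          have : t * q ^ 2 * H ^ 2 = σ * q * (q / W) := by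
            rw [ht]; field_simp
          rw [this]
          exact mul_le_of_le_one_right (by positivity) ((div_le_one hW).mpr hqW)
        linarith

variable {Ω : Type*} [MeasurableSpace Ω] {μ : Measure Ω} {𝓕 : ℕ → MeasurableSpace Ω}
  {ξ : ℕ → Ω → Ξ}

lemma StochasticProgram.ae_good [IsProbabilityMeasure P] [IsProbabilityMeasure μ]
    (h : StochasticProgram X F S P D A B) (hξ : IsSampleFiltration 𝓕 ξ P μ) (hK : 1 ≤ K)
    {x0 : Vec d} (hx0 : x0 ∈ X) (k : ℕ) :
    ∀ᵐ ω ∂μ, GoodSample S A B (pdIter X S K x0 (fun j => ξ j ω) k).1 (ξ k ω) :=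
  hξ.ae_of_ae k (p := fun p s => GoodSample S A B p.1 s) (measurable_pdIter h hξ hK hx0 k)
    h.measurableSet_good fun _ =>
    h.good _ (pdIter_fst_mem h.compact hx0 _ k)

/-- Exponential moments of the Lyapunov length grow at most linearly. -/
lemma StochasticProgram.lintegral_exp_lyapunovLength_le [IsProbabilityMeasure P]
    [IsProbabilityMeasure μ] (h : StochasticProgram X F S P D A B)
    (hξ : IsSampleFiltration 𝓕 ξ P μ) (hK : 1 ≤ K) (hσ : 0 < σ) (hD : 0 ≤ D) (hB : 0 ≤ B)
    (hH : 0 < boundH D A B m) {x0 : Vec d} (hx0 : x0 ∈ X) {y : Vec d} (hy : y ∈ X)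
    (hFy : ∀ i : Fin m, F i.succ y ≤ -σ) {c : ℝ}
    (hc : c = boundH D A B m ^ 2 / 2 + √(K : ℝ) * (B * D)) (k : ℕ) :
    ∫⁻ ω, ENNReal.ofReal (Real.exp (σ / boundH D A B m ^ 2
        * lyapunovLength K y (pdIter X S K x0 (fun j => ξ j ω) k))) ∂μ
      ≤ (k + 1) * ENNReal.ofReal (Real.exp (σ / boundH D A B m ^ 2
          * (2 * c / σ + boundH D A B m + √(2 * K) * D))) := by
  set H := boundH D A B m
  set r := σ / H ^ 2
  have hr : 0 ≤ r := by positivity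
  have hcpos : 0 < c := by rw [hc]; positivity
  have hq : 0 < 2 * c / σ := by positivity
  set Y : ℕ → Ω → Vec d × (Fin m → ℝ) := fun k ω => pdIter X S K x0 (fun j => ξ j ω) k with hY
  have hYm : ∀ k, Measurable[𝓕 k] (Y k) := measurable_pdIter h hξ hK hx0
  induction k with
  | zero =>
    simp only [Nat.cast_zero, zero_add, one_mul]
    calc _ ≤ ∫⁻ _, ENNReal.ofReal (Real.exp (r * (2 * c / σ + H + √(2 * K) * D))) ∂μ := by
          refine lintegral_mono fun _ => ENNReal.ofReal_le_ofReal (Real.exp_le_exp.mpr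
            (mul_le_mul_of_nonneg_left ?_ hr))
          have h1 := lyapunovLength_le (K := K) (m := m) (p := (x0, fun _ => 0))
            (h.diam _ hy _ hx0)
          have h2 : l2 (fun _ : Fin m => (0 : ℝ)) = 0 := by rw [l2_const]; simp
          change lyapunovLength K y (x0, fun _ => 0) ≤ _
          simp only [h2] at h1
          linarith
      _ = _ := by simp
  | succ k ih =>
    have hg : Measurable[𝓕 k] fun ω => ENNReal.ofReal (Real.exp (r * lyapunovLength K y (Y k ω))) :=
      ENNReal.measurable_ofReal.comp (Real.measurable_exp.comp
        (((continuous_lyapunovLength y).measurable.comp (hYm k)).const_mul r))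
    set ψ : Vec d × (Fin m → ℝ) → Ξ → ENNReal := fun p s =>
      if 2 * c / σ ≤ l2 p.2 then ENNReal.ofReal (Real.exp (r
        * ((c + queueDrift S y p s) / lyapunovLength K y p))) else 0 with hψdef
    have hψ : Measurable (Function.uncurry ψ) := by
      refine Measurable.ite ?_ ?_ measurable_const
      · exact measurableSet_le measurable_const (continuous_l2.measurable.comp
          (measurable_snd.comp measurable_fst))
      · refine ENNReal.measurable_ofReal.comp (Real.measurable_exp.comp (Measurable.const_mul ?_ r))
        exact ((h.measurable_queueDrift y).const_add c).div
          ((continuous_lyapunovLength y).measurable.comp measurable_fst)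
    have hψ1 : ∀ ω, ∫⁻ s, ψ (Y k ω) s ∂P ≤ 1 := by
      intro ω
      by_cases hcase : 2 * c / σ ≤ l2 (Y k ω).2
      · simp only [hψdef, if_pos hcase]
        exact h.lintegral_exp_drift_le hσ hH hy hFy (pdIter_fst_mem h.compact hx0 _ k)
          (pdIter_snd_nonneg x0 _ k) hcpos hcase
      · simp [hψdef, if_neg hcase]
    have hstep := hξ.lintegral_mul_le k hg (hYm k) hψ hψ1
    calc ∫⁻ ω, ENNReal.ofReal (Real.exp (r * lyapunovLength K y (Y (k + 1) ω))) ∂μ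
        ≤ ∫⁻ ω, (ENNReal.ofReal (Real.exp (r * lyapunovLength K y (Y k ω))) * ψ (Y k ω) (ξ k ω)
            + ENNReal.ofReal (Real.exp (r * (2 * c / σ + H + √(2 * K) * D)))) ∂μ := by
          refine lintegral_mono_ae ?_
          filter_upwards [h.ae_good hξ hK hx0 k] with ω hω
          exact exp_lyapunovLength_pdStep_le h.convex h.compact hK h.diam
            (pdIter_fst_mem h.compact hx0 _ k) hω hy hr hq hc
      _ = ∫⁻ ω, ENNReal.ofReal (Real.exp (r * lyapunovLength K y (Y k ω)))
              * ψ (Y k ω) (ξ k ω) ∂μ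
            + ENNReal.ofReal (Real.exp (r * (2 * c / σ + H + √(2 * K) * D))) := by
          rw [lintegral_add_right _ measurable_const]
          simp
      _ ≤ 1 * ((k + 1) * ENNReal.ofReal (Real.exp (r * (2 * c / σ + H + √(2 * K) * D))))
            + ENNReal.ofReal (Real.exp (r * (2 * c / σ + H + √(2 * K) * D))) := by
          gcongr
          exact hstep.trans (by gcongr)
      _ = _ := by push_cast; ring

/-- The tail bound for the queues. -/
lemma StochasticProgram.measure_queue_ge_le [IsProbabilityMeasure P]
    [IsProbabilityMeasure μ] (h : StochasticProgram X F S P D A B)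
    (hξ : IsSampleFiltration 𝓕 ξ P μ) (hK : 1 ≤ K) (hσ : 0 < σ) (hD : 0 ≤ D) (hB : 0 ≤ B)
    (hH : 0 < boundH D A B m) {x0 : Vec d} (hx0 : x0 ∈ X) {y : Vec d} (hy : y ∈ X)
    (hFy : ∀ i : Fin m, F i.succ y ≤ -σ) {δ : ℝ} (hδ : 0 < δ) (hδ1 : δ < 1) {k : ℕ}
    (hk : k ≤ K) :
    μ {ω | √(K : ℝ) * boundLambda D A B m σ K δ
        ≤ l2 (pdIter X S K x0 (fun j => ξ j ω) k).2} ≤ ENNReal.ofReal (δ / (2 * K)) := by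
  set H := boundH D A B m with hHdef
  set r := σ / H ^ 2 with hrdef
  set c := H ^ 2 / 2 + √(K : ℝ) * (B * D) with hc
  set w := √(K : ℝ) * boundLambda D A B m σ K δ with hw
  have hK1 : (1 : ℝ) ≤ K := by exact_mod_cast hK
  have hr : 0 ≤ r := by positivity
  have hmeas : Measurable fun ω => lyapunovLength K y (pdIter X S K x0 (fun j => ξ j ω) k) :=
    (continuous_lyapunovLength y).measurable.comp
      (Measurable.le (hξ.le k) (measurable_pdIter h hξ hK hx0 k))
  have h1 := measure_le_of_lintegral_exp_le (w := w)
    (h.lintegral_exp_lyapunovLength_le hξ hK hσ hD hB hH hx0 hy hFy hc k) hmeas hr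
  refine (measure_mono fun ω (hω : w ≤ _) => hω.trans (l2_le_lyapunovLength y _)).trans
    (h1.trans ?_)
  have hnum := le_boundLambda hσ hD hH hK hδ hδ1 hc
  set bd := 2 * c / σ + H + √(2 * K) * D with hbd
  have hcast : ((k : ENNReal) + 1) = ENNReal.ofReal ((k : ℝ) + 1) := by
    rw [ENNReal.ofReal_add (by positivity) zero_le_one]; simp
  rw [hcast, ← ENNReal.ofReal_mul (by positivity), ← ENNReal.ofReal_mul (Real.exp_pos _).le]
  refine ENNReal.ofReal_le_ofReal ?_
  have hpos : 0 < 2 * (K : ℝ) / δ := by positivity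
  have hlog : 0 ≤ Real.log (2 * K / δ) :=
    Real.log_nonneg ((one_le_div hδ).mpr (by linarith))
  have hgap : 2 * Real.log (2 * K / δ) ≤ r * (w - bd) := by
    have h2 : r * (8 * H ^ 2 / σ * Real.log (2 * K / δ)) ≤ r * (w - bd) :=
      mul_le_mul_of_nonneg_left (by linarith) hr
    have h3 : r * (8 * H ^ 2 / σ * Real.log (2 * K / δ)) = 8 * Real.log (2 * K / δ) := by
      rw [hrdef]; field_simp
    linarith
  have hk1 : (k : ℝ) + 1 ≤ 2 * K := by
    have : (k : ℝ) ≤ K := by exact_mod_cast hk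
    linarith
  calc Real.exp (-(r * w)) * ((k + 1) * Real.exp (r * bd))
      = (k + 1) * Real.exp (-(r * (w - bd))) := by
        rw [mul_left_comm, ← Real.exp_add]; ring_nf
    _ ≤ (2 * K) * Real.exp (-(2 * Real.log (2 * K / δ))) := by gcongr
    _ = (2 * K) * (δ / (2 * K)) ^ 2 := by
        congr 1
        rw [show -(2 * Real.log (2 * K / δ)) = (2 : ℕ) * Real.log (2 * K / δ)⁻¹ by
          rw [Real.log_inv]; push_cast; ring, Real.exp_nat_mul, Real.exp_log (by positivity),
          inv_div]
    _ = δ * (δ / (2 * K)) := by field_simp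
    _ ≤ 1 * (δ / (2 * K)) := by gcongr
    _ = δ / (2 * K) := one_mul _

end QueueTail

/-! ### High-probability guarantee of the primal-dual method -/

section Pathwise

variable {m d : ℕ} {Ξ : Type*} {X : Set (Vec d)} {S : Estimator m d Ξ} {D A B : ℝ} {K : ℕ}

lemma sqrt_mul_sum_inner_le (hconv : Convex ℝ X) (hX : IsCompact X) (hK : 1 ≤ K)
    (hdiam : ∀ x ∈ X, ∀ y ∈ X, ‖x - y‖ ≤ D) {x0 : Vec d} (hx0 : x0 ∈ X) {s : ℕ → Ξ}
    (hg : ∀ k < K, GoodSample S A B (pdIter X S K x0 s k).1 (s k)) {w : Vec d} (hw : w ∈ X) :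
    √(K : ℝ) * ∑ k ∈ Finset.range K,
        inner ℝ (S.ζ 0 (pdIter X S K x0 s k).1 (s k)) ((pdIter X S K x0 s k).1 - w)
      ≤ K * (D ^ 2 + B ^ 2 / 4 + boundH D A B m ^ 2 / 2)
        + ∑ k ∈ Finset.range K, queueDrift S w (pdIter X S K x0 s k) (s k) := by
  set Y := pdIter X S K x0 s with hY
  set Φ : ℕ → ℝ := fun k => K * ‖w - (Y k).1‖ ^ 2 + l2 (Y k).2 ^ 2 / 2 with hΦ
  have hmem : ∀ k, (Y k).1 ∈ X := pdIter_fst_mem hX hx0 s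
  have hstep : ∀ k ∈ Finset.range K,
      √(K : ℝ) * inner ℝ (S.ζ 0 (Y k).1 (s k)) ((Y k).1 - w)
        ≤ (B ^ 2 / 4 + boundH D A B m ^ 2 / 2 + queueDrift S w (Y k) (s k))
          + (Φ k - Φ (k + 1)) := by
    intro k hk
    have h := pdStep_regret hconv hX hK (hg k (Finset.mem_range.mp hk))
      (hdiam _ (hmem (k + 1)) _ (hmem k)) hw
    change _ ≤ _ + (Φ k) - Φ (k + 1) at h
    linarith
  have hsum := Finset.sum_le_sum hstep
  rw [← Finset.mul_sum, Finset.sum_add_distrib, Finset.sum_range_sub', Finset.sum_add_distrib,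
    Finset.sum_const, Finset.card_range, nsmul_eq_mul] at hsum
  have h0 : Φ 0 ≤ K * D ^ 2 := by
    have h1 : Φ 0 = K * ‖w - x0‖ ^ 2 + l2 (fun _ : Fin m => (0 : ℝ)) ^ 2 / 2 := rfl
    have h2 : l2 (fun _ : Fin m => (0 : ℝ)) = 0 := by rw [l2_const]; simp
    rw [h1, h2]
    have h3 : ‖w - x0‖ ^ 2 ≤ D ^ 2 := pow_le_pow_left₀ (norm_nonneg _) (hdiam w hw x0 hx0) 2
    have h4 := mul_le_mul_of_nonneg_left h3 (Nat.cast_nonneg (α := ℝ) K)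
    linarith
  have hK0 : 0 ≤ Φ K := by positivity
  linarith

lemma sum_estimate_le (hconv : Convex ℝ X) (hX : IsCompact X) (hK : 1 ≤ K) {x0 : Vec d}
    (hx0 : x0 ∈ X) {s : ℕ → Ξ} (hB : 0 ≤ B)
    (hg : ∀ k < K, GoodSample S A B (pdIter X S K x0 s k).1 (s k)) {Λ : ℝ}
    (hQ : ∀ k ≤ K, l2 (pdIter X S K x0 s k).2 ≤ √(K : ℝ) * Λ) (i : Fin m) :
    ∑ k ∈ Finset.range K, S.θ i.succ (pdIter X S K x0 s k).1 (s k)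
      ≤ √(K : ℝ) * (Λ + (B ^ 2 + Λ * √(m : ℝ) * B ^ 2) / 2) := by
  set Y := pdIter X S K x0 s with hY
  have hmem : ∀ k, (Y k).1 ∈ X := pdIter_fst_mem hX hx0 s
  have hKpos : (0 : ℝ) < K := by exact_mod_cast hK
  have hstep : ∀ k ∈ Finset.range K, S.θ i.succ (Y k).1 (s k)
      ≤ (√(K : ℝ) * (B ^ 2 + Λ * √(m : ℝ) * B ^ 2)) / (2 * K)
        + ((Y (k + 1)).2 i - (Y k).2 i) := by
    intro k hk
    have hk := Finset.mem_range.mp hk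
    have h1 : S.θ i.succ (Y k).1 (s k)
        ≤ (Y (k + 1)).2 i - (Y k).2 i + B * ‖(Y (k + 1)).1 - (Y k).1‖ :=
      estimate_le_queue_increment (hg k hk) i
    have h2 : 2 * K * ‖(Y (k + 1)).1 - (Y k).1‖
        ≤ √(K : ℝ) * B + l2 (Y k).2 * (√(m : ℝ) * B) :=
      norm_pdStep_fst_sub_le hconv hX hK (hmem k) (hg k hk)
    have h3 : l2 (Y k).2 * (√(m : ℝ) * B) ≤ √(K : ℝ) * Λ * (√(m : ℝ) * B) :=
      mul_le_mul_of_nonneg_right (hQ k hk.le) (by positivity)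
    have h4 : B * ‖(Y (k + 1)).1 - (Y k).1‖
        ≤ (√(K : ℝ) * (B ^ 2 + Λ * √(m : ℝ) * B ^ 2)) / (2 * K) := by
      rw [le_div_iff₀ (by positivity)]
      have := mul_le_mul_of_nonneg_left (h2.trans (add_le_add_right h3 _)) hB
      linarith
    linarith
  have hsum := Finset.sum_le_sum hstep
  rw [Finset.sum_add_distrib, Finset.sum_range_sub fun k => (Y k).2 i, Finset.sum_const,
    Finset.card_range, nsmul_eq_mul] at hsum
  have h0 : (Y 0).2 i = 0 := rfl
  have h5 : (Y K).2 i ≤ √(K : ℝ) * Λ := (le_abs_self _).trans ((abs_le_l2 _ i).trans (hQ K le_rfl))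
  have h6 : (K : ℝ) * (√(K : ℝ) * (B ^ 2 + Λ * √(m : ℝ) * B ^ 2) / (2 * K))
      = √(K : ℝ) * ((B ^ 2 + Λ * √(m : ℝ) * B ^ 2) / 2) := by field_simp
  rw [h6, h0] at hsum
  linarith

end Pathwise

section HighProbability

variable {m d : ℕ} {Ξ : Type*} [MeasurableSpace Ξ] {X : Set (Vec d)}
  {F : Fin (m + 1) → Vec d → ℝ} {S : Estimator m d Ξ} {P : Measure Ξ} {D A B σ : ℝ} {K : ℕ}
  {Ω : Type*} [MeasurableSpace Ω] {μ : Measure Ω} {𝓕 : ℕ → MeasurableSpace Ω} {ξ : ℕ → Ω → Ξ}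

lemma boundLambda_nonneg (hσ : 0 < σ) (hH : 0 ≤ boundH D A B m) (hD : 0 ≤ D) (hB : 0 ≤ B)
    (hK : 1 ≤ K) {δ : ℝ} (hδ : 0 < δ) (hδ1 : δ < 1) : 0 ≤ boundLambda D A B m σ K δ := by
  have hK1 : (1 : ℝ) ≤ K := by exact_mod_cast hK
  have hlog : 0 ≤ Real.log (2 * K / δ) :=
    Real.log_nonneg ((one_le_div hδ).mpr (by linarith))
  have hlog1 : 0 ≤ Real.log (1 + 32 * boundH D A B m ^ 2 / σ ^ 2
      * Real.exp (σ / (8 * boundH D A B m))) :=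
    Real.log_nonneg (by
      have : 0 ≤ 32 * boundH D A B m ^ 2 / σ ^ 2 * Real.exp (σ / (8 * boundH D A B m)) := by
        positivity
      linarith)
  unfold boundLambda
  positivity

/-- Deviation of the objective estimates. -/
lemma StochasticProgram.measure_objective_deviation_le [IsProbabilityMeasure P]
    [IsProbabilityMeasure μ] (h : StochasticProgram X F S P D A B)
    (hξ : IsSampleFiltration 𝓕 ξ P μ) (hK : 1 ≤ K) (hD : 0 ≤ D) (hB : 0 ≤ B)
    {x0 : Vec d} (hx0 : x0 ∈ X) {w : Vec d} (hw : w ∈ X) {L : ℝ} (hL : 0 ≤ L) :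
    μ {ω | B * D * √(2 * K * L) < ∑ k ∈ Finset.range K,
        (inner ℝ (S.ζ 0 (pdIter X S K x0 (fun j => ξ j ω) k).1 (ξ k ω))
            (w - (pdIter X S K x0 (fun j => ξ j ω) k).1)
          - (F 0 w - F 0 (pdIter X S K x0 (fun j => ξ j ω) k).1))}
      ≤ ENNReal.ofReal (Real.exp (-L)) := by
  have hx : Measurable fun q : (Vec d × (Fin m → ℝ)) × Ξ => (q.1.1, q.2) := by fun_prop
  have hm : Measurable fun q : (Vec d × (Fin m → ℝ)) × Ξ => w - q.1.1 := by fun_prop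
  exact hξ.measure_sum_gt_le (measurable_pdIter h hξ hK hx0)
    (U := fun p s => inner ℝ (S.ζ 0 p.1 s) (w - p.1)) (a := fun p => F 0 w - F 0 p.1)
    (((h.measurable_ζ 0).comp hx).inner hm)
    (((h.measurable_F 0).comp measurable_fst).const_sub _) (by positivity)
    (fun k ω => by
      filter_upwards [h.good _ (pdIter_fst_mem h.compact hx0 _ k)] with s hs
      exact hs.abs_inner_le 0 (h.diam _ hw _ (pdIter_fst_mem h.compact hx0 _ k)))
    (fun k ω => h.integral_inner_le 0 (pdIter_fst_mem h.compact hx0 _ k) hw) hK hL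

/-- Deviation of the queue drift towards a feasible point, with the queues truncated at `b`. -/
lemma StochasticProgram.measure_queueDrift_deviation_le [IsProbabilityMeasure P]
    [IsProbabilityMeasure μ] (h : StochasticProgram X F S P D A B)
    (hξ : IsSampleFiltration 𝓕 ξ P μ) (hK : 1 ≤ K) (hH : 0 ≤ boundH D A B m)
    {x0 : Vec d} (hx0 : x0 ∈ X) {w : Vec d} (hw : w ∈ X) (hFw : ∀ i : Fin m, F i.succ w ≤ 0)
    {L b : ℝ} (hL : 0 ≤ L) (hb : 0 ≤ b) :
    μ {ω | b * boundH D A B m * √(2 * K * L) < ∑ k ∈ Finset.range K,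
        ((if l2 (pdIter X S K x0 (fun j => ξ j ω) k).2 ≤ b then
          queueDrift S w (pdIter X S K x0 (fun j => ξ j ω) k) (ξ k ω) else 0) - 0)}
      ≤ ENNReal.ofReal (Real.exp (-L)) := by
  refine hξ.measure_sum_gt_le (measurable_pdIter h hξ hK hx0)
    (U := fun p s => if l2 p.2 ≤ b then queueDrift S w p s else 0) (a := fun _ => 0)
    ?_ measurable_const (by positivity) ?_ ?_ hK hL
  · exact Measurable.ite (measurableSet_le (continuous_l2.measurable.comp
      (measurable_snd.comp measurable_fst)) measurable_const) (h.measurable_queueDrift w)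
      measurable_const
  · intro k ω
    filter_upwards [h.good _ (pdIter_fst_mem h.compact hx0 _ k)] with s hs
    split_ifs with hc
    · exact (hs.abs_queueDrift_le (h.diam _ hw _ (pdIter_fst_mem h.compact hx0 _ k))).trans
        (mul_le_mul_of_nonneg_right hc hH)
    · rw [abs_zero]; positivity
  · intro k ω
    split_ifs with hc
    · refine (h.integral_queueDrift_le (pdIter_fst_mem h.compact hx0 _ k)
        (pdIter_snd_nonneg x0 _ k) hw).trans ?_
      exact Finset.sum_nonpos fun i _ =>
        mul_nonpos_of_nonneg_of_nonpos (pdIter_snd_nonneg x0 _ k i) (hFw i)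
    · simp

/-- Deviation of the constraint estimates. -/
lemma StochasticProgram.measure_constraint_deviation_le [IsProbabilityMeasure P]
    [IsProbabilityMeasure μ] (h : StochasticProgram X F S P D A B)
    (hξ : IsSampleFiltration 𝓕 ξ P μ) (hK : 1 ≤ K) (hA : 0 ≤ A)
    {x0 : Vec d} (hx0 : x0 ∈ X) {L : ℝ} (hL : 0 ≤ L) (i : Fin m) :
    μ {ω | A * √(2 * K * L) < ∑ k ∈ Finset.range K,
        (-S.θ i.succ (pdIter X S K x0 (fun j => ξ j ω) k).1 (ξ k ω)
          - -F i.succ (pdIter X S K x0 (fun j => ξ j ω) k).1)}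
      ≤ ENNReal.ofReal (Real.exp (-L)) := by
  have hx : Measurable fun q : (Vec d × (Fin m → ℝ)) × Ξ => (q.1.1, q.2) := by fun_prop
  refine hξ.measure_sum_gt_le (measurable_pdIter h hξ hK hx0)
    (U := fun p s => -S.θ i.succ p.1 s) (a := fun p => -F i.succ p.1)
    ((h.measurable_θ i.succ).comp hx).neg ((h.measurable_F i.succ).comp measurable_fst).neg hA
    ?_ ?_ hK hL
  · intro k ω
    filter_upwards [h.good _ (pdIter_fst_mem h.compact hx0 _ k)] with s hs
    rw [abs_neg]
    exact (abs_le_l2 (fun i : Fin m => S.θ i.succ _ s) i).trans hs.1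
  · intro k ω
    rw [integral_neg, (h.mean_θ i.succ _ (pdIter_fst_mem h.compact hx0 _ k)).2]

/-- Off the exceptional events, averaging the iterates gives both bounds. -/
lemma StochasticProgram.bounds_of_good (h : StochasticProgram X F S P D A B) (hK : 1 ≤ K)
    (hm : 1 ≤ m) (hA : 0 ≤ A) (hB : 0 ≤ B) (hD : 0 ≤ D) (hσ : 0 < σ) {δ : ℝ} (hδ : 0 < δ)
    (hδ1 : δ < 1) {x0 : Vec d} (hx0 : x0 ∈ X) {w : Vec d} (hw : w ∈ X) {s : ℕ → Ξ}
    (hg : ∀ k < K, GoodSample S A B (pdIter X S K x0 s k).1 (s k))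
    (hQ : ∀ k ≤ K, l2 (pdIter X S K x0 s k).2 ≤ √(K : ℝ) * boundLambda D A B m σ K δ)
    (h1 : ∑ k ∈ Finset.range K, (inner ℝ (S.ζ 0 (pdIter X S K x0 s k).1 (s k))
        (w - (pdIter X S K x0 s k).1) - (F 0 w - F 0 (pdIter X S K x0 s k).1))
      ≤ B * D * √(2 * K * Real.log (8 / δ)))
    (h2 : ∑ k ∈ Finset.range K, queueDrift S w (pdIter X S K x0 s k) (s k)
      ≤ √(K : ℝ) * boundLambda D A B m σ K δ * boundH D A B m * √(2 * K * Real.log (8 / δ)))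
    (h3 : ∀ i : Fin m, ∑ k ∈ Finset.range K, (-S.θ i.succ (pdIter X S K x0 s k).1 (s k)
        - -F i.succ (pdIter X S K x0 s k).1) ≤ A * √(2 * K * Real.log (8 * m / δ))) :
    ∑ k ∈ Finset.range K, (F 0 (pdIter X S K x0 s k).1 - F 0 w) ≤ K * boundB1 D A B m σ K δ ∧
    ∀ i : Fin m, ∑ k ∈ Finset.range K, F i.succ (pdIter X S K x0 s k).1
      ≤ K * boundB2 D A B m σ K δ := by
  have hK1 : (1 : ℝ) ≤ K := by exact_mod_cast hK
  have hKpos : (0 : ℝ) < K := by linarith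
  have hs : 0 < √(K : ℝ) := Real.sqrt_pos.mpr hKpos
  have hs2 : √(K : ℝ) * √(K : ℝ) = K := Real.mul_self_sqrt hKpos.le
  have hH : 0 ≤ boundH D A B m := by unfold boundH; positivity
  have hΛ := boundLambda_nonneg (m := m) (A := A) hσ hH hD hB hK hδ hδ1
  have hsplit : ∀ L : ℝ, √(2 * K * L) = √(K : ℝ) * √(2 * L) := by
    intro L
    rw [← Real.sqrt_mul hKpos.le]
    ring_nf
  have hdiv : ∀ a : ℝ, (K : ℝ) * (a / √(K : ℝ)) = √(K : ℝ) * a := by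
    intro a
    rw [mul_div_assoc', div_eq_iff hs.ne']
    linear_combination (-a) * hs2
  constructor
  · have h4 := sqrt_mul_sum_inner_le h.convex h.compact hK h.diam hx0 hg hw
    have h5 := h4.trans (add_le_add_right h2 _)
    rw [hsplit] at h5 h1
    set R := √(2 * Real.log (8 / δ))
    have hR : 0 ≤ R := Real.sqrt_nonneg _
    set T := ∑ k ∈ Finset.range K,
        inner ℝ (S.ζ 0 (pdIter X S K x0 s k).1 (s k)) ((pdIter X S K x0 s k).1 - w)
    have h6 : T ≤ √(K : ℝ) * (D ^ 2 + B ^ 2 / 4 + boundH D A B m ^ 2 / 2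
        + boundLambda D A B m σ K δ * boundH D A B m * R) := by
      refine le_of_mul_le_mul_left (h5.trans (le_of_eq ?_)) hs
      linear_combination (-(D ^ 2 + B ^ 2 / 4 + boundH D A B m ^ 2 / 2)) * hs2
    have h7 : ∑ k ∈ Finset.range K, (F 0 (pdIter X S K x0 s k).1 - F 0 w)
        = ∑ k ∈ Finset.range K, (inner ℝ (S.ζ 0 (pdIter X S K x0 s k).1 (s k))
          (w - (pdIter X S K x0 s k).1) - (F 0 w - F 0 (pdIter X S K x0 s k).1)) + T := by
      rw [← Finset.sum_add_distrib]
      refine Finset.sum_congr rfl fun k _ => ?_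
      rw [← neg_sub (pdIter X S K x0 s k).1 w, inner_neg_right]
      ring
    rw [h7, boundB1, hdiv]
    have h8 : 0 ≤ √(K : ℝ) * (R * (boundH D A B m * boundLambda D A B m σ K δ + B * D)) := by
      positivity
    linarith
  · intro i
    have h4 := sum_estimate_le h.convex h.compact hK hx0 hB hg hQ i
    have h5 := h3 i
    rw [hsplit] at h5
    set R := √(2 * Real.log (8 * m / δ))
    have h7 : ∑ k ∈ Finset.range K, F i.succ (pdIter X S K x0 s k).1
        = ∑ k ∈ Finset.range K, (-S.θ i.succ (pdIter X S K x0 s k).1 (s k)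
          - -F i.succ (pdIter X S K x0 s k).1)
          + ∑ k ∈ Finset.range K, S.θ i.succ (pdIter X S K x0 s k).1 (s k) := by
      rw [← Finset.sum_add_distrib]
      exact Finset.sum_congr rfl fun k _ => by ring
    rw [h7, boundB2, hdiv]
    have h8 : 0 ≤ √(K : ℝ) * (A * R + B ^ 2 / 2) := by positivity
    linarith

/-- Convexity passes the bounds on the sums to the average of the iterates. -/
lemma StochasticProgram.mul_average_le (h : StochasticProgram X F S P D A B) (hK : 1 ≤ K)
    {z : ℕ → Vec d} (hz : ∀ k, z k ∈ X) :
    (K : ℝ)⁻¹ • ∑ k ∈ Finset.range K, z k ∈ X ∧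
    ∀ i, K * F i ((K : ℝ)⁻¹ • ∑ k ∈ Finset.range K, z k) ≤ ∑ k ∈ Finset.range K, F i (z k) := by
  have hKpos : (0 : ℝ) < K := by exact_mod_cast hK
  set x := (K : ℝ)⁻¹ • ∑ k ∈ Finset.range K, z k with hxdef
  have hx : x ∈ X := by
    rw [hxdef, Finset.smul_sum]
    refine h.convex.sum_mem (fun _ _ => by positivity) ?_ fun k _ => hz k
    rw [Finset.sum_const, Finset.card_range, nsmul_eq_mul, mul_inv_cancel₀ hKpos.ne']
  refine ⟨hx, fun i => ?_⟩
  have hsum : ∑ k ∈ Finset.range K, (z k - x) = 0 := by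
    rw [Finset.sum_sub_distrib, Finset.sum_const, Finset.card_range, ← Nat.cast_smul_eq_nsmul ℝ,
      hxdef, smul_smul, mul_inv_cancel₀ hKpos.ne', one_smul, sub_self]
  have h1 : ∑ k ∈ Finset.range K, (F i x + inner ℝ (∫ s, S.ζ i x s ∂P) (z k - x))
      ≤ ∑ k ∈ Finset.range K, F i (z k) :=
    Finset.sum_le_sum fun k _ => (h.mean_ζ i x hx).2 _ (hz k)
  rwa [Finset.sum_add_distrib, ← inner_sum, hsum, inner_zero_right, add_zero, Finset.sum_const,
    Finset.card_range, nsmul_eq_mul] at h1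

/-- With probability at least `1 - δ`, the averaged iterate is nearly optimal and nearly
feasible. -/
theorem StochasticProgram.measure_not_bounds_le [IsProbabilityMeasure P]
    [IsProbabilityMeasure μ] (h : StochasticProgram X F S P D A B)
    (hξ : IsSampleFiltration 𝓕 ξ P μ) (hK : 1 ≤ K) (hm : 1 ≤ m) (hσ : 0 < σ) (hD : 0 ≤ D)
    (hA : 0 ≤ A) (hB : 0 ≤ B) (hH : 0 < boundH D A B m) {x0 : Vec d} (hx0 : x0 ∈ X) {y : Vec d}
    (hy : y ∈ X) (hFy : ∀ i : Fin m, F i.succ y ≤ -σ) {w : Vec d} (hw : w ∈ X)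
    (hFw : ∀ i : Fin m, F i.succ w ≤ 0) {δ : ℝ} (hδ : 0 < δ) (hδ1 : δ < 1) :
    μ {ω | ¬ (F 0 ((K : ℝ)⁻¹ • ∑ k ∈ Finset.range K, (pdIter X S K x0 (fun j => ξ j ω) k).1)
          - F 0 w ≤ boundB1 D A B m σ K δ ∧
        ∀ i : Fin m, F i.succ
          ((K : ℝ)⁻¹ • ∑ k ∈ Finset.range K, (pdIter X S K x0 (fun j => ξ j ω) k).1)
            ≤ boundB2 D A B m σ K δ)} ≤ ENNReal.ofReal δ := by
  have hKpos : (0 : ℝ) < K := by exact_mod_cast hK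
  have hm1 : (1 : ℝ) ≤ m := by exact_mod_cast hm
  have hL1 : 0 ≤ Real.log (8 / δ) := Real.log_nonneg ((one_le_div hδ).mpr (by linarith))
  have hL2 : 0 ≤ Real.log (8 * m / δ) := Real.log_nonneg ((one_le_div hδ).mpr (by linarith))
  have hΛ := boundLambda_nonneg (m := m) (A := A) hσ hH.le hD hB hK hδ hδ1
  set Λ := boundLambda D A B m σ K δ with hΛdef
  set Y : Ω → ℕ → Vec d × (Fin m → ℝ) := fun ω k => pdIter X S K x0 (fun j => ξ j ω) k with hY
  set E0 : Set Ω := {ω | ¬ ∀ k, GoodSample S A B (Y ω k).1 (ξ k ω)} with hE0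
  set E1 : ℕ → Set Ω := fun k => {ω | √(K : ℝ) * Λ ≤ l2 (Y ω (k + 1)).2} with hE1
  set E2 : Set Ω := {ω | B * D * √(2 * K * Real.log (8 / δ)) < ∑ k ∈ Finset.range K,
        (inner ℝ (S.ζ 0 (Y ω k).1 (ξ k ω)) (w - (Y ω k).1)
          - (F 0 w - F 0 (Y ω k).1))} with hE2
  set E3 : Set Ω := {ω | √(K : ℝ) * Λ * boundH D A B m * √(2 * K * Real.log (8 / δ))
      < ∑ k ∈ Finset.range K, ((if l2 (Y ω k).2 ≤ √(K : ℝ) * Λ then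
          queueDrift S w (Y ω k) (ξ k ω) else 0) - 0)} with hE3
  set E4 : Fin m → Set Ω := fun i => {ω | A * √(2 * K * Real.log (8 * m / δ))
      < ∑ k ∈ Finset.range K, (-S.θ i.succ (Y ω k).1 (ξ k ω) - -F i.succ (Y ω k).1)} with hE4
  have hexp : ∀ a : ℝ, 0 < a → Real.exp (-Real.log (a / δ)) = δ / a := by
    intro a ha
    rw [Real.exp_neg, Real.exp_log (by positivity), inv_div]
  have p0 : μ E0 = 0 := ae_iff.mp (ae_all_iff.mpr fun k => h.ae_good hξ hK hx0 k)
  have p1 : μ (⋃ k ∈ Finset.range K, E1 k) ≤ ENNReal.ofReal (δ / 2) := by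
    refine (measure_biUnion_finset_le _ _).trans ?_
    have : ∀ k ∈ Finset.range K, μ (E1 k) ≤ ENNReal.ofReal (δ / (2 * K)) := fun k hk =>
      h.measure_queue_ge_le hξ hK hσ hD hB hH hx0 hy hFy hδ hδ1 (Finset.mem_range.mp hk)
    refine (Finset.sum_le_sum this).trans ?_
    rw [Finset.sum_const, Finset.card_range, nsmul_eq_mul, ← ENNReal.ofReal_natCast,
      ← ENNReal.ofReal_mul (Nat.cast_nonneg _)]
    refine ENNReal.ofReal_le_ofReal (le_of_eq ?_)
    field_simp
  have p2 : μ E2 ≤ ENNReal.ofReal (δ / 8) := by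
    have := h.measure_objective_deviation_le hξ hK hD hB hx0 hw hL1
    rwa [hexp 8 (by norm_num)] at this
  have p3 : μ E3 ≤ ENNReal.ofReal (δ / 8) := by
    have := h.measure_queueDrift_deviation_le hξ hK hH.le hx0 hw hFw hL1
      (b := √(K : ℝ) * Λ) (by positivity)
    rwa [hexp 8 (by norm_num)] at this
  have p4 : μ (⋃ i, E4 i) ≤ ENNReal.ofReal (δ / 8) := by
    refine (measure_iUnion_fintype_le _ _).trans ?_
    have : ∀ i ∈ Finset.univ, μ (E4 i) ≤ ENNReal.ofReal (δ / (8 * m)) := fun i _ => by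
      have := h.measure_constraint_deviation_le hξ hK hA hx0 hL2 i
      rwa [hexp (8 * m) (by positivity)] at this
    refine (Finset.sum_le_sum this).trans ?_
    rw [Finset.sum_const, Finset.card_univ, Fintype.card_fin, nsmul_eq_mul,
      ← ENNReal.ofReal_natCast, ← ENNReal.ofReal_mul (Nat.cast_nonneg _)]
    refine ENNReal.ofReal_le_ofReal (le_of_eq ?_)
    field_simp
  have hsub : {ω | ¬ (F 0 ((K : ℝ)⁻¹ • ∑ k ∈ Finset.range K, (Y ω k).1)
          - F 0 w ≤ boundB1 D A B m σ K δ ∧ ∀ i : Fin m, F i.succ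
          ((K : ℝ)⁻¹ • ∑ k ∈ Finset.range K, (Y ω k).1) ≤ boundB2 D A B m σ K δ)}
      ⊆ E0 ∪ (⋃ k ∈ Finset.range K, E1 k) ∪ E2 ∪ E3 ∪ ⋃ i, E4 i := by
    intro ω hω
    by_contra hn
    simp only [Set.mem_union, not_or, Set.mem_iUnion, not_exists] at hn
    obtain ⟨⟨⟨⟨n0, n1⟩, n2⟩, n3⟩, n4⟩ := hn
    have g0 : ∀ k, GoodSample S A B (Y ω k).1 (ξ k ω) := by
      by_contra hcon; exact n0 hcon
    have g1 : ∀ k ≤ K, l2 (Y ω k).2 ≤ √(K : ℝ) * Λ := by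
      intro k hk
      cases k with
      | zero =>
        change l2 (fun _ : Fin m => (0 : ℝ)) ≤ _
        rw [l2_const, abs_zero, mul_zero]
        positivity
      | succ k =>
        have := n1 k (Finset.mem_range.mpr hk)
        exact (not_le.mp this).le
    have g3 : ∑ k ∈ Finset.range K, queueDrift S w (Y ω k) (ξ k ω)
        ≤ √(K : ℝ) * Λ * boundH D A B m * √(2 * K * Real.log (8 / δ)) := by
      refine le_trans (le_of_eq (Finset.sum_congr rfl fun k hk => ?_)) (not_lt.mp n3)
      rw [if_pos (g1 k (Finset.mem_range.mp hk).le), sub_zero]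
    obtain ⟨b1, b2⟩ := h.bounds_of_good hK hm hA hB hD hσ hδ hδ1 hx0 hw (fun k _ => g0 k) g1
      (not_lt.mp n2) g3 fun i => not_lt.mp (n4 i)
    obtain ⟨_, havg⟩ := h.mul_average_le hK
      (z := fun k => (Y ω k).1) fun k => pdIter_fst_mem h.compact hx0 _ k
    refine hω ⟨?_, fun i => ?_⟩
    · rw [Finset.sum_sub_distrib, Finset.sum_const, Finset.card_range, nsmul_eq_mul] at b1
      refine le_of_mul_le_mul_left ?_ hKpos
      have := havg 0
      rw [mul_sub]
      linarith
    · exact le_of_mul_le_mul_left ((havg i.succ).trans (b2 i)) hKpos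
  refine (measure_mono hsub).trans ?_
  refine (measure_union_le _ _).trans ((add_le_add ((measure_union_le _ _).trans
    (add_le_add ((measure_union_le _ _).trans (add_le_add ((measure_union_le _ _).trans
      (add_le_add p0.le p1)) p2)) p3)) p4).trans ?_)
  rw [zero_add, ← ENNReal.ofReal_add (by positivity) (by positivity),
    ← ENNReal.ofReal_add (by positivity) (by positivity),
    ← ENNReal.ofReal_add (by positivity) (by positivity)]
  exact ENNReal.ofReal_le_ofReal (by linarith)

end HighProbability

/-! ### The proximal subproblem -/

section Subproblem

variable {m d : ℕ} {X : Set (Vec d)} {f : Fin (m + 1) → Vec d → EReal}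
  {ρ ε σ ρε D M ρhat : ℝ}

lemma ProblemAssumption.ne_top (h : ProblemAssumption X f ρ ε σ ρε D M) (i : Fin (m + 1))
    {x : Vec d} (hx : x ∈ X) : f i x ≠ ⊤ := by
  obtain ⟨v, hv⟩ := h.subdifferential_nonempty i x hx
  exact hv.1

lemma ProblemAssumption.toReal_add_inner_le (h : ProblemAssumption X f ρ ε σ ρε D M)
    (i : Fin (m + 1)) {x y : Vec d} (hx : x ∈ X) (hy : y ∈ X) {v : Vec d}
    (hv : v ∈ subdifferential (f i) x) :
    (f i x).toReal + inner ℝ v (y - x) - ρ / 2 * ‖y - x‖ ^ 2 ≤ (f i y).toReal := by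
  have h1 := h.weaklyConvex i y hy x hx v hv
  rwa [← EReal.coe_toReal (h.ne_top i hy) (h.ne_bot i y), EReal.coe_le_coe_iff] at h1

lemma proxFun_identity (x y xt : Vec d) :
    ρhat / 2 * ‖y - xt‖ ^ 2 = ρhat / 2 * ‖x - xt‖ ^ 2 + inner ℝ (ρhat • (x - xt)) (y - x)
      + ρhat / 2 * ‖y - x‖ ^ 2 := by
  rw [show y - xt = (x - xt) + (y - x) by abel, norm_add_sq_real, real_inner_smul_left]
  ring

/-- The functions `F_i` are `(ρ̂ - ρ)`-strongly convex on `X`. -/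
lemma ProblemAssumption.proxFun_add_inner_le (h : ProblemAssumption X f ρ ε σ ρε D M)
    (i : Fin (m + 1)) (xt : Vec d) {x y : Vec d} (hx : x ∈ X) (hy : y ∈ X) {v : Vec d}
    (hv : v ∈ subdifferential (f i) x) :
    proxFun f ρhat xt i x + inner ℝ (v + ρhat • (x - xt)) (y - x)
      + (ρhat - ρ) / 2 * ‖y - x‖ ^ 2 ≤ proxFun f ρhat xt i y := by
  have h1 := h.toReal_add_inner_le i hx hy hv
  have h2 := proxFun_identity (ρhat := ρhat) x y xt
  rw [proxFun, proxFun, inner_add_left]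
  linarith

lemma constraintMax_le_iff (hm : 1 ≤ m) {x : Vec d} {c : ℝ} :
    constraintMax f x ≤ c ↔ ∀ i : Fin m, (f i.succ x).toReal ≤ c := by
  have : Nonempty (Fin m) := ⟨⟨0, hm⟩⟩
  exact ciSup_le_iff (Set.finite_range _).bddAbove

lemma proxConstraint_le_iff (hm : 1 ≤ m) {xt x : Vec d} {c : ℝ} :
    proxConstraint f ρhat xt x ≤ c ↔ ∀ i : Fin m, proxFun f ρhat xt i.succ x ≤ c := by
  rw [proxConstraint, ← le_sub_iff_add_le, constraintMax_le_iff hm]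
  simp only [proxFun, le_sub_iff_add_le]

lemma ProblemAssumption.continuousOn_toReal (h : ProblemAssumption X f ρ ε σ ρε D M)
    (hρ : 0 ≤ ρ) (hM : 0 ≤ M) (hD : 0 ≤ D) (i : Fin (m + 1)) :
    ContinuousOn (fun x => (f i x).toReal) X := by
  have key : ∀ x ∈ X, ∀ y ∈ X, (f i x).toReal - (f i y).toReal ≤ (M + ρ / 2 * D) * ‖x - y‖ := by
    intro x hx y hy
    obtain ⟨v, hv⟩ := h.subdifferential_nonempty i x hx
    have h1 := h.toReal_add_inner_le i hx hy hv
    have h2 := (abs_le.mp (abs_real_inner_le_norm v (y - x))).1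
    have h3 := mul_le_mul_of_nonneg_right (h.subgradient_bound i x hx v hv)
      (norm_nonneg (y - x))
    have h4 : ρ / 2 * ‖y - x‖ ^ 2 ≤ ρ / 2 * (D * ‖y - x‖) := by
      rw [sq]
      gcongr
      exact h.diam y hy x hx
    rw [norm_sub_rev x y]
    linarith
  have hC : 0 ≤ M + ρ / 2 * D := by positivity
  refine (LipschitzOnWith.of_dist_le_mul (K := ⟨M + ρ / 2 * D, hC⟩) fun x hx y hy => ?_).continuousOn
  rw [Real.dist_eq, dist_eq_norm, abs_le]
  have h1 := key x hx y hy
  have h2 := key y hy x hx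
  rw [norm_sub_rev y x] at h2
  change -((M + ρ / 2 * D) * ‖x - y‖) ≤ _ ∧ _ ≤ (M + ρ / 2 * D) * ‖x - y‖
  constructor <;> linarith

lemma ProblemAssumption.continuousOn_proxFun (h : ProblemAssumption X f ρ ε σ ρε D M)
    (hρ : 0 ≤ ρ) (hM : 0 ≤ M) (hD : 0 ≤ D) (xt : Vec d) (i : Fin (m + 1)) :
    ContinuousOn (proxFun f ρhat xt i) X :=
  (h.continuousOn_toReal hρ hM hD i).add (by fun_prop)

lemma ProblemAssumption.measurable_toReal (h : ProblemAssumption X f ρ ε σ ρε D M)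
    (i : Fin (m + 1)) : Measurable fun x => (f i x).toReal :=
  (h.closed i).measurable.ereal_toReal

/-- The uniform Slater condition, for the subproblem. -/
lemma ProblemAssumption.exists_slater (h : ProblemAssumption X f ρ ε σ ρε D M) (hm : 1 ≤ m)
    (hρhat : ρhat ≤ ρ + ρε) {xt : Vec d} (hxt : xt ∈ X) (hg : constraintMax f xt ≤ ε ^ 2) :
    ∃ y ∈ X, proxConstraint f ρhat xt y < -σ ∧
      ∀ i : Fin m, proxFun f ρhat xt i.succ y ≤ -σ := by
  obtain ⟨y, hy, hlt⟩ := h.slater xt hxt hg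
  have h1 : proxConstraint f ρhat xt y < -σ := by
    refine lt_of_le_of_lt ?_ hlt
    rw [proxConstraint]
    gcongr
  exact ⟨y, hy, h1, (proxConstraint_le_iff hm).mp h1.le⟩

lemma ProblemAssumption.exists_isProxSolution (h : ProblemAssumption X f ρ ε σ ρε D M)
    (hm : 1 ≤ m) (hρ : 0 ≤ ρ) (hM : 0 ≤ M) (hD : 0 ≤ D) (hσ : 0 < σ) (hρhat : ρhat ≤ ρ + ρε)
    {xt : Vec d} (hxt : xt ∈ X) (hg : constraintMax f xt ≤ ε ^ 2) :
    ∃ xh, IsProxSolution X f ρhat xt xh := by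
  obtain ⟨y, hy, hlt, -⟩ := h.exists_slater (ρhat := ρhat) hm hρhat hxt hg
  set N : Set (Vec d) := X ∩ ⋂ i : Fin m, {x | x ∈ X ∧ proxFun f ρhat xt i.succ x ≤ 0} with hN
  have hNc : IsCompact N := by
    refine h.compact.inter_right (isClosed_iInter fun i => ?_)
    exact (h.continuousOn_proxFun hρ hM hD xt i.succ).preimage_isClosed_of_isClosed
      h.compact.isClosed isClosed_Iic
  have hmem : ∀ x, x ∈ N ↔ x ∈ X ∧ proxConstraint f ρhat xt x ≤ 0 := by
    intro x
    rw [proxConstraint_le_iff hm, hN]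
    simp only [Set.mem_inter_iff, Set.mem_iInter, Set.mem_ofPred_eq]
    exact ⟨fun hx => ⟨hx.1, fun i => (hx.2 i).2⟩, fun hx => ⟨hx.1, fun i => ⟨hx.1, hx.2 i⟩⟩⟩
  obtain ⟨xh, hxh, hmin⟩ := hNc.exists_isMinOn ⟨y, (hmem y).mpr ⟨hy, by linarith⟩⟩
    ((h.continuousOn_proxFun (ρhat := ρhat) hρ hM hD xt 0).mono Set.inter_subset_left)
  exact ⟨xh, ((hmem xh).mp hxh).1, ((hmem xh).mp hxh).2, fun w hw hGw =>
    hmin ((hmem w).mpr ⟨hw, hGw⟩)⟩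

variable {Ξ : Type*}

/-- The estimator of the subproblem at `xt`. -/
noncomputable def proxEstimator (S : Estimator m d Ξ) (ρhat : ℝ) (xt : Vec d) :
    Estimator m d Ξ where
  θ i x s := S.θ i x s + ρhat / 2 * ‖x - xt‖ ^ 2
  ζ i x s := S.ζ i x s + ρhat • (x - xt)

lemma yuState_eq_pdIter (S : Estimator m d Ξ) (K : ℕ) (xt : Vec d) (s : ℕ → Ξ) (k : ℕ) :
    ((yuState X S ρhat K xt s k).z, (yuState X S ρhat K xt s k).Q)
      = pdIter X (proxEstimator S ρhat xt) K xt s k := by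
  induction k with
  | zero => rfl
  | succ k ih =>
    rw [pdIter, ← ih]
    rfl

lemma yuState_z (S : Estimator m d Ξ) (K : ℕ) (xt : Vec d) (s : ℕ → Ξ) (k : ℕ) :
    (yuState X S ρhat K xt s k).z = (pdIter X (proxEstimator S ρhat xt) K xt s k).1 := by
  rw [← yuState_eq_pdIter]

lemma yuState_queries (S : Estimator m d Ξ) (K : ℕ) (xt : Vec d) (s : ℕ → Ξ) (k : ℕ) :
    (yuState X S ρhat K xt s k).queries = k := by
  induction k with
  | zero => rfl
  | succ k ih =>
    change (yuState X S ρhat K xt s k).queries + 1 = k + 1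
    rw [ih]

lemma yuOutput_mem (hc : Convex ℝ X) (hX : IsCompact X) (S : Estimator m d Ξ) {K : ℕ}
    (hK : 1 ≤ K) {xt : Vec d} (hxt : xt ∈ X) (s : ℕ → Ξ) : yuOutput X S ρhat K xt s ∈ X := by
  have hKpos : (0 : ℝ) < K := by exact_mod_cast hK
  rw [yuOutput, Finset.smul_sum]
  refine hc.sum_mem (fun _ _ => by positivity) ?_ fun k _ => ?_
  · rw [Finset.sum_const, Finset.card_range, nsmul_eq_mul, mul_inv_cancel₀ hKpos.ne']
  · rw [yuState_z]
    exact pdIter_fst_mem hX hxt s k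

variable [MeasurableSpace Ξ] {P : Measure Ξ} {S : Estimator m d Ξ} {M0 M1 : ℝ}

/-- The subproblem is a convex program with stochastic estimates. -/
lemma ProblemAssumption.stochasticProgram [IsProbabilityMeasure P]
    (h : ProblemAssumption X f ρ ε σ ρε D M)
    (hS : EstimatorAssumption X f S P M0 M1) (hρ : 0 ≤ ρ) (hρhat : ρ < ρhat)
    {xt : Vec d} (hxt : xt ∈ X) :
    StochasticProgram X (proxFun f ρhat xt) (proxEstimator S ρhat xt) P D
      (tildeM0 m D ρhat M0) (tildeM1 D ρhat M1) where
  convex := h.convex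
  compact := h.compact
  diam := h.diam
  measurable_F i := (h.measurable_toReal i).add (by fun_prop)
  measurable_θ i := (hS.measurable_θ i).add (by fun_prop)
  measurable_ζ i := (hS.measurable_ζ i).add (by fun_prop)
  mean_θ i x hx := by
    obtain ⟨h1, h2⟩ := hS.unbiased_θ i x hx
    refine ⟨h1.add (integrable_const _), ?_⟩
    change ∫ s, (S.θ i x s + ρhat / 2 * ‖x - xt‖ ^ 2) ∂P = _
    rw [integral_add h1 (integrable_const _), h2, integral_const, probReal_univ, one_smul]
    rfl
  mean_ζ i x hx := by
    obtain ⟨h1, h2⟩ := hS.unbiased_ζ i x hx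
    refine ⟨h1.add (integrable_const _), fun y hy => ?_⟩
    change _ + inner ℝ (∫ s, (S.ζ i x s + ρhat • (x - xt)) ∂P) (y - x) ≤ _
    rw [integral_add h1 (integrable_const _), integral_const, probReal_univ, one_smul]
    have h3 := h.proxFun_add_inner_le (ρhat := ρhat) i xt hx hy h2
    have h4 : 0 ≤ (ρhat - ρ) / 2 * ‖y - x‖ ^ 2 := by
      have : 0 ≤ ρhat - ρ := by linarith
      positivity
    linarith
  good x hx := by
    have h0 : 0 ≤ ρhat := by linarith
    have hdx := h.diam x hx xt hxt
    filter_upwards [hS.bound_θ x hx, ae_all_iff.mpr fun i => hS.bound_ζ i x hx] with s hs1 hs2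
    refine ⟨?_, fun i => ?_⟩
    · refine (l2_add_le _ _).trans ?_
      rw [tildeM0, l2_const, abs_of_nonneg (by positivity)]
      have h1 : ‖x - xt‖ ^ 2 ≤ D ^ 2 := pow_le_pow_left₀ (norm_nonneg _) hdx 2
      have h2 : √(m : ℝ) * (ρhat / 2 * ‖x - xt‖ ^ 2) ≤ √(m : ℝ) * (ρhat / 2 * D ^ 2) := by gcongr
      have h3 : l2 (fun i : Fin m => S.θ i.succ x s) ≤ M0 := hs1
      linarith
    · refine (norm_add_le _ _).trans (add_le_add (hs2 i) ?_)
      rw [norm_smul, Real.norm_eq_abs, abs_of_nonneg h0]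
      gcongr

/-- The Slater point forces the bound on the constraint values, and hence `H`, to be positive. -/
lemma StochasticProgram.boundH_pos [IsProbabilityMeasure P] {F : Fin (m + 1) → Vec d → ℝ}
    {A B : ℝ} (h : StochasticProgram X F S P D A B) (hm : 1 ≤ m) (hσ : 0 < σ) (hD : 0 ≤ D)
    (hB : 0 ≤ B) {y : Vec d} (hy : y ∈ X) (hFy : ∀ i : Fin m, F i.succ y ≤ -σ) :
    0 < boundH D A B m := by
  have hA : σ ≤ A := by
    have i : Fin m := ⟨0, hm⟩
    obtain ⟨h1, h2⟩ := h.mean_θ i.succ y hy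
    have h3 : ∫ _, -A ∂P ≤ ∫ s, S.θ i.succ y s ∂P := by
      refine integral_mono_ae (integrable_const _) h1 ?_
      filter_upwards [h.good y hy] with s hs
      exact (abs_le.mp ((abs_le_l2 (fun i : Fin m => S.θ i.succ y s) i).trans hs.1)).1
    rw [integral_const, probReal_univ, one_smul, h2] at h3
    linarith [hFy i]
  have : 0 ≤ √(m : ℝ) * B * D := by positivity
  rw [boundH]
  linarith

variable {Ω : Type*} [MeasurableSpace Ω] {μ : Measure Ω}

/-- The natural filtration of an i.i.d. sequence of samples. -/
lemma IsIIDSample.exists_isSampleFiltration {ξ : ℕ → Ω → Ξ} (h : IsIIDSample ξ P μ) :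
    ∃ 𝓕 : ℕ → MeasurableSpace Ω, IsSampleFiltration 𝓕 ξ P μ := by
  refine ⟨fun k => ⨆ j ∈ {j | j < k}, MeasurableSpace.comap (ξ j) inferInstance, ?_, ?_, ?_, h.law,
    ?_⟩
  · exact fun k => iSup₂_le fun j _ => (h.measurable j).comap_le
  · exact fun a b hab => biSup_mono fun j (hj : j < a) => lt_of_lt_of_le hj hab
  · intro k
    refine Measurable.mono (comap_measurable (ξ k)) ?_ le_rfl
    exact le_iSup₂_of_le (f := fun j (_ : j ∈ {j | j < k + 1}) =>
      MeasurableSpace.comap (ξ j) inferInstance) k (Nat.lt_succ_self k) le_rfl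
  · intro k
    have h1 := indep_iSup_of_disjoint (m := fun j => MeasurableSpace.comap (ξ j) inferInstance)
      (fun j => (h.measurable j).comap_le) h.indep (S := {j | j < k}) (T := {k})
      (by simp)
    simpa using h1

/-- With probability at least `1 - δ`, the method for the subproblem obeys both bounds. -/
theorem ProblemAssumption.measure_not_bounds_le [IsProbabilityMeasure P] [IsProbabilityMeasure μ]
    (h : ProblemAssumption X f ρ ε σ ρε D M) (hS : EstimatorAssumption X f S P M0 M1)
    (hm : 1 ≤ m) (hD : 0 ≤ D) (hM : 0 ≤ M) (hM0 : 0 ≤ M0) (hM1 : 0 ≤ M1) (hρ : 0 ≤ ρ)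
    (hσ : 0 < σ) (hρhat : ρ < ρhat) (hρhat' : ρhat ≤ ρ + ρε) {ξ : ℕ → Ω → Ξ}
    (hξ : IsIIDSample ξ P μ) {xt : Vec d} (hxt : xt ∈ X) (hg : constraintMax f xt ≤ ε ^ 2) {K : ℕ}
    {δ : ℝ} (hK : 1 ≤ K) (hδ : 0 < δ) (hδ1 : δ < 1) :
    μ {ω | ¬ ∃ xh, IsProxSolution X f ρhat xt xh ∧
        proxFun f ρhat xt 0 (yuOutput X S ρhat K xt fun k => ξ k ω) - proxFun f ρhat xt 0 xh
          ≤ boundB1 D (tildeM0 m D ρhat M0) (tildeM1 D ρhat M1) m σ K δ ∧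
        ∀ i : Fin m, proxFun f ρhat xt i.succ (yuOutput X S ρhat K xt fun k => ξ k ω)
          ≤ boundB2 D (tildeM0 m D ρhat M0) (tildeM1 D ρhat M1) m σ K δ}
      ≤ ENNReal.ofReal δ := by
  have hρ0 : 0 ≤ ρhat := by linarith
  obtain ⟨xh, hxh⟩ := h.exists_isProxSolution hm hρ hM hD hσ hρhat' hxt hg
  obtain ⟨y, hy, -, hFy⟩ := h.exists_slater (ρhat := ρhat) hm hρhat' hxt hg
  obtain ⟨𝓕, h𝓕⟩ := hξ.exists_isSampleFiltration
  have hprog := h.stochasticProgram hS hρ hρhat hxt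
  have hA : 0 ≤ tildeM0 m D ρhat M0 := by unfold tildeM0; positivity
  have hB : 0 ≤ tildeM1 D ρhat M1 := by unfold tildeM1; positivity
  have hH := hprog.boundH_pos hm hσ hD hB hy hFy
  refine (measure_mono fun ω hω => ?_).trans (hprog.measure_not_bounds_le h𝓕 hK hm hσ hD hA hB hH
    hxt hy hFy hxh.1 ((proxConstraint_le_iff hm).mp hxh.2.1) hδ hδ1)
  intro hb
  refine hω ⟨xh, hxh, ?_⟩
  simpa only [yuOutput, yuState_z] using hb

end Subproblem

/-! ### Order of the bounds and the iteration budget -/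

section Budget

variable {m : ℕ} {D A B σ : ℝ}

lemma log_const_mul_div {a δ : ℝ} (ha : 0 < a) (hδ : 0 < δ) :
    Real.log (a / δ) = Real.log a + Real.log δ⁻¹ := by
  rw [div_eq_mul_inv, Real.log_mul ha.ne' (inv_pos.mpr hδ).ne']

lemma log_eight_le : Real.log 8 ≤ 3 := by
  rw [show (8 : ℝ) = 2 ^ 3 by norm_num, Real.log_pow]
  have := Real.log_two_lt_d9
  push_cast
  linarith

lemma boundLambda_le (hσ : 0 < σ) (hD : 0 ≤ D) (hA : 0 ≤ A) (hB : 0 ≤ B) :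
    ∃ c : ℝ, 0 ≤ c ∧ ∀ (K : ℕ) (δ : ℝ), 1 ≤ K → 0 < δ → δ < 1 →
      boundLambda D A B m σ K δ ≤ c * (1 + Real.log K + Real.log δ⁻¹) := by
  have hH : 0 ≤ boundH D A B m := by unfold boundH; positivity
  set H := boundH D A B m with hHdef
  set b := 8 * H ^ 2 / σ with hb
  set l := Real.log (1 + 32 * H ^ 2 / σ ^ 2 * Real.exp (σ / (8 * H)))
  have hl : 0 ≤ l := Real.log_nonneg (by
    have : 0 ≤ 32 * H ^ 2 / σ ^ 2 * Real.exp (σ / (8 * H)) := by positivity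
    linarith)
  set a := σ / 2 + H + 2 * D ^ 2 / σ + (2 * B * D + H ^ 2) / σ + b * l with ha
  have hb0 : 0 ≤ b := by positivity
  have ha0 : 0 ≤ a := by positivity
  refine ⟨a + b, by positivity, fun K δ hK hδ hδ1 => ?_⟩
  have hK1 : (1 : ℝ) ≤ K := by exact_mod_cast hK
  have hlogK : 0 ≤ Real.log K := Real.log_nonneg hK1
  have hL : 0 ≤ Real.log δ⁻¹ := Real.log_nonneg (one_le_inv_iff₀.mpr ⟨hδ, hδ1.le⟩)
  have e1 : boundLambda D A B m σ K δ = a + b * Real.log (2 * K / δ) := rfl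
  have e2 : Real.log (2 * K / δ) ≤ 1 + Real.log K + Real.log δ⁻¹ := by
    rw [log_const_mul_div (by positivity) hδ, Real.log_mul (by norm_num) (by positivity)]
    have := Real.log_two_lt_d9
    linarith
  rw [e1, add_mul]
  refine add_le_add ?_ (mul_le_mul_of_nonneg_left e2 hb0)
  exact le_mul_of_one_le_right ha0 (by linarith)

/-- Both bounds are of order `√(1 + log (1/δ)) (1 + log K + log (1/δ)) / √K`, uniformly in `K`
and `δ`. -/
lemma bounds_le (hm : 1 ≤ m) (hσ : 0 < σ) (hD : 0 ≤ D) (hA : 0 ≤ A) (hB : 0 ≤ B) :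
    ∃ c : ℝ, 1 ≤ c ∧ ∀ (K : ℕ) (δ : ℝ), 1 ≤ K → 0 < δ → δ < 1 →
      (0 ≤ boundB1 D A B m σ K δ ∧ boundB1 D A B m σ K δ
        ≤ c * (√(1 + Real.log δ⁻¹) * (1 + Real.log K + Real.log δ⁻¹)) / √(K : ℝ)) ∧
      (0 ≤ boundB2 D A B m σ K δ ∧ boundB2 D A B m σ K δ
        ≤ c * (√(1 + Real.log δ⁻¹) * (1 + Real.log K + Real.log δ⁻¹)) / √(K : ℝ)) := by
  obtain ⟨c0, hc0, hΛle⟩ := boundLambda_le (m := m) hσ hD hA hB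
  have hH : 0 ≤ boundH D A B m := by unfold boundH; positivity
  have hm1 : (1 : ℝ) ≤ m := by exact_mod_cast hm
  have hlogm : 0 ≤ Real.log m := Real.log_nonneg hm1
  set H := boundH D A B m with hHdef
  set c1 := D ^ 2 + B ^ 2 / 4 + H ^ 2 / 2 + 6 * (H * c0 + B * D) with hc1
  set c2 := c0 + B ^ 2 + c0 * √(m : ℝ) * B ^ 2 / 2 + 2 * A * √(2 * (3 + Real.log m)) with hc2
  have hc10 : 0 ≤ c1 := by positivity
  have hc20 : 0 ≤ c2 := by positivity
  refine ⟨1 + c1 + c2, by linarith, fun K δ hK hδ hδ1 => ?_⟩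
  have hK1 : (1 : ℝ) ≤ K := by exact_mod_cast hK
  have hlogK : 0 ≤ Real.log K := Real.log_nonneg hK1
  have hL : 0 ≤ Real.log δ⁻¹ := Real.log_nonneg (one_le_inv_iff₀.mpr ⟨hδ, hδ1.le⟩)
  have hΛ0 : 0 ≤ boundLambda D A B m σ K δ := boundLambda_nonneg hσ hH hD hB hK hδ hδ1
  have hΛ := hΛle K δ hK hδ hδ1
  set Λ := boundLambda D A B m σ K δ
  set L := Real.log δ⁻¹
  set T := 1 + Real.log K + L with hT
  set R := √(1 + L) with hR
  have hT1 : 1 ≤ T := by linarith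
  have hR1 : 1 ≤ R := Real.one_le_sqrt.mpr (by linarith)
  have hRT : 1 ≤ R * T := by nlinarith
  have hTR : T ≤ R * T := le_mul_of_one_le_left (by linarith) hR1
  have hRR : R ≤ R * T := le_mul_of_one_le_right (by linarith) hT1
  have r1 : √(2 * Real.log (8 / δ)) ≤ 3 * R := by
    refine Real.sqrt_le_iff.mpr ⟨by positivity, ?_⟩
    rw [log_const_mul_div (by norm_num) hδ, mul_pow, hR, Real.sq_sqrt (by linarith)]
    have := log_eight_le
    linarith
  have r2 : √(2 * Real.log (8 * m / δ)) ≤ √(2 * (3 + Real.log m)) * R := by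
    rw [hR, ← Real.sqrt_mul (by linarith)]
    refine Real.sqrt_le_sqrt ?_
    rw [log_const_mul_div (by positivity) hδ, Real.log_mul (by norm_num) (by positivity)]
    have := log_eight_le
    nlinarith [mul_nonneg hlogm hL]
  have hs : 0 ≤ √(K : ℝ) := Real.sqrt_nonneg _
  have hq1 : 0 ≤ c1 * (R * T) := by positivity
  have hq2 : 0 ≤ c2 * (R * T) := by positivity
  refine ⟨⟨by unfold boundB1; positivity, ?_⟩, ⟨by unfold boundB2; positivity, ?_⟩⟩
  · rw [boundB1]
    refine div_le_div_of_nonneg_right ?_ hs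
    have i1 : D ^ 2 + B ^ 2 / 4 + H ^ 2 / 2 ≤ (D ^ 2 + B ^ 2 / 4 + H ^ 2 / 2) * (R * T) :=
      le_mul_of_one_le_right (by positivity) hRT
    have i2 : H * Λ + B * D ≤ (H * c0 + B * D) * T := by
      rw [add_mul]
      refine add_le_add ?_ (le_mul_of_one_le_right (by positivity) hT1)
      rw [mul_assoc]
      gcongr
    have i3 : 2 * √(2 * Real.log (8 / δ)) * (H * Λ + B * D)
        ≤ 2 * (3 * R) * ((H * c0 + B * D) * T) := by gcongr
    rw [hc1] at *
    linarith
  · rw [boundB2]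
    refine div_le_div_of_nonneg_right ?_ hs
    have i0 : Λ ≤ c0 * (R * T) := hΛ.trans (mul_le_mul_of_nonneg_left hTR hc0)
    have i1 : B ^ 2 ≤ B ^ 2 * (R * T) := le_mul_of_one_le_right (by positivity) hRT
    have i2 : Λ * √(m : ℝ) * B ^ 2 / 2 ≤ c0 * (R * T) * √(m : ℝ) * B ^ 2 / 2 := by gcongr
    have i3 : 2 * A * √(2 * Real.log (8 * m / δ))
        ≤ 2 * A * (√(2 * (3 + Real.log m)) * (R * T)) := by
      gcongr
      exact r2.trans (mul_le_mul_of_nonneg_left hRR (Real.sqrt_nonneg _))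
    rw [hc2] at *
    linarith

/-- For fixed `δ`, anything of the uniform order of `bounds_le` is `O(log (K/δ) / √K)`. -/
lemma isBigO_of_le {b : ℕ → ℝ} {c δ : ℝ} (hδ : 0 < δ) (hδ1 : δ < 1)
    (h : ∀ K : ℕ, 1 ≤ K → 0 ≤ b K ∧ b K
      ≤ c * (√(1 + Real.log δ⁻¹) * (1 + Real.log K + Real.log δ⁻¹)) / √(K : ℝ)) (hc : 0 ≤ c) :
    b =O[atTop] fun K : ℕ => Real.log (K / δ) / √(K : ℝ) := by
  refine IsBigO.of_bound (c * √(1 + Real.log δ⁻¹) * 2) ?_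
  filter_upwards [eventually_ge_atTop 3] with K hK
  have hK3 : (3 : ℝ) ≤ K := by exact_mod_cast hK
  obtain ⟨h0, h1⟩ := h K (by omega)
  have hL : 0 ≤ Real.log δ⁻¹ := Real.log_nonneg (one_le_inv_iff₀.mpr ⟨hδ, hδ1.le⟩)
  have hlogK : 1 ≤ Real.log K := by
    rw [Real.le_log_iff_exp_le (by linarith)]
    have := Real.exp_one_lt_d9
    linarith
  have e1 : Real.log (K / δ) = Real.log K + Real.log δ⁻¹ := log_const_mul_div (by linarith) hδ
  rw [Real.norm_of_nonneg h0, Real.norm_of_nonneg (div_nonneg (by linarith) (Real.sqrt_nonneg _)),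
    e1, mul_div_assoc']
  refine h1.trans (div_le_div_of_nonneg_right ?_ (Real.sqrt_nonneg _))
  have : 1 + Real.log K + Real.log δ⁻¹ ≤ 2 * (Real.log K + Real.log δ⁻¹) := by linarith
  calc c * (√(1 + Real.log δ⁻¹) * (1 + Real.log K + Real.log δ⁻¹))
      ≤ c * (√(1 + Real.log δ⁻¹) * (2 * (Real.log K + Real.log δ⁻¹))) := by gcongr
    _ = _ := by ring

lemma one_le_iterBudget {C εhat δ : ℝ} (hC : 1 ≤ C) (hδ : 0 < δ) (hδ1 : δ < 1) :
    1 ≤ iterBudget C εhat δ := by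
  have hL : 0 ≤ Real.log δ⁻¹ := Real.log_nonneg (one_le_inv_iff₀.mpr ⟨hδ, hδ1.le⟩)
  have he : 1 ≤ max 1 εhat⁻¹ := le_max_left _ _
  have hle : 0 ≤ Real.log (max 1 εhat⁻¹) := Real.log_nonneg he
  rw [iterBudget]
  have h1 : 1 ≤ (max 1 εhat⁻¹) ^ 4 := one_le_pow₀ he
  have h2 : 1 ≤ (1 + Real.log (max 1 εhat⁻¹) + Real.log δ⁻¹) ^ 2 := one_le_pow₀ (by linarith)
  exact one_le_mul_of_one_le_of_one_le (one_le_mul_of_one_le_of_one_le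
    (one_le_mul_of_one_le_of_one_le hC h1) (by linarith)) h2

/-- A quantity of the order of `bounds_le` is at most `ε̂²` once `K` meets the budget: with
`s = K / (e⁴ (1 + L) u²)`, `u = 1 + log e + L`, one has `1 + log K + L ≤ 10 s^{1/4} u`. -/
lemma le_sq_of_iterBudget_le {c εhat δ : ℝ} {K : ℕ} (hc : 1 ≤ c) (hε : 0 < εhat) (hδ : 0 < δ)
    (hδ1 : δ < 1) (hK : iterBudget ((10 * c) ^ 4) εhat δ ≤ K) :
    c * (√(1 + Real.log δ⁻¹) * (1 + Real.log K + Real.log δ⁻¹)) / √(K : ℝ) ≤ εhat ^ 2 := by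
  have hC : 1 ≤ (10 * c) ^ 4 := one_le_pow₀ (by linarith)
  have hK1 : (1 : ℝ) ≤ K := (one_le_iterBudget hC hδ hδ1).trans hK
  have hL : 0 ≤ Real.log δ⁻¹ := Real.log_nonneg (one_le_inv_iff₀.mpr ⟨hδ, hδ1.le⟩)
  rw [iterBudget] at hK
  set L := Real.log δ⁻¹
  set e := max 1 εhat⁻¹ with he
  have he1 : 1 ≤ e := le_max_left _ _
  have hle : 0 ≤ Real.log e := Real.log_nonneg he1
  set u := 1 + Real.log e + L with hu
  have hu1 : 1 ≤ u := by linarith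
  set y := e ^ 4 * (1 + L) * u ^ 2 with hy
  have hypos : 0 < y := by positivity
  set s := K / y with hs
  have hsC : (10 * c) ^ 4 ≤ s := by
    rw [hs, le_div_iff₀ hypos, hy]
    linarith
  have hs1 : 1 ≤ s := hC.trans hsC
  have hKs : (K : ℝ) = s * y := by rw [hs]; field_simp
  set w := √(√s) with hw
  have hw2 : w ^ 2 = √s := Real.sq_sqrt (Real.sqrt_nonneg _)
  have hw4 : w ^ 4 = s := by
    rw [show w ^ 4 = (w ^ 2) ^ 2 by ring, hw2, Real.sq_sqrt (by linarith)]
  have hw0 : 0 ≤ w := Real.sqrt_nonneg _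
  have hwc : 10 * c ≤ w := by
    refine le_of_pow_le_pow_left₀ (n := 4) (by norm_num) hw0 ?_
    rw [hw4]; exact hsC
  have hw1 : 1 ≤ w := by linarith
  have hlogs : Real.log s ≤ 4 * w := by
    rw [← hw4, Real.log_pow]
    have := Real.log_le_self hw0
    push_cast
    linarith
  have hlogy : Real.log y ≤ 4 * Real.log e + L + 2 * (u - 1) := by
    rw [hy, Real.log_mul (by positivity) (by positivity), Real.log_mul (by positivity)
      (by positivity), Real.log_pow, Real.log_pow]
    have h1 := Real.log_le_sub_one_of_pos (show 0 < 1 + L by linarith)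
    have h2 := Real.log_le_sub_one_of_pos (show 0 < u by linarith)
    push_cast
    linarith
  have hT : 1 + Real.log K + L ≤ 10 * w * u := by
    rw [hKs, Real.log_mul (by positivity) hypos.ne']
    have h1 : 1 + Real.log s + Real.log y + L ≤ 6 * u + 4 * w := by linarith
    nlinarith
  have hTw : c * (1 + Real.log K + L) ≤ w ^ 2 * u := by
    calc c * (1 + Real.log K + L) ≤ c * (10 * w * u) := by gcongr
      _ = (10 * c) * (w * u) := by ring
      _ ≤ w * (w * u) := by gcongr
      _ = w ^ 2 * u := by ring
  have hsqrtK : √(K : ℝ) = w ^ 2 * u * √(1 + L) * e ^ 2 := by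
    have h1 : (K : ℝ) = (w ^ 2 * u * √(1 + L) * e ^ 2) ^ 2 := by
      have h2 : √(1 + L) ^ 2 = 1 + L := Real.sq_sqrt (by linarith)
      calc (K : ℝ) = w ^ 4 * (e ^ 4 * (1 + L) * u ^ 2) := by rw [hw4, hKs]
        _ = _ := by linear_combination (-(w ^ 4 * e ^ 4 * u ^ 2)) * h2
    rw [h1, Real.sqrt_sq (by positivity)]
  have hee : e⁻¹ ≤ εhat := by
    rw [inv_le_comm₀ (by linarith) hε]
    exact le_max_right _ _
  have hR : 0 < √(1 + L) := Real.sqrt_pos.mpr (by linarith)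
  rw [hsqrtK]
  calc c * (√(1 + L) * (1 + Real.log K + L)) / (w ^ 2 * u * √(1 + L) * e ^ 2)
      = c * (1 + Real.log K + L) / (w ^ 2 * u) * (e⁻¹) ^ 2 := by field_simp
    _ ≤ 1 * εhat ^ 2 := by
        gcongr
        exact (div_le_one (by positivity)).mpr hTw
    _ = εhat ^ 2 := one_mul _

end Budget

/-! ### Lagrange multipliers of the subproblem -/

section Duality

variable {d : ℕ} {X : Set (Vec d)}

/-- Lagrange duality for one convex constraint under the Slater condition. The multiplier is the
least upper bound of the slopes `(Φ x̂ - Φ x) / G x` over the infeasible points. -/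
lemma exists_multiplier {Φ G : Vec d → ℝ} (hΦ : ConvexOn ℝ X Φ) (hG : ConvexOn ℝ X G)
    {xh y : Vec d} (hmin : ∀ x ∈ X, G x ≤ 0 → Φ xh ≤ Φ x) (hy : y ∈ X) (hGy : G y < 0) :
    ∃ l : ℝ, 0 ≤ l ∧ ∀ x ∈ X, Φ xh ≤ Φ x + l * G x := by
  set T : Set ℝ := {r | r = 0 ∨ ∃ x ∈ X, 0 < G x ∧ r = (Φ xh - Φ x) / G x} with hT
  have hub : ∀ x ∈ X, G x < 0 → ∀ r ∈ T, r ≤ (Φ x - Φ xh) / (-G x) := by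
    rintro x2 hx2 hG2 r (rfl | ⟨x1, hx1, hG1, rfl⟩)
    · exact div_nonneg (by linarith [hmin x2 hx2 hG2.le]) (by linarith)
    · have hs : 0 < G x1 + -G x2 := by linarith
      have ha : 0 ≤ -G x2 / (G x1 + -G x2) := div_nonneg (by linarith) hs.le
      have hb : 0 ≤ G x1 / (G x1 + -G x2) := div_nonneg hG1.le hs.le
      have hab : -G x2 / (G x1 + -G x2) + G x1 / (G x1 + -G x2) = 1 := by
        rw [← add_div, add_comm (-G x2), div_self hs.ne']
      have h1 := hG.2 hx1 hx2 ha hb hab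
      have h2 := hΦ.2 hx1 hx2 ha hb hab
      have h3 := hmin _ (hΦ.1 hx1 hx2 ha hb hab) (h1.trans (le_of_eq (by
        simp only [smul_eq_mul]; field_simp; ring)))
      have h4 := h3.trans h2
      simp only [smul_eq_mul] at h4
      rw [div_mul_eq_mul_div, div_mul_eq_mul_div, ← add_div, le_div_iff₀ hs] at h4
      rw [div_le_div_iff₀ hG1 (by linarith)]
      linarith
  have hbdd : BddAbove T := ⟨_, hub y hy hGy⟩
  refine ⟨sSup T, le_csSup hbdd (Or.inl rfl), fun x hx => ?_⟩
  rcases lt_trichotomy (G x) 0 with h | h | h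
  · have h1 : sSup T ≤ (Φ x - Φ xh) / (-G x) := csSup_le ⟨0, Or.inl rfl⟩ (hub x hx h)
    rw [le_div_iff₀ (by linarith)] at h1
    linarith
  · rw [h, mul_zero, add_zero]
    exact hmin x hx h.le
  · have h1 : (Φ xh - Φ x) / G x ≤ sSup T := le_csSup hbdd (Or.inr ⟨x, hx, h, rfl⟩)
    rw [div_le_iff₀ h] at h1
    linarith

/-- Quadratic growth of a strongly convex Lagrangian at its minimizer. -/
lemma lagrangian_growth {Φ G : Vec d → ℝ} {κ l : ℝ} (hΦ : StrongConvexOn X κ Φ)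
    (hG : StrongConvexOn X κ G) (hl : 0 ≤ l) {xh : Vec d} (hxh : xh ∈ X)
    (hmin : ∀ x ∈ X, Φ xh + l * G xh ≤ Φ x + l * G x) {x : Vec d} (hx : x ∈ X) :
    Φ xh + l * G xh + (1 + l) * (κ / 2 * ‖x - xh‖ ^ 2) ≤ Φ x + l * G x := by
  suffices h : 0 ≤ Φ x + l * G x - (Φ xh + l * G xh) - (1 + l) * (κ / 2 * ‖x - xh‖ ^ 2) by
    linarith
  refine nonneg_of_forall_add_mul_nonneg (b := (1 + l) * (κ / 2 * ‖x - xh‖ ^ 2))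
    fun t ht ht1 => ?_
  have ha : 0 ≤ 1 - t := by linarith
  have hab : t + (1 - t) = 1 := by ring
  have h1 := hΦ.2 hx hxh ht.le ha hab
  have h2 := mul_le_mul_of_nonneg_left (hG.2 hx hxh ht.le ha hab) hl
  have h3 := hmin _ (hΦ.1 hx hxh ht.le ha hab)
  simp only [smul_eq_mul] at h1 h2
  refine nonneg_of_mul_nonneg_right ?_ ht
  linarith

lemma strongConvexOn_of_subgradient {κ : ℝ} {Φ : Vec d → ℝ} (hX : Convex ℝ X)
    (h : ∀ x ∈ X, ∃ v : Vec d, ∀ y ∈ X, Φ x + inner ℝ v (y - x) + κ / 2 * ‖y - x‖ ^ 2 ≤ Φ y) :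
    StrongConvexOn X κ Φ := by
  refine ⟨hX, fun x hx y hy a b ha hb hab => ?_⟩
  obtain ⟨v, hv⟩ := h _ (hX hx hy ha hb hab)
  have hbe : b = 1 - a := by linarith
  have e1 : x - (a • x + b • y) = b • (x - y) := by
    rw [hbe]; module
  have e2 : y - (a • x + b • y) = -(a • (x - y)) := by
    rw [hbe]; module
  have h1 := mul_le_mul_of_nonneg_left (hv x hx) ha
  have h2 := mul_le_mul_of_nonneg_left (hv y hy) hb
  rw [e1, inner_smul_right, norm_smul, mul_pow, Real.norm_eq_abs, sq_abs] at h1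
  rw [e2, inner_neg_right, inner_smul_right, norm_neg, norm_smul, mul_pow, Real.norm_eq_abs,
    sq_abs] at h2
  simp only [smul_eq_mul]
  set p := Φ (a • x + b • y)
  have e3 : a * p + b * p = p := by rw [← add_mul, hab, one_mul]
  have e4 : a * (κ / 2 * (b ^ 2 * ‖x - y‖ ^ 2)) + b * (κ / 2 * (a ^ 2 * ‖x - y‖ ^ 2))
      = a * b * (κ / 2 * ‖x - y‖ ^ 2) := by rw [hbe]; ring
  linarith

end Duality

section ProxMultiplier

variable {m d : ℕ} {X : Set (Vec d)} {f : Fin (m + 1) → Vec d → EReal}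
  {ρ ε σ ρε D M ρhat : ℝ}

lemma ProblemAssumption.strongConvexOn_proxFun (h : ProblemAssumption X f ρ ε σ ρε D M)
    (xt : Vec d) (i : Fin (m + 1)) : StrongConvexOn X (ρhat - ρ) (proxFun f ρhat xt i) :=
  strongConvexOn_of_subgradient h.convex fun x hx => by
    obtain ⟨v, hv⟩ := h.subdifferential_nonempty i x hx
    exact ⟨_, fun y hy => h.proxFun_add_inner_le i xt hx hy hv⟩

lemma ProblemAssumption.strongConvexOn_proxConstraint (h : ProblemAssumption X f ρ ε σ ρε D M)
    (hm : 1 ≤ m) (xt : Vec d) : StrongConvexOn X (ρhat - ρ) (proxConstraint f ρhat xt) := by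
  refine ⟨h.convex, fun x hx y hy a b ha hb hab => (proxConstraint_le_iff hm).mpr fun i => ?_⟩
  refine ((h.strongConvexOn_proxFun xt i.succ).2 hx hy ha hb hab).trans ?_
  have h1 := (proxConstraint_le_iff hm).mp (le_refl (proxConstraint f ρhat xt x)) i
  have h2 := (proxConstraint_le_iff hm).mp (le_refl (proxConstraint f ρhat xt y)) i
  simp only [smul_eq_mul]
  gcongr

/-- The multiplier of the subproblem is bounded uniformly in `xt`, and the Lagrangian grows
quadratically at the solution. -/
lemma ProblemAssumption.exists_multiplier (h : ProblemAssumption X f ρ ε σ ρε D M)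
    (hm : 1 ≤ m) (hρ : 0 ≤ ρ) (hσ : 0 < σ) (hρhat : ρ < ρhat) (hρhat' : ρhat ≤ ρ + ρε)
    {xt xh : Vec d} (hxt : xt ∈ X) (hg : constraintMax f xt ≤ ε ^ 2)
    (hxh : IsProxSolution X f ρhat xt xh) :
    ∃ l : ℝ, 0 ≤ l ∧ l ≤ (M + ρhat * D) / √(2 * σ * (ρhat - ρ)) ∧ ∀ x ∈ X,
      proxFun f ρhat xt 0 xh + (ρhat - ρ) / 2 * ‖x - xh‖ ^ 2
        ≤ proxFun f ρhat xt 0 x + l * proxConstraint f ρhat xt x := by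
  obtain ⟨y, hy, hGy, -⟩ := h.exists_slater (ρhat := ρhat) hm hρhat' hxt hg
  obtain ⟨hxX, hGx, hopt⟩ := hxh
  have hκ : 0 < ρhat - ρ := by linarith
  have hΦ := h.strongConvexOn_proxFun (ρhat := ρhat) xt 0
  have hG := h.strongConvexOn_proxConstraint (ρhat := ρhat) hm xt
  obtain ⟨l, hl, hlag⟩ := IPC.exists_multiplier (hΦ.convexOn fun r => by positivity)
    (hG.convexOn fun r => by positivity) hopt hy (by linarith)
  have hcs : l * proxConstraint f ρhat xt xh = 0 :=
    le_antisymm (mul_nonpos_of_nonneg_of_nonpos hl hGx) (by linarith [hlag xh hxX])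
  have hgrow : ∀ x ∈ X, proxFun f ρhat xt 0 xh + (1 + l) * ((ρhat - ρ) / 2 * ‖x - xh‖ ^ 2)
      ≤ proxFun f ρhat xt 0 x + l * proxConstraint f ρhat xt x := by
    intro x hx
    have := lagrangian_growth hΦ hG hl hxX (fun x hx => by rw [hcs, add_zero]; exact hlag x hx) hx
    rwa [hcs, add_zero] at this
  refine ⟨l, hl, ?_, fun x hx => ?_⟩
  · set r := ‖y - xh‖ with hr
    have hr0 : 0 ≤ r := norm_nonneg _
    obtain ⟨v, hv⟩ := h.subdifferential_nonempty 0 y hy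
    have h1 := h.proxFun_add_inner_le (ρhat := ρhat) 0 xt hy hxX hv
    have hV : ‖v + ρhat • (y - xt)‖ ≤ M + ρhat * D := by
      have hρ0 : 0 ≤ ρhat := by linarith
      refine (norm_add_le _ _).trans (add_le_add (h.subgradient_bound 0 y hy v hv) ?_)
      rw [norm_smul, Real.norm_eq_abs, abs_of_nonneg hρ0]
      exact mul_le_mul_of_nonneg_left (h.diam y hy xt hxt) hρ0
    have h2 := (abs_le.mp (abs_real_inner_le_norm (v + ρhat • (y - xt)) (xh - y))).1
    rw [norm_sub_rev xh y, ← hr] at h1 h2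
    have h3 := mul_le_mul_of_nonneg_right hV hr0
    have h4 := hgrow y hy
    have h5 := mul_le_mul_of_nonneg_left hGy.le hl
    have h6 : l * (σ + (ρhat - ρ) / 2 * r ^ 2) ≤ (M + ρhat * D) * r := by
      have h7 : 0 ≤ (ρhat - ρ) / 2 * r ^ 2 := by positivity
      linarith
    set q := √(2 * σ * (ρhat - ρ)) with hq
    have hq0 : 0 < q := Real.sqrt_pos.mpr (by positivity)
    have hq2 : q ^ 2 = 2 * σ * (ρhat - ρ) := Real.sq_sqrt (by positivity)
    -- the arithmetic-geometric mean inequality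
    have h8 : q * r ≤ σ + (ρhat - ρ) / 2 * r ^ 2 := by
      have e : σ + (ρhat - ρ) / 2 * r ^ 2 - q * r = (2 * σ - q * r) ^ 2 / (4 * σ) := by
        have : (2 * σ - q * r) ^ 2 = 4 * σ ^ 2 - 4 * σ * (q * r) + q ^ 2 * r ^ 2 := by ring
        rw [this, hq2]
        field_simp
        ring
      have : 0 ≤ (2 * σ - q * r) ^ 2 / (4 * σ) := by positivity
      linarith
    have h9 : l * (q * r) ≤ (M + ρhat * D) * r := (mul_le_mul_of_nonneg_left h8 hl).trans h6
    have hMD : 0 ≤ M + ρhat * D := (norm_nonneg _).trans hV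
    rw [le_div_iff₀ hq0]
    rcases hr0.eq_or_lt with h0 | hpos
    · rw [← h0] at h6
      have : l = 0 := by
        refine le_antisymm ?_ hl
        by_contra! hlt
        have := mul_pos hlt hσ
        linarith
      rw [this, zero_mul]
      exact hMD
    · refine le_of_mul_le_mul_right ?_ hpos
      linarith
  · have h1 := hgrow x hx
    have h2 : 0 ≤ l * ((ρhat - ρ) / 2 * ‖x - xh‖ ^ 2) := by positivity
    linarith

end ProxMultiplier

/-! ### Descent of the proximal method -/

section Descent

variable {m d : ℕ} {X : Set (Vec d)} {f : Fin (m + 1) → Vec d → EReal}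
  {ρ ε σ ρε D M ρhat : ℝ}

/-- The bound on the multipliers of all subproblems. -/
noncomputable def multiplierBound (ρ ρhat D M σ : ℝ) : ℝ :=
  (M + ρhat * D) / √(2 * σ * (ρhat - ρ))

lemma constraintMax_le_of_proxConstraint_le (hρhat : 0 ≤ ρhat) {xt x : Vec d} {c : ℝ}
    (h : proxConstraint f ρhat xt x ≤ c) : constraintMax f x ≤ c := by
  have : 0 ≤ ρhat / 2 * ‖x - xt‖ ^ 2 := by positivity
  rw [proxConstraint] at h
  linarith

lemma toReal_le_proxFun (hρhat : 0 ≤ ρhat) (i : Fin (m + 1)) (xt x : Vec d) :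
    (f i x).toReal ≤ proxFun f ρhat xt i x := by
  have : 0 ≤ ρhat / 2 * ‖x - xt‖ ^ 2 := by positivity
  rw [proxFun]
  linarith

/-- At a nearly feasible point the objective exceeds the subproblem value by a multiple of the
squared distance to the solution, up to the infeasibility weighted by the multiplier. -/
lemma ProblemAssumption.sq_dist_le (h : ProblemAssumption X f ρ ε σ ρε D M)
    (hm : 1 ≤ m) (hρ : 0 ≤ ρ) (hσ : 0 < σ) (hρhat : ρ < ρhat) (hρhat' : ρhat ≤ ρ + ρε)
    {xt xh : Vec d} (hxt : xt ∈ X) {c : ℝ} (hc : 0 ≤ c) (hcε : c ≤ ε ^ 2)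
    (hg : constraintMax f xt ≤ c) (hxh : IsProxSolution X f ρhat xt xh) :
    (ρhat - ρ) / 2 * ‖xt - xh‖ ^ 2
      ≤ (f 0 xt).toReal - proxFun f ρhat xt 0 xh + multiplierBound ρ ρhat D M σ * c := by
  obtain ⟨l, hl, hlb, hlag⟩ := h.exists_multiplier hm hρ hσ hρhat hρhat' hxt (hg.trans hcε) hxh
  have h1 := hlag xt hxt
  have e1 : proxFun f ρhat xt 0 xt = (f 0 xt).toReal := by simp [proxFun]
  have e2 : proxConstraint f ρhat xt xt = constraintMax f xt := by simp [proxConstraint]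
  rw [e1, e2] at h1
  have h2 : l * constraintMax f xt ≤ multiplierBound ρ ρhat D M σ * c :=
    (mul_le_mul_of_nonneg_left hg hl).trans (mul_le_mul_of_nonneg_right hlb hc)
  linarith

/-- Summing the descent inequalities of inexact proximal steps. -/
lemma ProblemAssumption.sum_sq_dist_le (h : ProblemAssumption X f ρ ε σ ρε D M)
    (hm : 1 ≤ m) (hρ : 0 ≤ ρ) (hσ : 0 < σ) (hρhat : ρ < ρhat)
    (hρhat' : ρhat ≤ ρ + ρε) {εhat : ℝ} (hεhat : εhat ^ 2 ≤ ε ^ 2) {T : ℕ}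
    {x xh : ℕ → Vec d} (hx : ∀ t ≤ T, x t ∈ X) (hx0 : constraintMax f (x 0) ≤ ε ^ 2)
    (hxh : ∀ t ≤ T, IsProxSolution X f ρhat (x t) (xh t))
    (hobj : ∀ t < T, proxFun f ρhat (x t) 0 (x (t + 1)) - proxFun f ρhat (x t) 0 (xh t)
      ≤ εhat ^ 2)
    (hcon : ∀ t < T, proxConstraint f ρhat (x t) (x (t + 1)) ≤ εhat ^ 2) :
    (ρhat - ρ) / 2 * ∑ t ∈ Finset.range (T + 1), ‖x t - xh t‖ ^ 2
      ≤ M * D + ρ / 2 * D ^ 2 + multiplierBound ρ ρhat D M σ * ε ^ 2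
        + T * (εhat ^ 2 * (multiplierBound ρ ρhat D M σ + 1)) := by
  have hρ0 : 0 ≤ ρhat := by linarith
  set Λ := multiplierBound ρ ρhat D M σ with hΛ
  have key : ∀ n ≤ T, (ρhat - ρ) / 2 * ∑ t ∈ Finset.range (n + 1), ‖x t - xh t‖ ^ 2
      ≤ (f 0 (x 0)).toReal - proxFun f ρhat (x n) 0 (xh n) + Λ * ε ^ 2
        + n * (εhat ^ 2 * (Λ + 1)) := by
    intro n
    induction n with
    | zero =>
      intro hn
      have := h.sq_dist_le hm hρ hσ hρhat hρhat' (hx 0 hn) (sq_nonneg ε) le_rfl hx0 (hxh 0 hn)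
      simp only [zero_add, Finset.sum_range_one, Nat.cast_zero, zero_mul, add_zero]
      exact this
    | succ n ih =>
      intro hn
      have h1 := ih (by omega)
      have h2 := h.sq_dist_le hm hρ hσ hρhat hρhat' (hx (n + 1) hn) (sq_nonneg εhat) hεhat
        (constraintMax_le_of_proxConstraint_le hρ0 (hcon n (by omega))) (hxh (n + 1) hn)
      have h3 := hobj n (by omega)
      have h4 := toReal_le_proxFun (f := f) hρ0 0 (x n) (x (n + 1))
      rw [Finset.sum_range_succ, mul_add]
      push_cast
      rw [← hΛ] at h2
      linarith
  have h1 := key T le_rfl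
  have hxhT := (hxh T le_rfl).1
  have h2 := toReal_le_proxFun (f := f) hρ0 0 (x T) (xh T)
  have h3 : (f 0 (x 0)).toReal - (f 0 (xh T)).toReal ≤ M * D + ρ / 2 * D ^ 2 := by
    obtain ⟨v, hv⟩ := h.subdifferential_nonempty 0 (x 0) (hx 0 (Nat.zero_le _))
    have h4 := h.toReal_add_inner_le 0 (hx 0 (Nat.zero_le _)) hxhT hv
    have h5 := (abs_le.mp (abs_real_inner_le_norm v (xh T - x 0))).1
    have hd := h.diam _ hxhT _ (hx 0 (Nat.zero_le _))
    have h6 : ‖v‖ * ‖xh T - x 0‖ ≤ M * D :=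
      mul_le_mul (h.subgradient_bound 0 _ (hx 0 (Nat.zero_le _)) v hv) hd (norm_nonneg _)
        ((norm_nonneg _).trans (h.subgradient_bound 0 _ (hx 0 (Nat.zero_le _)) v hv))
    have h7 : ρ / 2 * ‖xh T - x 0‖ ^ 2 ≤ ρ / 2 * D ^ 2 := by gcongr
    linarith
  linarith

lemma epsHat_spec {ρ ρhat D M σ ε : ℝ} (hΛ : 0 ≤ multiplierBound ρ ρhat D M σ)
    (hρhat : ρ < ρhat) (hε : 0 < ε) :
    0 < epsHat ρ ρhat D M σ ε ∧ epsHat ρ ρhat D M σ ε ^ 2 ≤ ε ^ 2 ∧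
    epsHat ρ ρhat D M σ ε ^ 2 * (multiplierBound ρ ρhat D M σ + 1) ≤ (ρhat - ρ) / 4 * ε ^ 2 := by
  set Λ := multiplierBound ρ ρhat D M σ with hΛdef
  set b := √((ρhat - ρ) / 4) * (√(Λ + 1))⁻¹ with hb
  have hκ : 0 < (ρhat - ρ) / 4 := by linarith
  have hb0 : 0 < b := mul_pos (Real.sqrt_pos.mpr hκ) (inv_pos.mpr (Real.sqrt_pos.mpr (by linarith)))
  have hb2 : b ^ 2 * (Λ + 1) = (ρhat - ρ) / 4 := by
    rw [hb, mul_pow, inv_pow, Real.sq_sqrt hκ.le, Real.sq_sqrt (by linarith)]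
    field_simp
  have e : epsHat ρ ρhat D M σ ε = min 1 b * ε := rfl
  have hmin : 0 < min 1 b := lt_min one_pos hb0
  have h1 : min 1 b ^ 2 ≤ 1 := pow_le_one₀ hmin.le (min_le_left _ _)
  have h2 : min 1 b ^ 2 ≤ b ^ 2 := pow_le_pow_left₀ hmin.le (min_le_right _ _) 2
  rw [e, mul_pow]
  refine ⟨mul_pos hmin hε, mul_le_of_le_one_left (sq_nonneg _) h1, ?_⟩
  calc min 1 b ^ 2 * ε ^ 2 * (Λ + 1) = min 1 b ^ 2 * (Λ + 1) * ε ^ 2 := by ring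
    _ ≤ b ^ 2 * (Λ + 1) * ε ^ 2 := by gcongr
    _ = _ := by rw [hb2]

end Descent

/-! ### The outer method -/

section OracleFailure

variable {m d : ℕ} {X : Set (Vec d)} {f : Fin (m + 1) → Vec d → EReal}
  {ρ ε σ ρε D M ρhat : ℝ} {Ξ : Type*}

/-- The point `x` is a solution of the subproblem at `xt` up to the accuracy `c`. -/
def IsApproxSolution (X : Set (Vec d)) (f : Fin (m + 1) → Vec d → EReal) (ρhat c : ℝ)
    (xt x : Vec d) : Prop :=
  ∃ xh, IsProxSolution X f ρhat xt xh ∧ proxFun f ρhat xt 0 x - proxFun f ρhat xt 0 xh ≤ c ∧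
    proxConstraint f ρhat xt x ≤ c

/-- The pairs `(x, r)` such that the optimal value of the subproblem at `x` is at most `r` form a
closed set, being the projection of a closed set along the compact set `X`. -/
lemma ProblemAssumption.isClosed_value_le (h : ProblemAssumption X f ρ ε σ ρε D M)
    (hρ : 0 ≤ ρ) (hM : 0 ≤ M) (hD : 0 ≤ D) :
    IsClosed {q : Vec d × ℝ | ∃ u ∈ X, (∀ i : Fin m, proxFun f ρhat q.1 i.succ u ≤ 0) ∧
      proxFun f ρhat q.1 0 u ≤ q.2} := by
  have : CompactSpace X := isCompact_iff_compactSpace.mp h.compact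
  have hcont : ∀ i, Continuous fun p : X × (Vec d × ℝ) => proxFun f ρhat p.2.1 i p.1 := by
    intro i
    have h1 : Continuous fun u : X => (f i u).toReal :=
      continuousOn_iff_continuous_domRestrict.mp (h.continuousOn_toReal hρ hM hD i)
    exact (h1.comp continuous_fst).add (by fun_prop)
  have hW : IsClosed {p : X × (Vec d × ℝ) | (∀ i : Fin m, proxFun f ρhat p.2.1 i.succ p.1 ≤ 0) ∧
      proxFun f ρhat p.2.1 0 p.1 ≤ p.2.2} := by
    refine IsClosed.and ?_ (isClosed_le (hcont 0) (by fun_prop))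
    rw [Set.ofPred_forall]
    exact isClosed_iInter fun i => isClosed_le (hcont i.succ) continuous_const
  convert isClosedMap_snd_of_compactSpace _ hW using 1
  ext q
  constructor
  · rintro ⟨u, hu, h1, h2⟩
    exact ⟨(⟨u, hu⟩, q), ⟨h1, h2⟩, rfl⟩
  · rintro ⟨⟨u, q'⟩, ⟨h1, h2⟩, rfl⟩
    exact ⟨u, u.2, h1, h2⟩

/-- Failure of a point `y` at a nearly feasible `x` is a measurable event of `(x, y)`. -/
lemma ProblemAssumption.measurableSet_failure (h : ProblemAssumption X f ρ ε σ ρε D M)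
    (hm : 1 ≤ m) (hρ : 0 ≤ ρ) (hM : 0 ≤ M) (hD : 0 ≤ D) (hσ : 0 < σ) (hρhat' : ρhat ≤ ρ + ρε)
    (c : ℝ) :
    MeasurableSet {q : Vec d × Vec d | (q.1 ∈ X ∧ constraintMax f q.1 ≤ ε ^ 2) ∧
      ¬ IsApproxSolution X f ρhat c q.1 q.2} := by
  set V : Set (Vec d × ℝ) := {q | ∃ u ∈ X, (∀ i : Fin m, proxFun f ρhat q.1 i.succ u ≤ 0) ∧
      proxFun f ρhat q.1 0 u ≤ q.2} with hV
  have hVm : MeasurableSet V := (h.isClosed_value_le hρ hM hD).measurableSet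
  have hF : ∀ i, Measurable fun q : Vec d × Vec d => proxFun f ρhat q.1 i q.2 := fun i =>
    ((h.measurable_toReal i).comp measurable_snd).add (by fun_prop)
  -- a strictly smaller value is attained iff some `r - 1 / (n + 1)` bounds the optimal value
  have hset : {q : Vec d × Vec d | (q.1 ∈ X ∧ constraintMax f q.1 ≤ ε ^ 2) ∧
      ¬ IsApproxSolution X f ρhat c q.1 q.2}
      = {q | q.1 ∈ X ∧ ∀ i : Fin m, (f i.succ q.1).toReal ≤ ε ^ 2}
        ∩ ({q | ∀ i : Fin m, proxFun f ρhat q.1 i.succ q.2 ≤ c}ᶜ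
          ∪ ⋃ n : ℕ, {q | (q.1, proxFun f ρhat q.1 0 q.2 - c - 1 / ((n : ℝ) + 1)) ∈ V}) := by
    ext ⟨x, y⟩
    simp only [Set.mem_ofPred_eq, Set.mem_inter_iff, Set.mem_union, Set.mem_compl_iff,
      Set.mem_iUnion, constraintMax_le_iff hm]
    refine and_congr_right fun hx => ?_
    obtain ⟨xh, hxh⟩ := h.exists_isProxSolution (ρhat := ρhat) hm hρ hM hD hσ hρhat' hx.1
      ((constraintMax_le_iff hm).mpr hx.2)
    constructor
    · intro hn
      by_cases hG : ∀ i : Fin m, proxFun f ρhat x i.succ y ≤ c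
      · right
        have hlt : 0 < proxFun f ρhat x 0 y - c - proxFun f ρhat x 0 xh := by
          by_contra! hle
          exact hn ⟨xh, hxh, by linarith, (proxConstraint_le_iff hm).mpr hG⟩
        obtain ⟨n, hn⟩ := exists_nat_one_div_lt hlt
        exact ⟨n, xh, hxh.1, (proxConstraint_le_iff hm).mp hxh.2.1, by
          change proxFun f ρhat x 0 xh ≤ proxFun f ρhat x 0 y - c - 1 / ((n : ℝ) + 1)
          linarith⟩
      · exact Or.inl hG
    · rintro (hG | ⟨n, u, hu, hGu, hFu⟩) ⟨xh', hxh', hobj, hcon⟩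
      · exact hG ((proxConstraint_le_iff hm).mp hcon)
      · have h1 := hxh'.2.2 u hu ((proxConstraint_le_iff hm).mpr hGu)
        have h2 : (0 : ℝ) < 1 / ((n : ℝ) + 1) := by positivity
        change proxFun f ρhat x 0 u ≤ proxFun f ρhat x 0 y - c - 1 / ((n : ℝ) + 1) at hFu
        linarith
  rw [hset]
  refine MeasurableSet.inter ?_ (MeasurableSet.union ?_ (MeasurableSet.iUnion fun n => ?_))
  · refine (h.compact.measurableSet.preimage measurable_fst).inter ?_
    change MeasurableSet {q : Vec d × Vec d | ∀ i : Fin m, (f i.succ q.1).toReal ≤ ε ^ 2}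
    rw [Set.ofPred_forall]
    exact MeasurableSet.iInter fun i =>
      measurableSet_le ((h.measurable_toReal i.succ).comp measurable_fst) measurable_const
  · refine MeasurableSet.compl ?_
    rw [Set.ofPred_forall]
    exact MeasurableSet.iInter fun i => measurableSet_le (hF i.succ) measurable_const
  · exact hVm.preimage (measurable_fst.prodMk (((hF 0).sub_const c).sub_const _))

variable [MeasurableSpace Ξ] {S : Estimator m d Ξ}

/-- The output of the inner method depends measurably on its input and on the samples. The input
enters the estimator as well, so it is treated as a part of each sample. -/
lemma measurable_yuOutput {Ω : Type*} {_ : MeasurableSpace Ω} (hconv : Convex ℝ X)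
    (hX : IsCompact X) (hne : X.Nonempty) {K : ℕ} (hK : 1 ≤ K)
    (hθ : ∀ i, Measurable fun p : Vec d × Ξ => S.θ i p.1 p.2)
    (hζ : ∀ i, Measurable fun p : Vec d × Ξ => S.ζ i p.1 p.2) {x : Ω → Vec d} (hx : Measurable x)
    {s : ℕ → Ω → Ξ} (hs : ∀ j, Measurable (s j)) :
    Measurable fun ω => yuOutput X S ρhat K (x ω) fun j => s j ω := by
  let S' : Estimator m d (Vec d × Ξ) :=
    ⟨fun i y q => (proxEstimator S ρhat q.1).θ i y q.2,
      fun i y q => (proxEstimator S ρhat q.1).ζ i y q.2⟩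
  have hy : Measurable fun p : Vec d × (Vec d × Ξ) => (p.1, p.2.2) := by fun_prop
  have hθ' : ∀ i, Measurable fun p : Vec d × (Vec d × Ξ) => S'.θ i p.1 p.2 := fun i =>
    ((hθ i).comp hy).add (by fun_prop)
  have hζ' : ∀ i, Measurable fun p : Vec d × (Vec d × Ξ) => S'.ζ i p.1 p.2 := fun i =>
    ((hζ i).comp hy).add (by fun_prop)
  have heq : ∀ ω k, pdIter X (proxEstimator S ρhat (x ω)) K (x ω) (fun j => s j ω) k
      = pdIter X S' K (x ω) (fun j => (x ω, s j ω)) k := by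
    intro ω k
    induction k with
    | zero => rfl
    | succ k ih => rw [pdIter, pdIter, ih]; rfl
  simp only [yuOutput, yuState_z, heq]
  refine Measurable.const_smul (Finset.measurable_sum _ fun k _ => ?_) ((K : ℝ)⁻¹)
  exact measurable_fst.comp (measurable_pdIter_comp hconv hX hne hK hθ' hζ' hx k
    (s := fun j ω => (x ω, s j ω)) fun j _ => hx.prodMk (hs j))

end OracleFailure

section Outer

variable {m d : ℕ} {X : Set (Vec d)} {f : Fin (m + 1) → Vec d → EReal}
  {ρ ε σ ρε D M ρhat M0 M1 : ℝ} {Ξ : Type*} {S : Estimator m d Ξ} {K : ℕ}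

lemma ipcState_x_mem (hc : Convex ℝ X) (hX : IsCompact X) (hK : 1 ≤ K) {x0 : Vec d}
    (hx0 : x0 ∈ X) (s : ℕ → ℕ → Ξ) (t : ℕ) : (ipcState X S ρhat K x0 s t).x ∈ X := by
  induction t with
  | zero => exact hx0
  | succ t ih => exact yuOutput_mem hc hX S hK ih (s t)

lemma ipcState_queries (x0 : Vec d) (s : ℕ → ℕ → Ξ) (t : ℕ) :
    (ipcState X S ρhat K x0 s t).queries = t * K := by
  induction t with
  | zero => simp [ipcState]
  | succ t ih =>
    change (ipcState X S ρhat K x0 s t).queries + (yuState X S ρhat K _ (s t) K).queries = _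
    rw [ih, yuState_queries]
    ring

variable [MeasurableSpace Ξ] {P : Measure Ξ} {Ω : Type*}

/-- The iterate `x_t` is determined by the samples of the previous outer iterations. -/
lemma measurable_ipcState_x {ξ : ℕ × ℕ → Ω → Ξ} (hconv : Convex ℝ X) (hX : IsCompact X) (hK : 1 ≤ K)
    (hS : EstimatorAssumption X f S P M0 M1) {x0 : Vec d} (hx0 : x0 ∈ X) (t : ℕ) :
    Measurable[⨆ p ∈ {p : ℕ × ℕ | p.1 < t}, MeasurableSpace.comap (ξ p) inferInstance]
      fun ω => (ipcState X S ρhat K x0 (fun t k => ξ (t, k) ω) t).x := by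
  induction t with
  | zero => exact measurable_const
  | succ t ih =>
    have hx := Measurable.le (m0 := ⨆ p ∈ {p : ℕ × ℕ | p.1 < t + 1},
      MeasurableSpace.comap (ξ p) inferInstance)
      (biSup_mono fun p (hp : p.1 < t) => Nat.lt_succ_of_lt hp) ih
    refine measurable_yuOutput hconv hX ⟨x0, hx0⟩ hK hS.measurable_θ hS.measurable_ζ hx
      fun k => ?_
    refine Measurable.mono (comap_measurable (ξ (t, k))) ?_ le_rfl
    exact le_iSup₂_of_le (f := fun p (_ : p ∈ {p : ℕ × ℕ | p.1 < t + 1}) =>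
      MeasurableSpace.comap (ξ p) inferInstance) (t, k) (Nat.lt_succ_self t) le_rfl

variable [MeasurableSpace Ω] {μ : Measure Ω} {ξ : ℕ × ℕ → Ω → Ξ}

lemma IsIIDSample.row (h : IsIIDSample ξ P μ) (t : ℕ) :
    IsIIDSample (fun k => ξ (t, k)) P μ where
  measurable k := h.measurable (t, k)
  law k := h.law (t, k)
  indep := h.indep.precomp (g := fun k => (t, k)) fun _ _ hab => (Prod.mk.inj hab).2

lemma IsIIDSample.indepFun_ipcState_x (h : IsIIDSample ξ P μ) (hconv : Convex ℝ X)
    (hX : IsCompact X) (hK : 1 ≤ K) (hS : EstimatorAssumption X f S P M0 M1) {x0 : Vec d}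
    (hx0 : x0 ∈ X) (t : ℕ) :
    IndepFun (fun ω => (ipcState X S ρhat K x0 (fun t k => ξ (t, k) ω) t).x)
      (fun ω k => ξ (t, k) ω) μ := by
  have h1 := indep_iSup_of_disjoint (m := fun p => MeasurableSpace.comap (ξ p) inferInstance)
    (fun p => (h.measurable p).comap_le) h.indep (S := {p : ℕ × ℕ | p.1 < t})
    (T := {p : ℕ × ℕ | p.1 = t}) (Set.disjoint_left.mpr fun p (hp : p.1 < t) (hp' : p.1 = t) => by
      omega)
  rw [IndepFun_iff_Indep]
  refine indep_of_indep_of_le_left (indep_of_indep_of_le_right h1 ?_)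
    (measurable_ipcState_x hconv hX hK hS hx0 t).comap_le
  refine Measurable.comap_le (m₁ := ⨆ p ∈ {p : ℕ × ℕ | p.1 = t},
    MeasurableSpace.comap (ξ p) inferInstance) (@measurable_pi_lambda _ _ _ (_) _ _ fun k => ?_)
  refine Measurable.mono (comap_measurable (ξ (t, k))) ?_ le_rfl
  exact le_iSup₂_of_le (f := fun p (_ : p ∈ {p : ℕ × ℕ | p.1 = t}) =>
    MeasurableSpace.comap (ξ p) inferInstance) (t, k) rfl le_rfl

/-- An outer step started at a nearly feasible iterate fails with probability at most `δ`: the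
iterate is independent of the fresh samples, so the bound for deterministic inputs applies. -/
lemma ProblemAssumption.measure_step_failure_le [IsProbabilityMeasure μ]
    (h : ProblemAssumption X f ρ ε σ ρε D M) (hS : EstimatorAssumption X f S P M0 M1)
    (hξ : IsIIDSample ξ P μ) (hm : 1 ≤ m) (hρ : 0 ≤ ρ) (hM : 0 ≤ M) (hD : 0 ≤ D) (hσ : 0 < σ)
    (hρhat' : ρhat ≤ ρ + ρε) (hK : 1 ≤ K) {x0 : Vec d} (hx0 : x0 ∈ X) {c : ℝ} {δ : ENNReal}
    (hfix : ∀ t, ∀ x ∈ X, constraintMax f x ≤ ε ^ 2 →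
      μ {ω | ¬ IsApproxSolution X f ρhat c x (yuOutput X S ρhat K x fun k => ξ (t, k) ω)} ≤ δ)
    (t : ℕ) :
    μ {ω | ((ipcState X S ρhat K x0 (fun t k => ξ (t, k) ω) t).x ∈ X ∧
        constraintMax f (ipcState X S ρhat K x0 (fun t k => ξ (t, k) ω) t).x ≤ ε ^ 2) ∧
      ¬ IsApproxSolution X f ρhat c (ipcState X S ρhat K x0 (fun t k => ξ (t, k) ω) t).x
        (ipcState X S ρhat K x0 (fun t k => ξ (t, k) ω) (t + 1)).x} ≤ δ := by
  set x : Ω → Vec d := fun ω => (ipcState X S ρhat K x0 (fun t k => ξ (t, k) ω) t).x with hxdef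
  set s : Ω → ℕ → Ξ := fun ω k => ξ (t, k) ω with hsdef
  have hx : Measurable x := Measurable.le (iSup₂_le fun p _ => (hξ.measurable p).comap_le)
    (measurable_ipcState_x h.convex h.compact hK hS hx0 t)
  have hs : Measurable s := measurable_pi_lambda _ fun k => hξ.measurable (t, k)
  set bad : Set (Vec d × (ℕ → Ξ)) := {q | (q.1 ∈ X ∧ constraintMax f q.1 ≤ ε ^ 2) ∧
    ¬ IsApproxSolution X f ρhat c q.1 (yuOutput X S ρhat K q.1 q.2)} with hbad
  have hout : Measurable fun q : Vec d × (ℕ → Ξ) => yuOutput X S ρhat K q.1 q.2 :=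
    measurable_yuOutput h.convex h.compact ⟨x0, hx0⟩ hK hS.measurable_θ hS.measurable_ζ
      measurable_fst (s := fun (j : ℕ) (q : Vec d × (ℕ → Ξ)) => q.2 j) fun j => (measurable_pi_apply j).comp measurable_snd
  have hbadm : MeasurableSet bad :=
    (h.measurableSet_failure hm hρ hM hD hσ hρhat' c).preimage (measurable_fst.prodMk hout)
  have hmap := (hξ.indepFun_ipcState_x (ρhat := ρhat) h.convex h.compact hK hS hx0
    t).map_prod_eq_prod_map_map hx.aemeasurable hs.aemeasurable
  have : IsProbabilityMeasure (μ.map x) := Measure.isProbabilityMeasure_map hx.aemeasurable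
  have : IsProbabilityMeasure (μ.map s) := Measure.isProbabilityMeasure_map hs.aemeasurable
  calc μ {ω | (x ω, s ω) ∈ bad} = (μ.map fun ω => (x ω, s ω)) bad :=
        (Measure.map_apply (hx.prodMk hs) hbadm).symm
    _ = ∫⁻ y, (μ.map s) (Prod.mk y ⁻¹' bad) ∂(μ.map x) := by
        rw [hmap, Measure.prod_apply hbadm]
    _ ≤ ∫⁻ _, δ ∂(μ.map x) := by
        refine lintegral_mono fun y => ?_
        rw [Measure.map_apply hs (measurable_prodMk_left hbadm)]
        by_cases hy : y ∈ X ∧ constraintMax f y ≤ ε ^ 2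
        · exact (measure_mono fun ω hω => hω.2).trans (hfix t y hy.1 hy.2)
        · have : s ⁻¹' (Prod.mk y ⁻¹' bad) = ∅ :=
            Set.eq_empty_of_forall_notMem fun ω hω => hy hω.1
          rw [this, measure_empty]
          exact zero_le
    _ = δ := by simp

/-- When every step succeeds with probability at least `1 - δ / T`, all steps succeed, and the
average squared distance to the subproblem solutions is bounded, with probability at least
`1 - δ`. -/
lemma ProblemAssumption.measure_not_average_le [IsProbabilityMeasure μ]
    (h : ProblemAssumption X f ρ ε σ ρε D M) (hS : EstimatorAssumption X f S P M0 M1)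
    (hξ : IsIIDSample ξ P μ) (hm : 1 ≤ m) (hρ : 0 ≤ ρ) (hM : 0 ≤ M) (hD : 0 ≤ D) (hσ : 0 < σ)
    (hρhat : ρ < ρhat) (hρhat' : ρhat ≤ ρ + ρε) (hK : 1 ≤ K) {x0 : Vec d} (hx0 : x0 ∈ X)
    (hg0 : constraintMax f x0 ≤ ε ^ 2) {εhat : ℝ} (hεhat : εhat ^ 2 ≤ ε ^ 2) {δ : ENNReal} {T : ℕ}
    (hfix : ∀ t, ∀ x ∈ X, constraintMax f x ≤ ε ^ 2 →
      μ {ω | ¬ IsApproxSolution X f ρhat (εhat ^ 2) x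
        (yuOutput X S ρhat K x fun k => ξ (t, k) ω)} ≤ δ)
    (hfinal : M * D + ρ / 2 * D ^ 2 + multiplierBound ρ ρhat D M σ * ε ^ 2
        + T * (εhat ^ 2 * (multiplierBound ρ ρhat D M σ + 1))
      ≤ (ρhat - ρ) / 2 * ((T + 1) * ε ^ 2)) :
    μ {ω | ¬ ∃ xh : ℕ → Vec d,
        (∀ t ≤ T, IsProxSolution X f ρhat
          (ipcState X S ρhat K x0 (fun t k => ξ (t, k) ω) t).x (xh t)) ∧
        (∑ t ∈ Finset.range (T + 1),
          ‖(ipcState X S ρhat K x0 (fun t k => ξ (t, k) ω) t).x - xh t‖ ^ 2) / (T + 1)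
          ≤ ε ^ 2} ≤ T * δ := by
  set x : Ω → ℕ → Vec d := fun ω t => (ipcState X S ρhat K x0 (fun t k => ξ (t, k) ω) t).x
    with hxdef
  set E : ℕ → Set Ω := fun t => {ω | (x ω t ∈ X ∧ constraintMax f (x ω t) ≤ ε ^ 2) ∧
    ¬ IsApproxSolution X f ρhat (εhat ^ 2) (x ω t) (x ω (t + 1))} with hE
  have hEm : ∀ t ∈ Finset.range T, μ (E t) ≤ δ := fun t _ =>
    h.measure_step_failure_le hS hξ hm hρ hM hD hσ hρhat' hK hx0 hfix t
  have hρ0 : 0 ≤ ρhat := by linarith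
  calc _ ≤ μ (⋃ t ∈ Finset.range T, E t) := by
        refine measure_mono fun ω hω => ?_
        by_contra hn
        simp only [Set.mem_iUnion, not_exists, Finset.mem_range] at hn
        have hX : ∀ t, x ω t ∈ X := fun t =>
          ipcState_x_mem h.convex h.compact hK hx0 _ t
        have happ : ∀ t < T, constraintMax f (x ω t) ≤ ε ^ 2 →
            IsApproxSolution X f ρhat (εhat ^ 2) (x ω t) (x ω (t + 1)) := by
          intro t ht hg
          by_contra hcon
          exact hn t ht ⟨⟨hX t, hg⟩, hcon⟩
        have hfeas : ∀ t ≤ T, constraintMax f (x ω t) ≤ ε ^ 2 := by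
          intro t
          induction t with
          | zero => exact fun _ => hg0
          | succ t ih =>
            intro ht
            obtain ⟨_, _, _, hcon⟩ := happ t (by omega) (ih (by omega))
            exact (constraintMax_le_of_proxConstraint_le hρ0 hcon).trans hεhat
        have hsol : ∀ t, ∃ y, t ≤ T → IsProxSolution X f ρhat (x ω t) y := by
          intro t
          by_cases ht : t ≤ T
          · obtain ⟨y, hy⟩ := h.exists_isProxSolution hm hρ hM hD hσ hρhat' (hX t) (hfeas t ht)
            exact ⟨y, fun _ => hy⟩
          · exact ⟨0, fun hle => absurd hle ht⟩
        choose xh hxh using hsol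
        refine hω ⟨xh, hxh, ?_⟩
        have hsum := h.sum_sq_dist_le hm hρ hσ hρhat hρhat' hεhat (x := x ω) (xh := xh)
          (fun t _ => hX t) hg0 hxh
          (fun t ht => by
            obtain ⟨y, hy, hobj, _⟩ := happ t ht (hfeas t ht.le)
            have := hy.2.2 (xh t) (hxh t ht.le).1 (hxh t ht.le).2.1
            linarith)
          (fun t ht => by
            obtain ⟨_, _, _, hcon⟩ := happ t ht (hfeas t ht.le)
            exact hcon)
        rw [div_le_iff₀ (by positivity)]
        have h1 := le_of_mul_le_mul_left (hsum.trans hfinal) (by linarith)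
        linarith
    _ ≤ ∑ t ∈ Finset.range T, μ (E t) := measure_biUnion_finset_le _ _
    _ ≤ ∑ t ∈ Finset.range T, δ := Finset.sum_le_sum hEm
    _ = T * δ := by rw [Finset.sum_const, Finset.card_range, nsmul_eq_mul]

end Outer

/-! ### Sample complexity -/

/-- The budget for accuracy `κ ε` and failure probability `δ / T` with `T = O(1 / ε²)`. -/
lemma exists_iterBudget_le {C κ E : ℝ} (hC : 1 ≤ C) (hκ : 0 < κ) (hκ1 : κ ≤ 1) (hE : 1 ≤ E) :
    ∃ N : ℝ, 0 ≤ N ∧ ∀ (ε δ : ℝ) (T : ℕ), 0 < ε → ε ≤ 1 → 0 < δ → δ < 1 → 1 ≤ T →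
      (T : ℝ) ≤ E / ε ^ 2 →
      iterBudget C (κ * ε) (δ / T) ≤ N / ε ^ 4 * (1 + Real.log (1 / (ε * δ))) ^ 3 := by
  have hlogE : 0 ≤ Real.log E := Real.log_nonneg hE
  have hlogκ : 0 ≤ Real.log κ⁻¹ := Real.log_nonneg (one_le_inv_iff₀.mpr ⟨hκ, hκ1⟩)
  set a := 3 + Real.log κ⁻¹ + Real.log E with ha
  have ha0 : 0 ≤ a := by positivity
  refine ⟨C * κ⁻¹ ^ 4 * a ^ 3, by positivity, fun ε δ T hε hε1 hδ hδ1 hT hTE => ?_⟩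
  have hT1 : (1 : ℝ) ≤ T := by exact_mod_cast hT
  have hlε : 0 ≤ Real.log ε⁻¹ := Real.log_nonneg (one_le_inv_iff₀.mpr ⟨hε, hε1⟩)
  have hlδ : 0 ≤ Real.log δ⁻¹ := Real.log_nonneg (one_le_inv_iff₀.mpr ⟨hδ, hδ1.le⟩)
  have hℓ : Real.log (1 / (ε * δ)) = Real.log ε⁻¹ + Real.log δ⁻¹ := by
    rw [one_div, mul_inv, Real.log_mul (inv_pos.mpr hε).ne' (inv_pos.mpr hδ).ne']
  have hmax : max 1 (κ * ε)⁻¹ = κ⁻¹ * ε⁻¹ := by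
    rw [mul_inv]
    refine max_eq_right ?_
    exact one_le_mul_of_one_le_of_one_le (one_le_inv_iff₀.mpr ⟨hκ, hκ1⟩)
      (one_le_inv_iff₀.mpr ⟨hε, hε1⟩)
  have hlogT : Real.log T ≤ Real.log E + 2 * Real.log ε⁻¹ := by
    refine (Real.log_le_log (by linarith) hTE).trans (le_of_eq ?_)
    rw [Real.log_div (by linarith) (by positivity), Real.log_pow, Real.log_inv]
    push_cast
    ring
  have hlogT0 : 0 ≤ Real.log T := Real.log_nonneg hT1
  have hlogδT : Real.log (δ / T)⁻¹ = Real.log T + Real.log δ⁻¹ := by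
    rw [inv_div, log_const_mul_div (by linarith) hδ]
  rw [iterBudget, hmax, hlogδT, Real.log_mul (inv_pos.mpr hκ).ne' (inv_pos.mpr hε).ne', hℓ]
  set ℓ := Real.log ε⁻¹ + Real.log δ⁻¹ with hℓdef
  have hℓ0 : 0 ≤ ℓ := by positivity
  have h1 : 1 + (Real.log T + Real.log δ⁻¹) ≤ a * (1 + ℓ) := by
    have : 0 ≤ (Real.log κ⁻¹ + Real.log E) * ℓ := by positivity
    rw [ha]
    linarith
  have h2 : 1 + (Real.log κ⁻¹ + Real.log ε⁻¹) + (Real.log T + Real.log δ⁻¹) ≤ a * (1 + ℓ) := by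
    have : 0 ≤ (Real.log κ⁻¹ + Real.log E) * ℓ := by positivity
    rw [ha]
    linarith
  calc C * (κ⁻¹ * ε⁻¹) ^ 4 * (1 + (Real.log T + Real.log δ⁻¹))
        * (1 + (Real.log κ⁻¹ + Real.log ε⁻¹) + (Real.log T + Real.log δ⁻¹)) ^ 2
      ≤ C * (κ⁻¹ * ε⁻¹) ^ 4 * (a * (1 + ℓ)) * (a * (1 + ℓ)) ^ 2 := by
        gcongr
    _ = _ := by
        field_simp

/-- The inner method meeting the iteration budget succeeds with probability at least `1 - δ`. -/
lemma ProblemAssumption.measure_not_isApproxSolution_le {m d : ℕ} {X : Set (Vec d)}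
    {f : Fin (m + 1) → Vec d → EReal} {ρ ε σ ρε D M ρhat M0 M1 : ℝ} {Ξ Ω : Type*}
    [MeasurableSpace Ξ] {P : Measure Ξ} [IsProbabilityMeasure P] {S : Estimator m d Ξ}
    [MeasurableSpace Ω] {μ : Measure Ω} [IsProbabilityMeasure μ]
    (h : ProblemAssumption X f ρ ε σ ρε D M) (hS : EstimatorAssumption X f S P M0 M1)
    (hm : 1 ≤ m) (hD : 0 ≤ D) (hM : 0 ≤ M) (hM0 : 0 ≤ M0) (hM1 : 0 ≤ M1) (hρ : 0 ≤ ρ)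
    (hσ : 0 < σ) (hρhat : ρ < ρhat) (hρhat' : ρhat ≤ ρ + ρε) {ξ : ℕ → Ω → Ξ}
    (hξ : IsIIDSample ξ P μ) {xt : Vec d} (hxt : xt ∈ X) (hg : constraintMax f xt ≤ ε ^ 2) {K : ℕ}
    {δ c : ℝ} (hK : 1 ≤ K) (hδ : 0 < δ) (hδ1 : δ < 1)
    (hB1 : boundB1 D (tildeM0 m D ρhat M0) (tildeM1 D ρhat M1) m σ K δ ≤ c)
    (hB2 : boundB2 D (tildeM0 m D ρhat M0) (tildeM1 D ρhat M1) m σ K δ ≤ c) :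
    μ {ω | ¬ IsApproxSolution X f ρhat c xt (yuOutput X S ρhat K xt fun k => ξ k ω)}
      ≤ ENNReal.ofReal δ := by
  refine (measure_mono ?_).trans (h.measure_not_bounds_le hS hm hD hM hM0 hM1 hρ hσ hρhat hρhat'
    hξ hxt hg hK hδ hδ1)
  intro ω hω hcon
  apply hω
  obtain ⟨xh, hxh, hobj, hfeas⟩ := hcon
  exact ⟨xh, hxh, hobj.trans hB1, (proxConstraint_le_iff hm).mpr fun i => (hfeas i).trans hB2⟩

end IPC

theorem mainTheorem4
    (m : ℕ) (hm : 1 ≤ m)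
    (D M M0 M1 ρ ρε σ ρhat : ℝ)
    (hD : 0 ≤ D) (hM : 0 ≤ M) (hM0 : 0 ≤ M0) (hM1 : 0 ≤ M1)
    (hρ : 0 ≤ ρ) (hρε : 0 < ρε) (hσ : 0 < σ)
    (hρhat : ρ < ρhat) (hρhat' : ρhat ≤ ρ + ρε) :
    -- the bounds hold with probability at least `1 - δ`
    (∀ (d : ℕ) (X : Set (Vec d)) (f : Fin (m + 1) → Vec d → EReal) (ε : ℝ), 0 < ε →
      ProblemAssumption X f ρ ε σ ρε D M →
      ∀ (Ξ : Type*) [MeasurableSpace Ξ] (P : Measure Ξ) [IsProbabilityMeasure P]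
        (S : Estimator m d Ξ), EstimatorAssumption X f S P M0 M1 →
      ∀ (Ω : Type*) [MeasurableSpace Ω] (μ : Measure Ω) [IsProbabilityMeasure μ]
        (ξ : ℕ → Ω → Ξ), IsIIDSample ξ P μ →
      ∀ xt ∈ X, constraintMax f xt ≤ ε ^ 2 →
      ∀ (K : ℕ) (δ : ℝ), 1 ≤ K → 0 < δ → δ < 1 →
        μ {ω | ¬ ∃ xh, IsProxSolution X f ρhat xt xh ∧
          proxFun f ρhat xt 0 (yuOutput X S ρhat K xt fun k => ξ k ω) - proxFun f ρhat xt 0 xh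
            ≤ boundB1 D (tildeM0 m D ρhat M0) (tildeM1 D ρhat M1) m σ K δ ∧
          ∀ i : Fin m, proxFun f ρhat xt i.succ (yuOutput X S ρhat K xt fun k => ξ k ω)
            ≤ boundB2 D (tildeM0 m D ρhat M0) (tildeM1 D ρhat M1) m σ K δ}
          ≤ ENNReal.ofReal δ) ∧
    -- order of the bounds
    (∀ δ : ℝ, 0 < δ → δ < 1 →
      (fun K : ℕ => boundB1 D (tildeM0 m D ρhat M0) (tildeM1 D ρhat M1) m σ K δ)
        =O[atTop] (fun K : ℕ => Real.log (K / δ) / √(K : ℝ)) ∧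
      (fun K : ℕ => boundB2 D (tildeM0 m D ρhat M0) (tildeM1 D ρhat M1) m σ K δ)
        =O[atTop] (fun K : ℕ => Real.log (K / δ) / √(K : ℝ))) ∧
    ∃ C : ℝ, 0 < C ∧
      -- sufficiently many iterations make both bounds at most `εhat ^ 2`
      (∀ (εhat δ : ℝ) (K : ℕ), 0 < εhat → 0 < δ → δ < 1 → iterBudget C εhat δ ≤ K →
        boundB1 D (tildeM0 m D ρhat M0) (tildeM1 D ρhat M1) m σ K δ ≤ εhat ^ 2 ∧
        boundB2 D (tildeM0 m D ρhat M0) (tildeM1 D ρhat M1) m σ K δ ≤ εhat ^ 2) ∧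
      -- the method with that many iterations is an oracle
      (∀ (d : ℕ) (X : Set (Vec d)) (f : Fin (m + 1) → Vec d → EReal) (ε : ℝ), 0 < ε →
        ProblemAssumption X f ρ ε σ ρε D M →
        ∀ (Ξ : Type*) [MeasurableSpace Ξ] (P : Measure Ξ) [IsProbabilityMeasure P]
          (S : Estimator m d Ξ), EstimatorAssumption X f S P M0 M1 →
        ∀ (Ω : Type*) [MeasurableSpace Ω] (μ : Measure Ω) [IsProbabilityMeasure μ]
          (ξ : ℕ → Ω → Ξ), IsIIDSample ξ P μ →
        ∀ K : ℝ → ℝ → ℕ, (∀ εhat δ : ℝ, 0 < εhat → 0 < δ → δ < 1 →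
            iterBudget C εhat δ ≤ K εhat δ) →
          IsOracle X f ρhat {x | x ∈ X ∧ constraintMax f x ≤ ε ^ 2} μ
            (fun x εhat δ ω => yuOutput X S ρhat (K εhat δ) x fun k => ξ k ω)) ∧
      -- complexity of the inexact proximally constrained method with this oracle
      (∃ C' : ℝ, 0 < C' ∧ ∀ ε δ : ℝ, 0 < ε → ε ≤ 1 → 0 < δ → δ < 1 →
        ∃ T K : ℕ, 1 ≤ T ∧ (T : ℝ) ≤ C' / ε ^ 2 ∧
          K = ⌈iterBudget C (epsHat ρ ρhat D M σ ε) (δ / T)⌉₊ ∧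
          ∀ (d : ℕ) (X : Set (Vec d)) (f : Fin (m + 1) → Vec d → EReal),
          ProblemAssumption X f ρ ε σ ρε D M →
          ∀ (Ξ : Type*) [MeasurableSpace Ξ] (P : Measure Ξ) [IsProbabilityMeasure P]
            (S : Estimator m d Ξ), EstimatorAssumption X f S P M0 M1 →
          ∀ (Ω : Type*) [MeasurableSpace Ω] (μ : Measure Ω) [IsProbabilityMeasure μ]
            (ξ : ℕ × ℕ → Ω → Ξ), IsIIDSample ξ P μ →
          ∀ x0 ∈ X, constraintMax f x0 ≤ ε ^ 2 →
            (∀ ω, ((ipcState X S ρhat K x0 (fun t k => ξ (t, k) ω) T).queries : ℝ)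
              ≤ C' / ε ^ 6 * (1 + Real.log (1 / (ε * δ))) ^ 3) ∧
            (∀ ω, ∀ t ≤ T, (ipcState X S ρhat K x0 (fun t k => ξ (t, k) ω) t).x ∈ X) ∧
            μ {ω | ¬ ∃ xh : ℕ → Vec d,
              (∀ t ≤ T, IsProxSolution X f ρhat
                (ipcState X S ρhat K x0 (fun t k => ξ (t, k) ω) t).x (xh t)) ∧
              (∑ t ∈ Finset.range (T + 1),
                ‖(ipcState X S ρhat K x0 (fun t k => ξ (t, k) ω) t).x - xh t‖ ^ 2) / (T + 1)
                ≤ ε ^ 2} ≤ ENNReal.ofReal δ) := by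
  have hρ0 : 0 ≤ ρhat := by linarith
  have hA : 0 ≤ tildeM0 m D ρhat M0 := by unfold tildeM0; positivity
  have hB : 0 ≤ tildeM1 D ρhat M1 := by unfold tildeM1; positivity
  obtain ⟨c, hc, hbounds⟩ := bounds_le hm hσ hD hA hB
  have hC : 1 ≤ (10 * c) ^ 4 := one_le_pow₀ (by linarith)
  have hbudget : ∀ (εhat δ : ℝ) (K : ℕ), 0 < εhat → 0 < δ → δ < 1 →
      iterBudget ((10 * c) ^ 4) εhat δ ≤ K → 1 ≤ K ∧
      boundB1 D (tildeM0 m D ρhat M0) (tildeM1 D ρhat M1) m σ K δ ≤ εhat ^ 2 ∧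
      boundB2 D (tildeM0 m D ρhat M0) (tildeM1 D ρhat M1) m σ K δ ≤ εhat ^ 2 := by
    intro εhat δ K hε hδ hδ1 hK
    have hK1 : 1 ≤ K := by exact_mod_cast (one_le_iterBudget hC hδ hδ1).trans hK
    have hle := le_sq_of_iterBudget_le hc hε hδ hδ1 hK
    obtain ⟨⟨-, h1⟩, -, h2⟩ := hbounds K δ hK1 hδ hδ1
    exact ⟨hK1, h1.trans hle, h2.trans hle⟩
  refine ⟨?_, ?_, (10 * c) ^ 4, by linarith, ?_, ?_, ?_⟩
  · intro d X f ε _ hP Ξ _ P _ S hS Ω _ μ _ ξ hξ xt hxt hg K δ hK hδ hδ1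
    exact hP.measure_not_bounds_le hS hm hD hM hM0 hM1 hρ hσ hρhat hρhat' hξ hxt hg hK hδ hδ1
  · intro δ hδ hδ1
    exact ⟨isBigO_of_le hδ hδ1 (fun K hK => (hbounds K δ hK hδ hδ1).1) (by linarith),
      isBigO_of_le hδ hδ1 (fun K hK => (hbounds K δ hK hδ hδ1).2) (by linarith)⟩
  · exact fun εhat δ K hε hδ hδ1 hK => (hbudget εhat δ K hε hδ hδ1 hK).2
  · intro d X f ε _ hP Ξ _ P _ S hS Ω _ μ _ ξ hξ K hK x hx εhat δ hε hδ hδ1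
    obtain ⟨hK1, h1, h2⟩ := hbudget εhat δ _ hε hδ hδ1 (hK εhat δ hε hδ hδ1)
    exact ⟨fun ω => yuOutput_mem hP.convex hP.compact S hK1 hx.1 _,
      hP.measure_not_isApproxSolution_le hS hm hD hM hM0 hM1 hρ hσ hρhat hρhat' hξ hx.1 hx.2 hK1
        hδ hδ1 h1 h2⟩
  · have hgap : 0 < ρhat - ρ := by linarith
    have hΛ : 0 ≤ multiplierBound ρ ρhat D M σ := by unfold multiplierBound; positivity
    set Λ := multiplierBound ρ ρhat D M σ with hΛdef
    set κ := epsHat ρ ρhat D M σ 1 with hκdef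
    have hκε : ∀ ε, epsHat ρ ρhat D M σ ε = κ * ε := fun ε => by simp [hκdef, epsHat]
    obtain ⟨hκ, hκ1, -⟩ := epsHat_spec hΛ hρhat one_pos
    have hκ1 : κ ≤ 1 := by
      rw [one_pow] at hκ1
      exact (pow_le_one_iff_of_nonneg hκ.le two_ne_zero).mp hκ1
    -- `b` bounds the sum of squared distances that the total decrease of the objective can pay for,
    -- up to a factor `2`; with `T ≥ b / ε²` it contributes at most `ε² / 2` to the average, and
    -- the inexactness of the steps contributes at most another `ε² / 2`
    set b := 4 / (ρhat - ρ) * (M * D + ρ / 2 * D ^ 2 + Λ) with hb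
    have hb0 : 0 ≤ b := by positivity
    obtain ⟨N, hN, hNle⟩ := exists_iterBudget_le hC hκ hκ1 (show 1 ≤ b + 2 by linarith)
    refine ⟨(b + 2) * (N + 1), by positivity, fun ε δ hε hε1 hδ hδ1 => ?_⟩
    have hε2 : 0 < ε ^ 2 := by positivity
    have hε21 : ε ^ 2 ≤ 1 := pow_le_one₀ hε.le hε1
    obtain ⟨T, hTdef⟩ : ∃ T : ℕ, T = ⌈b / ε ^ 2⌉₊ + 1 := ⟨_, rfl⟩
    have hT : 1 ≤ T := by omega
    have hT1 : (1 : ℝ) ≤ T := by exact_mod_cast hT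
    have hbT : b / ε ^ 2 ≤ T := by
      rw [hTdef]
      push_cast
      linarith [Nat.le_ceil (b / ε ^ 2)]
    have hTE : (T : ℝ) ≤ (b + 2) / ε ^ 2 := by
      have h1 := Nat.ceil_lt_add_one (show 0 ≤ b / ε ^ 2 by positivity)
      have h2 : 1 ≤ 1 / ε ^ 2 := (one_le_div hε2).mpr hε21
      rw [hTdef, add_div, show (2 : ℝ) / ε ^ 2 = 1 / ε ^ 2 + 1 / ε ^ 2 by ring]
      push_cast
      linarith
    have hδT : 0 < δ / T := by positivity
    have hδT1 : δ / T < 1 := (div_lt_one (by linarith)).mpr (by linarith)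
    obtain ⟨hεhat, hεhat2, hεhatΛ⟩ := epsHat_spec hΛ hρhat hε
    have hKle := hNle ε δ T hε hε1 hδ hδ1 hT hTE
    rw [← hκε] at hKle
    obtain ⟨K, hKdef⟩ : ∃ K : ℕ,
        K = ⌈iterBudget ((10 * c) ^ 4) (epsHat ρ ρhat D M σ ε) (δ / T)⌉₊ := ⟨_, rfl⟩
    have hKbudget : iterBudget ((10 * c) ^ 4) (epsHat ρ ρhat D M σ ε) (δ / T) ≤ K := by
      rw [hKdef]
      exact Nat.le_ceil _
    obtain ⟨hK1, hB1, hB2⟩ := hbudget _ _ K hεhat hδT hδT1 hKbudget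
    have hℓ : 0 ≤ Real.log (1 / (ε * δ)) :=
      Real.log_nonneg ((one_le_div (by positivity)).mpr (by nlinarith))
    refine ⟨T, K, hT, hTE.trans ?_, hKdef, ?_⟩
    · gcongr
      exact le_mul_of_one_le_right (by linarith) (by linarith)
    intro d X f hP Ξ _ P _ S hS Ω _ μ _ ξ hξ x0 hx0 hg0
    refine ⟨fun ω => ?_, fun ω t _ => ipcState_x_mem hP.convex hP.compact hK1 hx0 _ t, ?_⟩
    · rw [ipcState_queries]
      push_cast
      have hKN : (K : ℝ) ≤ (N + 1) / ε ^ 4 * (1 + Real.log (1 / (ε * δ))) ^ 3 := by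
        have h1 : (K : ℝ) < iterBudget ((10 * c) ^ 4) (epsHat ρ ρhat D M σ ε) (δ / T) + 1 := by
          rw [hKdef]
          exact Nat.ceil_lt_add_one (zero_le_one.trans (one_le_iterBudget hC hδT hδT1))
        have h2 : 1 ≤ 1 / ε ^ 4 * (1 + Real.log (1 / (ε * δ))) ^ 3 :=
          one_le_mul_of_one_le_of_one_le
            ((one_le_div (by positivity)).mpr (pow_le_one₀ hε.le hε1))
            (one_le_pow₀ (by linarith))
        rw [add_div, add_mul]
        linarith
      calc (T : ℝ) * K ≤ (b + 2) / ε ^ 2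
            * ((N + 1) / ε ^ 4 * (1 + Real.log (1 / (ε * δ))) ^ 3) := by gcongr
        _ = _ := by
            field_simp
    · refine (hP.measure_not_average_le hS hξ hm hρ hM hD hσ hρhat hρhat' hK1 hx0 hg0 hεhat2
        (δ := ENNReal.ofReal (δ / T)) (fun t x hx hg =>
          hP.measure_not_isApproxSolution_le hS hm hD hM hM0 hM1 hρ hσ hρhat hρhat' (hξ.row t) hx
            hg hK1 hδT hδT1 hB1 hB2) ?_).trans (le_of_eq ?_)
      · rw [← hΛdef] at hεhatΛ ⊢
        have h1 := mul_le_mul_of_nonneg_left hεhatΛ (Nat.cast_nonneg (α := ℝ) T)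
        have h2 : M * D + ρ / 2 * D ^ 2 + Λ = (ρhat - ρ) / 4 * b := by
          rw [hb]; field_simp
        have h3 : b ≤ T * ε ^ 2 := (div_le_iff₀ hε2).mp hbT
        have h4 : (ρhat - ρ) / 4 * b ≤ (ρhat - ρ) / 4 * (T * ε ^ 2) := by gcongr
        have h5 : Λ * ε ^ 2 ≤ Λ := mul_le_of_le_one_right hΛ hε21
        have h6 : 0 ≤ (ρhat - ρ) * ε ^ 2 := by positivity
        linarith
      · rw [← ENNReal.ofReal_natCast, ← ENNReal.ofReal_mul (Nat.cast_nonneg _)]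
        congr 1
        field_simp
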